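/- In a randomized distributed sketching scheme on $n$-vertex graphs, the vertices of the input graph $G$ are labeled with $n$ fixed labels. All parties share a random outcome $\omega$ drawn from an arbitrary probability space. For each vertex $v$ there is a player who sees only $v$, the set of labels of the neighbors of $v$, and $\omega$. All players simultaneously send one message each (the sketch, a finite bit string of arbitrary length) to a referee, who sees only the $n$ messages and $\omega$ and must decide whether $G$ is connected. The average sketch size is the sum of the lengths of the $n$ messages divided by $n$. Theorem. There are absolute constants $c>0$ and $n_0$ such that for every $n\ge n_0$ the following hold. (i) For every randomized distributed sketching scheme on $n$-vertex graphs in which, on every graph $G$, the referee correctly decides whether $G$ is connected with probability at least $3/4$ over $\omega$, there is a graph $G$ on which the expectation over $\omega$ of the average sketch size is at least $c\log^3 n$ bits. (ii) More strongly, there is a probability distribution $\mathcal D_n$ on $n$-vertex graphs, not depending on the scheme, such that every randomized distributed sketching scheme whose referee is correct with probability at least $3/4$ over $G\sim\mathcal D_n$ and an independent $\omega$ has expected average sketch size, over $G$ and $\omega$, at least $c\log^3 n$ bits. -/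

import Mathlib

open MeasureTheory
open scoped ENNReal

universe u

noncomputable section

/-- A randomized one-round distributed sketching scheme on `n`-vertex graphs with labels in `Fin n`.
The shared randomness is a point `ω` of an arbitrary probability space `Ω` (which may contain
independent parts serving as private randomness of the players). Player `v` sees its own label, the
set of labels of its neighbors and `ω`, and sends a finite bit string of arbitrary length. The
referee sees the `n` messages and `ω`, and answers `true` for connected or `false` for not
connected. -/
structure SketchingScheme (n : ℕ) where
  /-- the space of shared random outcomes -/
  Ω : Type u
  [measurableSpace : MeasurableSpace Ω]
  /-- the law of the shared randomness -/
  μ : Measure Ω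
  [isProbabilityMeasure : IsProbabilityMeasure μ]
  /-- the message of a player with a given label and a given neighborhood -/
  sketch : Fin n → Set (Fin n) → Ω → List Bool
  /-- the answer of the referee -/
  referee : (Fin n → List Bool) → Ω → Bool
  measurableSet_sketch : ∀ v N m, MeasurableSet {ω | sketch v N ω = m}
  measurableSet_referee : ∀ M, MeasurableSet {ω | referee M ω = true}

attribute [instance] SketchingScheme.measurableSpace SketchingScheme.isProbabilityMeasure

namespace SketchingScheme

variable {n : ℕ} (S : SketchingScheme.{u} n)

/-- The message sent by player `v` on input graph `G` and shared randomness `ω`. -/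
def message (G : SimpleGraph (Fin n)) (ω : S.Ω) (v : Fin n) : List Bool :=
  S.sketch v (G.neighborSet v) ω

/-- The answer of the referee on input graph `G` and shared randomness `ω`. -/
def output (G : SimpleGraph (Fin n)) (ω : S.Ω) : Bool :=
  S.referee (S.message G ω) ω

/-- The probability, over the shared randomness, that the referee correctly decides whether `G` is
connected. -/
def successProb (G : SimpleGraph (Fin n)) : ℝ≥0∞ :=
  S.μ {ω | S.output G ω = true ↔ G.Connected}

/-- The expectation, over the shared randomness, of the average message length in bits (possibly
infinite) on input graph `G`. -/
def expectedAverageSize (G : SimpleGraph (Fin n)) : ℝ≥0∞ :=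
  ∫⁻ ω, (∑ v : Fin n, ((S.message G ω v).length : ℝ≥0∞)) / (n : ℝ≥0∞) ∂S.μ

/-- The success probability when the input graph is drawn from the distribution `D`, independently
of the shared randomness. -/
def successProbOn (D : PMF (SimpleGraph (Fin n))) : ℝ≥0∞ :=
  ∑' G, D G * S.successProb G

/-- The expected average message length when the input graph is drawn from the distribution `D`,
independently of the shared randomness. -/
def expectedAverageSizeOn (D : PMF (SimpleGraph (Fin n))) : ℝ≥0∞ :=
  ∑' G, D G * S.expectedAverageSize G

end SketchingScheme

end

/-! A hard input is a chain of `k` stages carrying two strands. Each stage encodes a random bit by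
two units, which lead the strands straight on or cross them. One closing edge makes the graph
connected exactly when the bits have even parity (`hardGraph_connected_iff`). Parity amplifies
uncertainty: if the referee's views of a single unit under its two possible bits overlap by `δ₂`,
every stage costs a factor `1 - δ₂ ^ 2` (`abs_expect_prod_sideSign_mul_view_le`).

A unit has `s + 1` groups of `q` vertices. The vertices of one group are the middle vertices; each
has one neighbor in every other group. In the groups of a random set `Γ`, the revealed ones, that
neighbor is private. In the others it is one of few hubs, and the hubs are split into two sides
according to the terminal they are attached to. The bit is the side of one special middle vertex. A
middle vertex sees `s` labels that are uniform whatever `Γ` and its side are, so its message has to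
determine the side for every likely `Γ`.

Why this takes `log ^ 3 n` bits: fix the message function `f` of a middle vertex, and consider the
inputs with a given message and given labels on `Γ`. If this class is spread (no cylinder on
unrevealed coordinates is too dense), a second moment computation shows that random hub labels of
both sides hit it about equally often, so the message leaves the side uncertain
(`expect_abs_condAvg_sideSign_le`). Otherwise there is a dense cylinder, on whose coordinates `J`
the message carries about `log n` bits each. Treat `J` as revealed too, reveal some more groups at
random, and repeat for `L` rounds, about `log ^ 2 n` in number. If no round fails, at least `L / 2`
coordinates are captured, and a Kraft inequality requires about `γ ^ (L / 2)` messages, where `γ` is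
a power of `n` (`exists_spread_family`). Captures distort the law of the revealed set, but a
coordinate captured long ago would probably have been revealed anyway. The likelihood ratio is
therefore kept under control by pausing the captures whenever its logarithm exceeds a budget `κ = 2
* K`, where `K` is a small multiple of `log n`. Hence shorter messages meet a spread class with
probability at least a small inverse power of `n` (`expect_abs_condAvg_neighborLabels_le`).

The hubs also see sides, but they are few compared with the `q` middle vertices, so their messages
give away little about an average one of the independent sides (`expect_sum_sign_le`). An average
size bound must limit the messages of both roles, although in a hard input each role is played by a
small part of the vertices. The input distribution therefore also contains, with constant weight,
graphs in which all vertices of the units look like middle vertices and graphs in which almost all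
of them look like hubs (`sum_midMessage_le`, `sum_hubMessage_le`). Randomized schemes reduce to
deterministic ones by fixing the shared outcome (`exists_distribution_of_deterministic`), and
`sketchParameters_of_log` chooses the parameters. -/

noncomputable section

open scoped BigOperators
open Finset

/-! ### The reveal-and-capture process for a single input, and its change of measure. -/

section Chain

open scoped Classical

variable {I : Type*} [Fintype I]

/-- Probability that a set of revealed coordinates `Γ` becomes `X` after `d` rounds, when each
unrevealed coordinate stays unrevealed in a round with probability `y`. -/
def revealProb (y : ℝ) (d : ℕ) (Γ X : Finset I) : ℝ :=
  if Γ ⊆ X then (1 - y ^ d) ^ (X \ Γ).card * (y ^ d) ^ (Xᶜ).card else 0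

lemma revealProb_nonneg {y : ℝ} (hy0 : 0 ≤ y) (hy1 : y ≤ 1) (d : ℕ) (Γ X : Finset I) :
    0 ≤ revealProb y d Γ X := by
  unfold revealProb
  have : y ^ d ≤ 1 := pow_le_one₀ hy0 hy1
  split_ifs
  · have h1 : 0 ≤ 1 - y ^ d := by linarith
    positivity
  · exact le_rfl

lemma sum_Icc_pow_mul {I : Type*} (Γ X : Finset I) (h : Γ ⊆ X) (a b : ℝ) :
    ∑ Z ∈ Finset.Icc Γ X, a ^ (Z \ Γ).card * b ^ (X \ Z).card = (a + b) ^ (X \ Γ).card := by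
  rw [← Finset.sum_pow_mul_eq_add_pow]
  refine Finset.sum_nbij' (fun Z => Z \ Γ) (fun R => Γ ∪ R) ?_ ?_ ?_ ?_ ?_
  · intro Z hZ
    rw [Finset.mem_Icc] at hZ
    exact Finset.mem_powerset.2 (Finset.sdiff_subset_sdiff hZ.2 le_rfl)
  · intro R hR
    rw [Finset.mem_powerset] at hR
    exact Finset.mem_Icc.2 ⟨Finset.subset_union_left,
      Finset.union_subset h (hR.trans Finset.sdiff_subset)⟩
  · intro Z hZ
    rw [Finset.mem_Icc] at hZ
    exact Finset.union_sdiff_of_subset hZ.1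
  · intro R hR
    rw [Finset.mem_powerset] at hR
    ext i
    have := @hR i
    simp only [mem_sdiff, mem_union] at this ⊢
    tauto
  · intro Z hZ
    rw [Finset.mem_Icc] at hZ
    congr 2
    rw [← Finset.card_sdiff_of_subset (Finset.sdiff_subset_sdiff hZ.2 le_rfl)]
    congr 1
    ext i
    have := @hZ.1 i
    simp only [mem_sdiff]
    tauto

lemma sum_revealProb (y : ℝ) (d : ℕ) (Γ : Finset I) : ∑ X, revealProb y d Γ X = 1 := by
  have h := sum_Icc_pow_mul Γ Finset.univ (Finset.subset_univ _) (1 - y ^ d) (y ^ d)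
  rw [sub_add_cancel, one_pow] at h
  rw [← h]
  unfold revealProb
  rw [← Finset.sum_filter]
  refine Finset.sum_congr ?_ fun Z _ => ?_
  · ext; simp
  · rw [Finset.compl_eq_univ_sdiff]

/-- Markov property: a coordinate of `X \ Γ` is revealed at once, with probability `1 - y`, or
within the later rounds, with probability `y * (1 - y ^ d)`; the binomial theorem sums over both
options. -/
lemma sum_revealProb_mul (y : ℝ) (d : ℕ) (Γ X : Finset I) :
    ∑ Z, revealProb y 1 Γ Z * revealProb y d Z X = revealProb y (d + 1) Γ X := by
  by_cases hX : Γ ⊆ X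
  · have key : ∀ Z ∈ Finset.Icc Γ X, revealProb y 1 Γ Z * revealProb y d Z X
        = (y ^ (d + 1)) ^ (Xᶜ).card *
          ((1 - y) ^ (Z \ Γ).card * (y * (1 - y ^ d)) ^ (X \ Z).card) := by
      intro Z hZ
      rw [Finset.mem_Icc] at hZ
      have hc : (Zᶜ).card = (X \ Z).card + (Xᶜ).card := by
        rw [← Finset.card_union_of_disjoint]
        · congr 1
          ext i
          have := @hZ.2 i
          simp only [mem_compl, mem_union, mem_sdiff]
          tauto
        · rw [Finset.disjoint_left]
          intro i
          simp only [mem_compl, mem_sdiff]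
          tauto
      unfold revealProb
      rw [if_pos (show Γ ⊆ Z from hZ.1), if_pos (show Z ⊆ X from hZ.2), hc, pow_one, pow_add,
        pow_succ, mul_pow, mul_pow]
      ring
    have hs : ∑ Z, revealProb y 1 Γ Z * revealProb y d Z X
        = ∑ Z ∈ Finset.Icc Γ X, revealProb y 1 Γ Z * revealProb y d Z X := by
      symm
      refine Finset.sum_subset (Finset.subset_univ _) ?_
      intro Z _ hZ
      rw [Finset.mem_Icc, not_and_or] at hZ
      unfold revealProb
      rcases hZ with hZ | hZ
      · rw [if_neg (show ¬ Γ ⊆ Z from hZ), zero_mul]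
      · rw [if_neg (show ¬ Z ⊆ X from hZ), mul_zero]
    rw [hs, Finset.sum_congr rfl key, ← Finset.mul_sum, sum_Icc_pow_mul Γ X hX]
    unfold revealProb
    rw [if_pos hX, mul_comm]
    congr 2
    ring
  · have : revealProb y (d + 1) Γ X = 0 := by
      unfold revealProb; rw [if_neg hX]
    rw [this]
    refine Finset.sum_eq_zero fun Z _ => ?_
    unfold revealProb
    by_cases h1 : Γ ⊆ Z
    · rw [if_neg (show ¬ Z ⊆ X from fun h => hX (h1.trans h)), mul_zero]
    · rw [if_neg h1, zero_mul]

/-- The price of planting `J`: nature would have revealed it within `d` rounds with probability `(1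
- y ^ d) ^ J.card`, so after `d` rounds the planted law exceeds the natural one by at most the
inverse of this factor. -/
lemma revealProb_union_mul_le {y : ℝ} (hy0 : 0 ≤ y) (hy1 : y ≤ 1) (d : ℕ) (Γ J X : Finset I)
    (hJ : Disjoint J Γ) :
    (1 - y ^ d) ^ J.card * revealProb y d (Γ ∪ J) X ≤ revealProb y d Γ X := by
  by_cases h : Γ ∪ J ⊆ X
  · have hc : (X \ Γ).card = J.card + (X \ (Γ ∪ J)).card := by
      rw [← Finset.card_union_of_disjoint]
      · congr 1
        ext i
        have h1 := @h i
        have h2 := @Finset.disjoint_left _ J Γ |>.1 hJ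
        have h2 := @h2 i
        simp only [mem_union, mem_sdiff] at h1 ⊢
        tauto
      · rw [Finset.disjoint_left]
        intro i
        simp only [mem_sdiff, mem_union]
        tauto
    unfold revealProb
    rw [if_pos h, if_pos (Finset.subset_union_left.trans h), hc, pow_add, mul_assoc]
  · have : revealProb y d (Γ ∪ J) X = 0 := by unfold revealProb; rw [if_neg h]
    rw [this, mul_zero]
    exact revealProb_nonneg hy0 hy1 _ _ _

/-- Weighted sum of a list of counts. -/
def weightedSum : (ℕ → ℝ) → List ℕ → ℝ
  | _, [] => 0
  | w, a :: h => a * w 0 + weightedSum (fun d => w (d + 1)) h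

lemma weightedSum_nonneg {w : ℕ → ℝ} (hw : ∀ d, 0 ≤ w d) (h : List ℕ) :
    0 ≤ weightedSum w h := by
  induction h generalizing w with
  | nil => exact le_rfl
  | cons a h ih =>
    have := ih (w := fun d => w (d + 1)) fun d => hw _
    have h2 := hw 0
    simp only [weightedSum]
    positivity

lemma weightedSum_add (w w' : ℕ → ℝ) (h : List ℕ) :
    weightedSum (fun d => w d + w' d) h = weightedSum w h + weightedSum w' h := by
  induction h generalizing w w' with
  | nil => simp [weightedSum]
  | cons a h ih =>
    simp only [weightedSum]
    rw [ih (fun d => w (d + 1)) (fun d => w' (d + 1))]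
    ring

lemma weightedSum_le {w : ℕ → ℝ} {c : ℝ} (h : List ℕ) (hw : ∀ d < h.length, w d ≤ c) :
    weightedSum w h ≤ c * h.sum := by
  induction h generalizing w with
  | nil => simp [weightedSum]
  | cons a h ih =>
    have h1 := ih (w := fun d => w (d + 1)) fun d hd => hw _ (by simpa using hd)
    have h2 := hw 0 (by simp)
    simp only [weightedSum, List.sum_cons, Nat.cast_add]
    nlinarith [mul_le_mul_of_nonneg_left h2 (Nat.cast_nonneg a : (0 : ℝ) ≤ a)]

/-- A history of counts (most recent first) in which every round that started with cost at most `κ`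
found at least one element. -/
def IsProductive (w : ℕ → ℝ) (κ : ℝ) : List ℕ → Prop
  | [] => True
  | a :: h => (weightedSum w h ≤ κ → 1 ≤ a) ∧ IsProductive w κ h

/-- Amortization. A round without captures can occur only when the cost exceeds `κ`, while one
captured element contributes at most `∑ w ≤ κ` to the costs of all later rounds together. So idle
rounds are at most as many as captured elements, and so are the remaining rounds. -/
lemma IsProductive.length_le {w : ℕ → ℝ} {κ : ℝ} (hκ : 0 < κ) (hw0 : ∀ d, 0 ≤ w d) {L : ℕ}
    (hw : ∑ d ∈ range L, w d ≤ κ) (h : List ℕ) (hL : h.length ≤ L + 1) (hp : IsProductive w κ h) :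
    h.length ≤ 2 * h.sum := by
  have key : ∀ h : List ℕ, IsProductive w κ h →
      κ * h.length ≤ κ * h.sum + weightedSum (fun d => ∑ e ∈ range d, w e) h := by
    intro h
    induction h with
    | nil => intro _; simp [weightedSum]
    | cons a h ih =>
      intro hp
      have h1 := ih hp.2
      have h2 : weightedSum (fun d => ∑ e ∈ range (d + 1), w e) h
          = weightedSum (fun d => ∑ e ∈ range d, w e) h + weightedSum w h := by
        rw [← weightedSum_add]
        congr 1
        funext d
        rw [Finset.sum_range_succ]
      simp only [weightedSum, Finset.range_zero, Finset.sum_empty, mul_zero, zero_add,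
        List.length_cons, List.sum_cons, Nat.cast_add, Nat.cast_one]
      rw [h2]
      by_cases hc : weightedSum w h ≤ κ
      · have h3 : (1 : ℝ) ≤ a := by exact_mod_cast hp.1 hc
        have h4 := weightedSum_nonneg hw0 h
        nlinarith
      · push Not at hc
        have h3 : (0 : ℝ) ≤ a := Nat.cast_nonneg a
        nlinarith
  have h1 := key h hp
  have h2 : weightedSum (fun d => ∑ e ∈ range d, w e) h ≤ κ * h.sum := by
    refine weightedSum_le h fun d hd => le_trans ?_ hw
    exact Finset.sum_le_sum_of_subset_of_nonneg (by simp; omega) fun i _ _ => hw0 i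
  have h3 : κ * (h.length : ℝ) ≤ κ * (2 * h.sum : ℕ) := by
    rw [Nat.cast_mul, Nat.cast_two]; linarith
  exact_mod_cast le_of_mul_le_mul_left h3 hκ

/-- Expectation of `γ ^ (number of captured coordinates)`, on the event that no round fails, over the
next `r` rounds, from the revealed set `Γ` and the history `h`. In each round a random set is
revealed, and then, if the cost of the history permits, the set `J Γ'` is captured. -/
def chainValue (J : Finset I → Finset I) (y : ℝ) (w : ℕ → ℝ) (κ γ : ℝ) :
    ℕ → Finset I → List ℕ → ℝ
  | 0, _, h => γ ^ h.sum
  | r + 1, Γ, h => ∑ Z, revealProb y 1 Γ Z *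
      if weightedSum w h ≤ κ then
        if J Z = ∅ then 0 else chainValue J y w κ γ r (Z ∪ J Z) ((J Z).card :: h)
      else chainValue J y w κ γ r Z (0 :: h)

lemma chainValue_nonneg {J : Finset I → Finset I} {y : ℝ} (hy0 : 0 ≤ y) (hy1 : y ≤ 1) (w : ℕ → ℝ)
    (κ : ℝ) {γ : ℝ} (hγ : 0 ≤ γ) (r : ℕ) (Γ : Finset I) (h : List ℕ) :
    0 ≤ chainValue J y w κ γ r Γ h := by
  induction r generalizing Γ h with
  | zero => exact pow_nonneg hγ _
  | succ r ih =>
    simp only [chainValue]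
    refine Finset.sum_nonneg fun Z _ => mul_nonneg (revealProb_nonneg hy0 hy1 _ _ _) ?_
    split_ifs
    · exact le_rfl
    · exact ih _ _
    · exact ih _ _

/-- Along every path that does not fail the history stays productive, so at the end at least `L / 2`
coordinates are captured and each surviving path carries a factor of at least `γ ^ (L / 2)`. -/
lemma mul_chainValue_one_le {J : Finset I → Finset I} {y : ℝ} (hy0 : 0 ≤ y) (hy1 : y ≤ 1)
    {w : ℕ → ℝ} {κ γ : ℝ} (hγ : 1 ≤ γ) (hκ : 0 < κ) (hw0 : ∀ d, 0 ≤ w d) {L : ℕ}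
    (hw : ∑ d ∈ range L, w d ≤ κ) (r : ℕ) (Γ : Finset I) (h : List ℕ)
    (hL : r + h.length = L) (hp : IsProductive w κ h) :
    γ ^ (L / 2) * chainValue J y w κ 1 r Γ h ≤ chainValue J y w κ γ r Γ h := by
  induction r generalizing Γ h with
  | zero =>
    simp only [chainValue, one_pow, mul_one]
    refine pow_le_pow_right₀ hγ ?_
    have := hp.length_le hκ hw0 hw h (by omega)
    omega
  | succ r ih =>
    simp only [chainValue]
    rw [Finset.mul_sum]
    refine Finset.sum_le_sum fun Z _ => ?_
    rw [mul_left_comm]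
    refine mul_le_mul_of_nonneg_left ?_ (revealProb_nonneg hy0 hy1 _ _ _)
    split_ifs with h1 h2
    · simp
    · refine ih _ _ (by simp; omega) ⟨fun _ => ?_, hp⟩
      exact Finset.card_pos.2 (Finset.nonempty_of_ne_empty h2)
    · exact ih _ _ (by simp; omega) ⟨fun h3 => absurd h3 h1, hp⟩

lemma sum_mul_const_mul_sum {α β : Type*} [Fintype α] [Fintype β] (p : α → ℝ) (q : α → β → ℝ)
    (c : β → ℝ) (E : ℝ) :
    ∑ a, p a * (E * ∑ b, q a b * c b) = E * ∑ b, (∑ a, p a * q a b) * c b := by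
  simp_rw [Finset.sum_mul, Finset.mul_sum]
  rw [Finset.sum_comm]
  refine Finset.sum_congr rfl fun b _ => Finset.sum_congr rfl fun a _ => ?_
  ring

lemma one_sub_sum_add_mul_sum {α : Type*} [Fintype α] (p A B : α → ℝ) (E : ℝ)
    (hp : ∑ a, p a = 1) :
    1 - (∑ a, p a * A a + E * ∑ a, p a * B a) = ∑ a, p a * (1 - (A a + E * B a)) := by
  conv_lhs => rw [← hp]
  rw [Finset.mul_sum, ← Finset.sum_add_distrib, ← Finset.sum_sub_distrib]
  refine Finset.sum_congr rfl fun a _ => ?_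
  ring

/-- Union bound over the rounds for failure, after a change of measure. A failure counts only while
the cost is at most `κ`, and the negative cost is exactly the logarithm of the factors in
`revealProb_union_mul_le`. So the failure probability in a round is at most `exp κ` times the
probability that the purely random revealed set fails. The shift by `i` in the weights evaluates the
cost of the present history `i` rounds later. -/
lemma chainValue_one_ge {J : Finset I → Finset I} (hJ : ∀ Γ, Disjoint (J Γ) Γ) {y : ℝ}
    (hy0 : 0 ≤ y) (hy1 : y < 1) {κ : ℝ} (r : ℕ) (Γ : Finset I) (h : List ℕ) :
    1 - ∑ i ∈ range r, Real.exp (κ - weightedSum (fun d => -Real.log (1 - y ^ (d + i + 1))) h) *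
        ∑ X, revealProb y (i + 1) Γ X * (if J X = ∅ then 1 else 0)
      ≤ chainValue J y (fun d => -Real.log (1 - y ^ (d + 1))) κ 1 r Γ h := by
  have hpow : ∀ i : ℕ, 0 < 1 - y ^ (i + 1) := fun i => by
    have := pow_lt_one₀ hy0 hy1 (Nat.succ_ne_zero i)
    simp only [Nat.succ_eq_add_one] at this
    linarith
  induction r generalizing Γ h with
  | zero => simp [chainValue]
  | succ r ih =>
    simp only [chainValue]
    rw [Finset.sum_range_succ']
    have hsplit : ∑ i ∈ range r,
        Real.exp (κ - weightedSum (fun d => -Real.log (1 - y ^ (d + (i + 1) + 1))) h) *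
          ∑ X, revealProb y (i + 1 + 1) Γ X * (if J X = ∅ then 1 else 0)
        = ∑ Z, revealProb y 1 Γ Z * ∑ i ∈ range r,
          Real.exp (κ - weightedSum (fun d => -Real.log (1 - y ^ (d + (i + 1) + 1))) h) *
          ∑ X, revealProb y (i + 1) Z X * (if J X = ∅ then 1 else 0) := by
      symm
      rw [Finset.sum_congr rfl fun Z _ => Finset.mul_sum _ _ _, Finset.sum_comm]
      refine Finset.sum_congr rfl fun i _ => ?_
      rw [sum_mul_const_mul_sum]
      simp_rw [sum_revealProb_mul]
    rw [hsplit]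
    simp only [zero_add]
    rw [one_sub_sum_add_mul_sum _ _ _ _ (sum_revealProb y 1 Γ)]
    refine Finset.sum_le_sum fun Z _ => ?_
    refine mul_le_mul_of_nonneg_left ?_ (revealProb_nonneg hy0 hy1.le _ _ _)
    have hnn : ∀ i ∈ range r, 0 ≤
        Real.exp (κ - weightedSum (fun d => -Real.log (1 - y ^ (d + (i + 1) + 1))) h) *
          ∑ X, revealProb y (i + 1) Z X * (if J X = ∅ then 1 else 0) := fun i _ =>
      mul_nonneg (Real.exp_pos _).le (Finset.sum_nonneg fun X _ =>
        mul_nonneg (revealProb_nonneg hy0 hy1.le _ _ _) (by split_ifs <;> simp))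
    by_cases h1 : weightedSum (fun d => -Real.log (1 - y ^ (d + 1))) h ≤ κ
    on_goal 1 => by_cases h2 : J Z = ∅
    · rw [if_pos h1, if_pos h2, if_pos h2]
      have h3 := Finset.sum_nonneg hnn
      -- Failure now: the `i = 0` term alone already makes the lower bound nonpositive.
      have h4 : 1 ≤ Real.exp (κ - weightedSum (fun d => -Real.log (1 - y ^ (d + 0 + 1))) h) := by
        rw [Real.one_le_exp_iff]
        simpa using h1
      linarith
    · rw [if_pos h1, if_neg h2, if_neg h2]
      refine le_trans ?_ (ih (Z ∪ J Z) ((J Z).card :: h))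
      rw [mul_zero, add_zero]
      refine sub_le_sub_left (Finset.sum_le_sum fun i _ => ?_) _
      simp only [weightedSum, zero_add]
      -- Prepending the capture to the history produces precisely the factor that pays for planting
      -- `J Z`.
      have e1 : Real.exp (κ - ((J Z).card * -Real.log (1 - y ^ (i + 1)) +
          weightedSum (fun d => -Real.log (1 - y ^ (d + 1 + i + 1))) h))
          = Real.exp (κ - weightedSum (fun d => -Real.log (1 - y ^ (d + (i + 1) + 1))) h)
            * (1 - y ^ (i + 1)) ^ (J Z).card := by
        have e2 : (1 - y ^ (i + 1)) ^ (J Z).card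
            = Real.exp ((J Z).card * Real.log (1 - y ^ (i + 1))) := by
          rw [Real.exp_nat_mul, Real.exp_log (hpow i)]
        rw [e2, ← Real.exp_add]
        congr 1
        have : (fun d => -Real.log (1 - y ^ (d + 1 + i + 1)))
            = (fun d => -Real.log (1 - y ^ (d + (i + 1) + 1))) := by
          funext d; rw [show d + 1 + i = d + (i + 1) by ring]
        rw [this]; ring
      rw [e1, mul_assoc]
      refine mul_le_mul_of_nonneg_left ?_ (Real.exp_pos _).le
      rw [Finset.mul_sum]
      refine Finset.sum_le_sum fun X _ => ?_
      rw [← mul_assoc]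
      refine mul_le_mul_of_nonneg_right ?_ (by split_ifs <;> simp)
      exact revealProb_union_mul_le hy0 hy1.le _ _ _ _ (hJ Z)
    · rw [if_neg h1]
      refine le_trans ?_ (ih Z (0 :: h))
      simp only [weightedSum, Nat.cast_zero, zero_mul, zero_add]
      have : ∀ i, (fun d => -Real.log (1 - y ^ (d + 1 + i + 1)))
            = (fun d => -Real.log (1 - y ^ (d + (i + 1) + 1))) := by
        intro i; funext d; rw [show d + 1 + i = d + (i + 1) by ring]
      simp_rw [this]
      refine sub_le_sub_left ?_ _
      refine le_add_of_nonneg_right (mul_nonneg (Real.exp_pos _).le ?_)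
      split_ifs <;> simp

end Chain

/-! ### Spread decompositions of message classes and the Kraft inequality for captures. -/

section Capture

set_option linter.unusedSectionVars false

open scoped Classical

variable {I Y 𝓜 : Type*} [Fintype I] [Fintype Y]

/-- The members of `𝒜` that agree with `z` on the coordinates in `J`. -/
def coordCylinder (𝒜 : Finset (I → Y)) (J : Finset I) (z : I → Y) : Finset (I → Y) :=
  𝒜.filter fun x => ∀ g ∈ J, x g = z g

lemma mem_coordCylinder {𝒜 : Finset (I → Y)} {J : Finset I} {z x : I → Y} :
    x ∈ coordCylinder 𝒜 J z ↔ x ∈ 𝒜 ∧ ∀ g ∈ J, x g = z g := by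
  simp [coordCylinder]

/-- No nonempty cylinder on coordinates outside `Γ` has relative density above `θ ^ |J|`. -/
def IsSpread (θ : ℝ) (Γ : Finset I) (𝒜 : Finset (I → Y)) : Prop :=
  ∀ J : Finset I, J.Nonempty → Disjoint J Γ → ∀ z ∈ 𝒜,
    ((coordCylinder 𝒜 J z).card : ℝ) ≤ θ ^ J.card * 𝒜.card

/-- Greedy removal: as long as the rest is larger than `δ * m` and not spread, cut out a cylinder
violating spreadness. Its density in the rest exceeds `θ ^ |J|`, so the piece has more than `(θ * δ)
^ |J| * m` elements. The last clause uses this in the form needed for Kraft: a cost of at most `c *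
(θ * δ) ^ |J|` on each cylinder can be charged to the size of the piece, and the pieces are
disjoint. -/
lemma exists_spread_decomposition {θ δ m : ℝ} (hθ : 0 < θ) (hδ : 0 ≤ δ) (hδ1 : δ ≤ 1) (hm : 0 < m)
    (Γ : Finset I) (𝒮 : Finset (I → Y)) :
    ∃ (U Lo : Finset (I → Y)) (J : (I → Y) → Finset I), U ⊆ 𝒮 ∧ IsSpread θ Γ U ∧
      (Lo.card : ℝ) ≤ δ * m ∧
      (∀ x ∈ 𝒮, x ∉ U → x ∉ Lo → (J x).Nonempty) ∧ (∀ x, Disjoint (J x) Γ) ∧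
      ∀ (R : Finset I → (I → Y) → ℝ) (c : ℝ), 0 ≤ c →
        (∀ J' : Finset I, Disjoint J' Γ → ∀ z, ∑ x ∈ coordCylinder 𝒮 J' z, R J' x
          ≤ c * (θ * δ) ^ J'.card) → (∀ J' x, 0 ≤ R J' x) →
        ∑ x ∈ 𝒮 with x ∉ U ∧ x ∉ Lo, R (J x) x ≤ c * 𝒮.card / m := by
  induction 𝒮 using Finset.strongInduction with
  | H 𝒮 ih =>
  by_cases h1 : (𝒮.card : ℝ) ≤ δ * m
  · refine ⟨∅, 𝒮, fun _ => ∅, by simp, ?_, h1, ?_, by simp, ?_⟩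
    · intro J _ _ z hz; simp at hz
    · intro x hx _ hx2; exact absurd hx hx2
    · intro R c hc _ _
      rw [Finset.filter_false_of_mem (by intro x hx; tauto)]
      simp only [Finset.sum_empty]
      positivity
  by_cases h2 : IsSpread θ Γ 𝒮
  · refine ⟨𝒮, ∅, fun _ => ∅, le_rfl, h2, by simpa using by positivity, ?_, by simp, ?_⟩
    · intro x hx hx2; exact absurd hx hx2
    · intro R c hc _ _
      rw [Finset.filter_false_of_mem (by intro x hx; tauto)]
      simp only [Finset.sum_empty]
      positivity
  unfold IsSpread at h2
  push Not at h2
  push Not at h1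
  obtain ⟨J₀, hJ₀, hdisj, z, hz, hcard⟩ := h2
  set P := coordCylinder 𝒮 J₀ z with hP
  have hPS : P ⊆ 𝒮 := Finset.filter_subset _ _
  have hzP : z ∈ P := mem_coordCylinder.2 ⟨hz, fun _ _ => rfl⟩
  obtain ⟨U, Lo, J, hU, hspread, hLo, hne, hd, hR⟩ :=
    ih (𝒮 \ P) (Finset.sdiff_ssubset hPS ⟨z, hzP⟩)
  refine ⟨U, Lo \ P, fun x => if x ∈ P then J₀ else J x, hU.trans Finset.sdiff_subset, hspread,
    le_trans (by exact_mod_cast Finset.card_le_card Finset.sdiff_subset) hLo, ?_, ?_, ?_⟩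
  · intro x hx hxU hxL
    by_cases hxP : x ∈ P
    · simpa [hxP] using hJ₀
    · simp only [hxP, if_false]
      exact hne x (Finset.mem_sdiff.2 ⟨hx, hxP⟩) hxU
        (fun h => hxL (Finset.mem_sdiff.2 ⟨h, hxP⟩))
  · intro x
    by_cases hxP : x ∈ P
    · simpa [hxP] using hdisj
    · simpa [hxP] using hd x
  · intro R c hc hcyl hRnn
    have hA : ∑ x ∈ P, R J₀ x ≤ c * P.card / m := by
      refine (hcyl J₀ hdisj z).trans ?_
      rw [mul_div_assoc]
      refine mul_le_mul_of_nonneg_left ?_ hc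
      rw [le_div_iff₀ hm, mul_pow]
      -- Only one factor `δ` is available from the stopping rule; it is weakened to one per
      -- coordinate so that the gain is multiplicative in `|J|`.
      have e1 : δ ^ J₀.card ≤ δ := by
        calc δ ^ J₀.card ≤ δ ^ 1 := pow_le_pow_of_le_one hδ hδ1 (Finset.card_pos.2 hJ₀)
          _ = δ := pow_one δ
      have e2 : 0 < θ ^ J₀.card := by positivity
      calc θ ^ J₀.card * δ ^ J₀.card * m ≤ θ ^ J₀.card * δ * m := by gcongr
        _ = θ ^ J₀.card * (δ * m) := by ring
        _ ≤ θ ^ J₀.card * 𝒮.card := by gcongr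
        _ ≤ P.card := hcard.le
    have hB := hR R c hc (fun J' hJ' z' => le_trans ?_ (hcyl J' hJ' z')) hRnn
    · have hsub : (𝒮.filter fun x => x ∉ U ∧ x ∉ Lo \ P)
          = P ∪ ((𝒮 \ P).filter fun x => x ∉ U ∧ x ∉ Lo) := by
        ext x
        have h3 := @hU x
        have h4 := @hPS x
        simp only [mem_filter, mem_sdiff, mem_union] at h3 ⊢
        tauto
      rw [hsub, Finset.sum_union]
      · have hA' : ∑ x ∈ P, R (if x ∈ P then J₀ else J x) x = ∑ x ∈ P, R J₀ x :=
          Finset.sum_congr rfl fun x hx => by rw [if_pos hx]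
        have hB' : ∑ x ∈ (𝒮 \ P) with x ∉ U ∧ x ∉ Lo, R (if x ∈ P then J₀ else J x) x
            = ∑ x ∈ (𝒮 \ P) with x ∉ U ∧ x ∉ Lo, R (J x) x :=
          Finset.sum_congr rfl fun x hx => by
            rw [if_neg (Finset.mem_sdiff.1 (Finset.mem_filter.1 hx).1).2]
        rw [hA', hB']
        have hcd : ((𝒮 \ P).card : ℝ) = 𝒮.card - P.card := by
          rw [Finset.card_sdiff_of_subset hPS, Nat.cast_sub (Finset.card_le_card hPS)]
        rw [hcd] at hB
        calc _ ≤ c * P.card / m + c * (𝒮.card - P.card) / m := add_le_add hA hB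
          _ = c * 𝒮.card / m := by ring
      · rw [Finset.disjoint_left]
        intro x hx hx2
        exact (Finset.mem_sdiff.1 (Finset.mem_filter.1 hx2).1).2 hx
    · refine Finset.sum_le_sum_of_subset_of_nonneg ?_ fun x _ _ => hRnn _ _
      intro x hx
      rw [mem_coordCylinder] at hx ⊢
      exact ⟨Finset.sdiff_subset hx.1, hx.2⟩

/-- The inputs with the same message as `x` under `f` that agree with `x` on `Γ`. -/
def messageClass (f : (I → Y) → 𝓜) (Γ : Finset I) (x : I → Y) : Finset (I → Y) :=
  Finset.univ.filter fun x' => f x' = f x ∧ ∀ g ∈ Γ, x' g = x g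

lemma mem_messageClass {f : (I → Y) → 𝓜} {Γ : Finset I} {x x' : I → Y} :
    x' ∈ messageClass f Γ x ↔ f x' = f x ∧ ∀ g ∈ Γ, x' g = x g := by
  simp [messageClass]

lemma messageClass_eq {f : (I → Y) → 𝓜} {Γ : Finset I} {x x' : I → Y}
    (h : x' ∈ messageClass f Γ x) : messageClass f Γ x' = messageClass f Γ x := by
  rw [mem_messageClass] at h
  ext z
  rw [mem_messageClass, mem_messageClass, h.1]
  refine and_congr_right fun _ => ⟨fun h2 g hg => ?_, fun h2 g hg => ?_⟩
  · rw [h2 g hg, h.2 g hg]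
  · rw [h2 g hg, h.2 g hg]

lemma self_mem_messageClass (f : (I → Y) → 𝓜) (Γ : Finset I) (x : I → Y) :
    x ∈ messageClass f Γ x := mem_messageClass.2 ⟨rfl, fun _ _ => rfl⟩

lemma card_agree (Γ : Finset I) (z : I → Y) :
    (Finset.univ.filter fun x : I → Y => ∀ g ∈ Γ, x g = z g).card
      = Fintype.card Y ^ (Fintype.card I - Γ.card) := by
  have : (Finset.univ.filter fun x : I → Y => ∀ g ∈ Γ, x g = z g)
      = Fintype.piFinset fun g => if g ∈ Γ then {z g} else Finset.univ := by
    ext x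
    simp only [mem_filter, mem_univ, true_and, Fintype.mem_piFinset]
    refine forall_congr' fun g => ?_
    by_cases hg : g ∈ Γ <;> simp [hg]
  rw [this, Fintype.card_piFinset]
  have : ∀ g, (if g ∈ Γ then ({z g} : Finset Y) else Finset.univ).card
      = if g ∈ Γᶜ then Fintype.card Y else 1 := by
    intro g
    by_cases hg : g ∈ Γ <;> simp [hg]
  simp_rw [this]
  rw [Finset.prod_ite_mem, Finset.univ_inter, Finset.prod_const, Finset.card_compl]

/-- The cylinder on `Γ` is partitioned into cylinders on the larger set `Γ'`. Double counting pairs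
that agree on `Γ'` avoids naming the parts. -/
lemma sum_agree_le [Nonempty Y] (Γ Γ' : Finset I) (hΓ : Γ ⊆ Γ') (z : I → Y) (F : (I → Y) → ℝ)
    {c : ℝ} (hF : ∀ z' : I → Y, ∑ x with ∀ g ∈ Γ', x g = z' g, F x
      ≤ c * (Fintype.card Y : ℝ) ^ (Fintype.card I - Γ'.card)) :
    ∑ x with ∀ g ∈ Γ, x g = z g, F x ≤ c * (Fintype.card Y : ℝ) ^ (Fintype.card I - Γ.card) := by
  have hQ : (0 : ℝ) < (Fintype.card Y : ℝ) ^ (Fintype.card I - Γ'.card) := by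
    have := Fintype.card_pos (α := Y)
    positivity
  refine le_of_mul_le_mul_right ?_ hQ
  have h1 : (∑ x with ∀ g ∈ Γ, x g = z g, F x) * (Fintype.card Y : ℝ) ^ (Fintype.card I - Γ'.card)
      = ∑ x : I → Y with ∀ g ∈ Γ, x g = z g, ∑ x' : I → Y with ∀ g ∈ Γ', x' g = x g, F x' := by
    rw [Finset.sum_comm' (t' := Finset.univ.filter fun x : I → Y => ∀ g ∈ Γ, x g = z g)
      (s' := fun x' => Finset.univ.filter fun x : I → Y => ∀ g ∈ Γ', x g = x' g), Finset.sum_mul]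
    · refine Finset.sum_congr rfl fun x' _ => ?_
      rw [Finset.sum_const, card_agree, nsmul_eq_mul, Nat.cast_pow, mul_comm]
    · intro x x'
      simp only [mem_filter, mem_univ, true_and]
      constructor
      · rintro ⟨h1, h2⟩
        exact ⟨fun g hg => (h2 g hg).symm, fun g hg => (h2 g (hΓ hg)).trans (h1 g hg)⟩
      · rintro ⟨h1, h2⟩
        exact ⟨fun g hg => (h1 g (hΓ hg)).trans (h2 g hg), fun g hg => (h1 g hg).symm⟩
  rw [h1]
  calc _ ≤ ∑ x : I → Y with ∀ g ∈ Γ, x g = z g,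
        c * (Fintype.card Y : ℝ) ^ (Fintype.card I - Γ'.card) :=
        Finset.sum_le_sum fun x _ => hF x
    _ = _ := by
      rw [Finset.sum_const, card_agree, nsmul_eq_mul, Nat.cast_pow]
      ring

/-- Kraft inequality: with reward `γ = |Y| * (θ * δ)` per captured coordinate, the inputs sharing
one message carry total value at most the number of all inputs (for `Γ = ∅` and no history).
Capturing `J` earns `γ ^ |J|`, but restricts the sum to a cylinder smaller by `|Y| ^ |J|`; what
remains is `(θ * δ) ^ |J|`, which the decomposition of the class absorbs. -/
lemma sum_chainValue_le [Nonempty Y] {f : (I → Y) → 𝓜} {J : Finset I → (I → Y) → Finset I}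
    {γ θ δ : ℝ} (hγ : γ = Fintype.card Y * (θ * δ)) (hγ1 : 0 ≤ γ)
    (hJ : ∀ Γ z (R : Finset I → (I → Y) → ℝ) (c : ℝ), 0 ≤ c →
      (∀ J' : Finset I, Disjoint J' Γ → ∀ z', ∑ x ∈ coordCylinder (messageClass f Γ z) J' z', R J' x
        ≤ c * (θ * δ) ^ J'.card) → (∀ J' x, 0 ≤ R J' x) →
      ∑ x ∈ messageClass f Γ z with (J Γ x).Nonempty, R (J Γ x) x ≤ c)
    {y : ℝ} (hy0 : 0 ≤ y) (hy1 : y ≤ 1) (w : ℕ → ℝ) (κ : ℝ) (M : 𝓜)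
    (r : ℕ) (Γ : Finset I) (h : List ℕ) (z : I → Y) :
    ∑ x with ∀ g ∈ Γ, x g = z g,
      (if f x = M then chainValue (fun Γ => J Γ x) y w κ γ r Γ h else 0)
      ≤ γ ^ h.sum * (Fintype.card Y : ℝ) ^ (Fintype.card I - Γ.card) := by
  have hQpos : (0 : ℝ) < Fintype.card Y := by exact_mod_cast Fintype.card_pos (α := Y)
  have hnn : ∀ r Γ h x, 0 ≤ chainValue (fun Γ => J Γ x) y w κ γ r Γ h := fun r Γ h x =>
    chainValue_nonneg hy0 hy1 w κ hγ1 r Γ h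
  induction r generalizing Γ h z with
  | zero =>
    simp only [chainValue]
    calc _ ≤ ∑ x : I → Y with ∀ g ∈ Γ, x g = z g, γ ^ h.sum :=
          Finset.sum_le_sum fun x _ => by split_ifs <;> [exact le_rfl; positivity]
      _ = _ := by
        rw [Finset.sum_const, card_agree, nsmul_eq_mul, Nat.cast_pow]
        ring
  | succ r ih =>
    have hswap : ∑ x with ∀ g ∈ Γ, x g = z g,
        (if f x = M then chainValue (fun Γ => J Γ x) y w κ γ (r + 1) Γ h else 0)
        = ∑ Z, revealProb y 1 Γ Z * ∑ x with ∀ g ∈ Γ, x g = z g, (if f x = M then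
          (if weightedSum w h ≤ κ then
            if J Z x = ∅ then 0
            else chainValue (fun Γ => J Γ x) y w κ γ r (Z ∪ J Z x) ((J Z x).card :: h)
          else chainValue (fun Γ => J Γ x) y w κ γ r Z (0 :: h)) else 0) := by
      simp_rw [Finset.mul_sum]
      rw [Finset.sum_comm]
      refine Finset.sum_congr rfl fun x _ => ?_
      by_cases hM : f x = M
      · simp only [hM, if_true, chainValue]
      · simp only [hM, if_false, mul_zero, Finset.sum_const_zero]
    rw [hswap]
    have hbound : ∀ Z, Γ ⊆ Z → ∑ x with ∀ g ∈ Γ, x g = z g, (if f x = M then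
          (if weightedSum w h ≤ κ then
            if J Z x = ∅ then 0
            else chainValue (fun Γ => J Γ x) y w κ γ r (Z ∪ J Z x) ((J Z x).card :: h)
          else chainValue (fun Γ => J Γ x) y w κ γ r Z (0 :: h)) else 0)
        ≤ γ ^ h.sum * (Fintype.card Y : ℝ) ^ (Fintype.card I - Γ.card) := by
      intro Z hZ
      refine sum_agree_le Γ Z hZ z _ fun z' => ?_
      by_cases hc : weightedSum w h ≤ κ
      · simp only [hc, if_true]
        by_cases hex : ∃ z₀ : I → Y, f z₀ = M ∧ ∀ g ∈ Z, z₀ g = z' g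
        · obtain ⟨z₀, hz₀, hz₀'⟩ := hex
          have hcls : messageClass f Z z₀
              = Finset.univ.filter fun x : I → Y => (∀ g ∈ Z, x g = z' g) ∧ f x = M := by
            ext x
            simp only [mem_messageClass, mem_filter, mem_univ, true_and, hz₀]
            rw [and_comm]
            refine and_congr_left fun _ => forall₂_congr fun g hg => ?_
            rw [hz₀' g hg]
          have := hJ Z z₀ (fun J' x =>
              chainValue (fun Γ => J Γ x) y w κ γ r (Z ∪ J') (J'.card :: h))
            (γ ^ h.sum * (Fintype.card Y : ℝ) ^ (Fintype.card I - Z.card)) (by positivity)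
            (fun J' hJ' z'' => ?_) (fun J' x => hnn _ _ _ _)
          · refine le_trans (le_of_eq ?_) this
            rw [hcls, Finset.sum_filter, Finset.sum_filter, Finset.sum_filter]
            refine Finset.sum_congr rfl fun x _ => ?_
            rw [Finset.sum_filter] at *
            by_cases e1 : ∀ g ∈ Z, x g = z' g <;> by_cases e2 : f x = M <;>
              by_cases e3 : J Z x = ∅ <;> simp [e1, e2, e3, Finset.nonempty_iff_ne_empty]
          -- Fixing `z'` on `Z` and `z''` on the disjoint set `J'` is a single condition on `Z ∪
          -- J'`, to which the induction hypothesis applies.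
          · let zz : I → Y := fun g => if g ∈ J' then z'' g else z' g
            have e := ih (Z ∪ J') (J'.card :: h) zz
            have e2 : coordCylinder (messageClass f Z z₀) J' z''
                = (Finset.univ.filter fun x : I → Y => ∀ g ∈ Z ∪ J', x g = zz g).filter
                  fun x => f x = M := by
              ext x
              rw [mem_coordCylinder, hcls]
              simp only [mem_filter, mem_univ, true_and, mem_union, zz]
              have hd : ∀ g ∈ Z, g ∉ J' := fun g hg hg' =>
                (Finset.disjoint_left.1 hJ' hg') hg
              constructor
              · rintro ⟨⟨a, b⟩, c⟩
                refine ⟨?_, b⟩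
                rintro g (hg | hg)
                · rw [if_neg (hd g hg)]; exact a g hg
                · rw [if_pos hg]; exact c g hg
              · rintro ⟨a, b⟩
                refine ⟨⟨fun g hg => ?_, b⟩, fun g hg => ?_⟩
                · have := a g (Or.inl hg); rwa [if_neg (hd g hg)] at this
                · have := a g (Or.inr hg); rwa [if_pos hg] at this
            rw [e2, Finset.sum_filter]
            refine e.trans (le_of_eq ?_)
            have hcard : (Z ∪ J').card = Z.card + J'.card :=
              Finset.card_union_of_disjoint hJ'.symm
            have hle : Z.card + J'.card ≤ Fintype.card I := by
              rw [← hcard]; exact Finset.card_le_univ _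
            rw [List.sum_cons, hcard]
            have e3 : (Fintype.card Y : ℝ) ^ (Fintype.card I - Z.card)
                = (Fintype.card Y : ℝ) ^ (Fintype.card I - (Z.card + J'.card))
                  * (Fintype.card Y : ℝ) ^ J'.card := by
              rw [← pow_add]; congr 1; omega
            have e4 : γ ^ J'.card = (Fintype.card Y : ℝ) ^ J'.card * (θ * δ) ^ J'.card := by
              rw [hγ, mul_pow]
            rw [e3, pow_add, e4]
            ring
        · rw [Finset.sum_eq_zero]
          · positivity
          · intro x hx
            rw [if_neg]
            intro hM
            exact hex ⟨x, hM, (Finset.mem_filter.1 hx).2⟩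
      · simp only [hc, if_false]
        simpa using ih Z (0 :: h) z'
    calc _ ≤ ∑ Z, revealProb y 1 Γ Z *
          (γ ^ h.sum * (Fintype.card Y : ℝ) ^ (Fintype.card I - Γ.card)) := by
          refine Finset.sum_le_sum fun Z _ => ?_
          by_cases hZ : Γ ⊆ Z
          · exact mul_le_mul_of_nonneg_left (hbound Z hZ) (revealProb_nonneg hy0 hy1 _ _ _)
          · have : revealProb y 1 Γ Z = 0 := by unfold revealProb; rw [if_neg hZ]
            rw [this, zero_mul, zero_mul]
      _ = _ := by rw [← Finset.sum_mul, sum_revealProb, one_mul]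

lemma card_filter_mem_messageClass_le {f : (I → Y) → 𝓜} {Γ : Finset I} {δ : ℝ}
    (Lo : Finset (I → Y) → Finset (I → Y))
    (hLo : ∀ z, ((Lo (messageClass f Γ z)).card : ℝ) ≤ δ * (messageClass f Γ z).card) :
    ((Finset.univ.filter fun x => x ∈ Lo (messageClass f Γ x)).card : ℝ)
      ≤ δ * (Fintype.card (I → Y) : ℝ) := by
  have h1 : ∀ T : Finset (I → Y), T.card
      = ∑ S ∈ Finset.univ.image (messageClass f Γ),
        (T.filter fun x => messageClass f Γ x = S).card := fun T =>
    Finset.card_eq_sum_card_fiberwise fun x _ => by simp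
  have h2 := h1 Finset.univ
  rw [Finset.card_univ] at h2
  rw [h1, h2]
  push_cast
  rw [Finset.mul_sum]
  refine Finset.sum_le_sum fun S hS => ?_
  obtain ⟨z, -, rfl⟩ := Finset.mem_image.1 hS
  have h3 : (Finset.univ.filter fun x => messageClass f Γ x = messageClass f Γ z)
      = messageClass f Γ z := by
    ext x
    simp only [mem_filter, mem_univ, true_and]
    exact ⟨fun h => h ▸ self_mem_messageClass f Γ x, fun h => messageClass_eq h⟩
  rw [h3]
  refine le_trans ?_ (hLo z)
  refine Nat.cast_le.2 (Finset.card_le_card fun x hx => ?_)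
  simp only [mem_filter, mem_univ, true_and] at hx
  rw [← hx.2]; exact hx.1

/-- Compare two estimates of the total value over the inputs with message in `𝓂`. Kraft bounds it
above by `|𝓂|` times the number of inputs. Each input contributes at least `γ ^ (L / 2)` times its
probability of not failing, and it fails at `X` only in `U X` or in a leftover set of density at
most `δ`. Few messages thus force the sets `U X` to be large on average. -/
theorem exists_spread_family [Nonempty Y] (f : (I → Y) → 𝓜) {θ δ : ℝ} (hθ : 0 < θ) (hδ : 0 ≤ δ)
    (hδ1 : δ ≤ 1) :
    ∃ U : Finset I → Finset (I → Y),
      (∀ Γ z, IsSpread θ Γ ((U Γ).filter fun x => x ∈ messageClass f Γ z)) ∧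
      ∀ (𝓂 : Finset 𝓜) (y κ : ℝ) (L : ℕ), 0 ≤ y → y < 1 → 0 < κ →
        1 ≤ Fintype.card Y * (θ * δ) →
        ∑ d ∈ range L, -Real.log (1 - y ^ (d + 1)) ≤ κ →
        (Fintype.card Y * (θ * δ)) ^ (L / 2) *
          (((Finset.univ.filter fun x => f x ∈ 𝓂).card : ℝ) / Fintype.card (I → Y)
            - ∑ i ∈ range L, Real.exp κ * ∑ X, revealProb y (i + 1) ∅ X *
              ((U X).card / Fintype.card (I → Y) + δ)) ≤ 𝓂.card := by
  have H : ∀ (Γ : Finset I) (S : Finset (I → Y)), ∃ (U Lo : Finset (I → Y))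
      (J : (I → Y) → Finset I), S.Nonempty → (U ⊆ S ∧ IsSpread θ Γ U ∧
      (Lo.card : ℝ) ≤ δ * S.card ∧
      (∀ x ∈ S, x ∉ U → x ∉ Lo → (J x).Nonempty) ∧ (∀ x, Disjoint (J x) Γ) ∧
      ∀ (R : Finset I → (I → Y) → ℝ) (c : ℝ), 0 ≤ c →
        (∀ J' : Finset I, Disjoint J' Γ → ∀ z, ∑ x ∈ coordCylinder S J' z, R J' x
          ≤ c * (θ * δ) ^ J'.card) → (∀ J' x, 0 ≤ R J' x) →
        ∑ x ∈ S with x ∉ U ∧ x ∉ Lo, R (J x) x ≤ c) := by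
    intro Γ S
    by_cases hS : S.Nonempty
    · have hpos : (0 : ℝ) < S.card := by exact_mod_cast Finset.card_pos.2 hS
      obtain ⟨U, Lo, J, h1, h2, h3, h4, h5, h6⟩ :=
        exists_spread_decomposition hθ hδ hδ1 hpos Γ S
      refine ⟨U, Lo, J, fun _ => ⟨h1, h2, h3, h4, h5, fun R c hc hR hnn => ?_⟩⟩
      have := h6 R c hc hR hnn
      rwa [mul_div_assoc, div_self hpos.ne', mul_one] at this
    · exact ⟨∅, ∅, fun _ => ∅, fun h => absurd h hS⟩
  choose U Lo J hJ using H
  have hne : ∀ Γ z, (messageClass f Γ z).Nonempty := fun Γ z => ⟨z, self_mem_messageClass f Γ z⟩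
  set V : Finset I → Finset (I → Y) :=
    fun Γ => Finset.univ.filter fun x => x ∈ U Γ (messageClass f Γ x) with hV
  refine ⟨V, ?_, ?_⟩
  · intro Γ z
    have : ((V Γ).filter fun x => x ∈ messageClass f Γ z) = U Γ (messageClass f Γ z) := by
      ext x
      simp only [hV, mem_filter, mem_univ, true_and]
      constructor
      · rintro ⟨h1, h2⟩
        rwa [messageClass_eq h2] at h1
      · intro h1
        have h2 := (hJ Γ _ (hne Γ z)).1 h1
        exact ⟨by rwa [messageClass_eq h2], h2⟩
    rw [this]
    exact (hJ Γ _ (hne Γ z)).2.1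
  · intro 𝓂 y κ L hy0 hy1 hκ hγ hlog
    set γ : ℝ := Fintype.card Y * (θ * δ) with hγdef
    set w : ℕ → ℝ := fun d => -Real.log (1 - y ^ (d + 1)) with hw
    -- The capture rule: inputs in the spread part or in the leftover capture nothing, which is a
    -- failure of the round.
    set C : Finset I → (I → Y) → Finset I := fun Γ x =>
      if x ∈ U Γ (messageClass f Γ x) ∨ x ∈ Lo Γ (messageClass f Γ x) then ∅
      else J Γ (messageClass f Γ x) x with hC
    have hCd : ∀ Γ x, Disjoint (C Γ x) Γ := by
      intro Γ x
      simp only [hC]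
      split_ifs
      · exact Finset.disjoint_empty_left _
      · exact (hJ Γ _ (hne Γ x)).2.2.2.2.1 x
    have hKraft : ∀ M : 𝓜, ∑ x : I → Y, (if f x = M then
        chainValue (fun Γ => C Γ x) y w κ γ L ∅ [] else 0) ≤ Fintype.card (I → Y) := by
      intro M
      obtain ⟨z⟩ : Nonempty (I → Y) := inferInstance
      have := sum_chainValue_le (f := f) (J := C) (γ := γ) (θ := θ) (δ := δ) rfl (by linarith) ?_
        hy0 hy1.le w κ M L ∅ [] z
      · simpa using this
      · intro Γ z R c hc hR hnn
        refine le_trans (le_of_eq ?_) ((hJ Γ _ (hne Γ z)).2.2.2.2.2 R c hc hR hnn)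
        have hmem : ∀ x ∈ messageClass f Γ z, (C Γ x).Nonempty ↔
            (x ∉ U Γ (messageClass f Γ z) ∧ x ∉ Lo Γ (messageClass f Γ z)) := by
          intro x hx
          simp only [hC, messageClass_eq hx]
          constructor
          · intro h
            by_contra h2
            rw [if_pos (by tauto)] at h
            simp at h
          · rintro ⟨h1, h2⟩
            rw [if_neg (by tauto)]
            exact (hJ Γ _ (hne Γ z)).2.2.2.1 x hx h1 h2
        rw [Finset.filter_congr hmem]
        refine Finset.sum_congr rfl fun x hx => ?_
        have h1 := Finset.mem_filter.1 hx
        have : C Γ x = J Γ (messageClass f Γ z) x := by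
          simp only [hC, messageClass_eq h1.1]
          rw [if_neg (by tauto)]
        rw [this]
    have hw0 : ∀ d, 0 ≤ w d := by
      intro d
      have h1 : 0 ≤ y ^ (d + 1) := by positivity
      have h2 : y ^ (d + 1) < 1 := pow_lt_one₀ hy0 hy1 (by omega)
      simp only [hw]
      have := Real.log_nonpos (x := 1 - y ^ (d + 1)) (by linarith) (by linarith)
      linarith
    set N : ℝ := ((Fintype.card (I → Y) : ℕ) : ℝ) with hN
    have hNpos : 0 < N := by
      rw [hN]; exact_mod_cast Fintype.card_pos (α := I → Y)
    have hfail : ∀ X, ∑ x : I → Y, (if C X x = ∅ then (1 : ℝ) else 0) ≤ (V X).card + δ * N := by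
      intro X
      rw [← Finset.sum_filter, Finset.sum_const, nsmul_eq_mul, mul_one]
      have hsub : (Finset.univ.filter fun x => C X x = ∅) ⊆
          V X ∪ Finset.univ.filter fun x => x ∈ Lo X (messageClass f X x) := by
        intro x hx
        simp only [hV, mem_union, mem_filter, mem_univ, true_and] at hx ⊢
        by_contra h2
        simp only [hC] at hx
        rw [if_neg h2] at hx
        have := (hJ X _ (hne X x)).2.2.2.1 x (self_mem_messageClass f X x) (by tauto) (by tauto)
        rw [hx] at this
        simp at this
      have h3 := (Finset.card_le_card hsub).trans (Finset.card_union_le _ _)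
      have h4 := card_filter_mem_messageClass_le (f := f) (Γ := X) (δ := δ) (Lo X)
        fun z => (hJ X _ (hne X z)).2.2.1
      have h5 : ((Finset.univ.filter fun x => C X x = ∅).card : ℝ) ≤ (V X).card +
          (Finset.univ.filter fun x => x ∈ Lo X (messageClass f X x)).card := by exact_mod_cast h3
      linarith
    set T : (I → Y) → ℝ := fun x => ∑ i ∈ range L, Real.exp κ *
      ∑ X, revealProb y (i + 1) ∅ X * (if C X x = ∅ then 1 else 0) with hT
    have hTnn : ∀ x, 0 ≤ T x := fun x => Finset.sum_nonneg fun i _ =>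
      mul_nonneg (Real.exp_pos _).le (Finset.sum_nonneg fun X _ =>
        mul_nonneg (revealProb_nonneg hy0 hy1.le _ _ _) (by split_ifs <;> simp))
    have hTsum : ∑ x, T x ≤ N * ∑ i ∈ range L, Real.exp κ * ∑ X, revealProb y (i + 1) ∅ X *
        ((V X).card / N + δ) := by
      simp only [hT]
      rw [Finset.sum_comm, Finset.mul_sum]
      refine Finset.sum_le_sum fun i _ => ?_
      rw [← Finset.mul_sum, Finset.sum_comm, mul_left_comm]
      refine mul_le_mul_of_nonneg_left ?_ (Real.exp_pos _).le
      rw [Finset.mul_sum]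
      refine Finset.sum_le_sum fun X _ => ?_
      rw [← Finset.mul_sum, mul_left_comm]
      refine mul_le_mul_of_nonneg_left ?_ (revealProb_nonneg hy0 hy1.le _ _ _)
      refine (hfail X).trans (le_of_eq ?_)
      field_simp
    have hmain : ∀ x, γ ^ (L / 2) * (1 - T x) ≤ chainValue (fun Γ => C Γ x) y w κ γ L ∅ [] := by
      intro x
      refine le_trans ?_ (mul_chainValue_one_le hy0 hy1.le hγ hκ hw0 hlog L ∅ [] (by simp) trivial)
      refine mul_le_mul_of_nonneg_left ?_ (by positivity)
      have := chainValue_one_ge (J := fun Γ => C Γ x) (fun Γ => hCd Γ x) hy0 hy1 (κ := κ) L ∅ []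
      simpa only [weightedSum, sub_zero] using this
    have h1 : ∑ x, (if f x ∈ 𝓂 then chainValue (fun Γ => C Γ x) y w κ γ L ∅ [] else 0)
        ≤ 𝓂.card * N := by
      calc _ = ∑ M ∈ 𝓂, ∑ x, (if f x = M then
            chainValue (fun Γ => C Γ x) y w κ γ L ∅ [] else 0) := by
            rw [Finset.sum_comm]
            refine Finset.sum_congr rfl fun x _ => ?_
            rw [Finset.sum_ite_eq]
        _ ≤ ∑ M ∈ 𝓂, N := Finset.sum_le_sum fun M _ => hKraft M
        _ = _ := by rw [Finset.sum_const, nsmul_eq_mul]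
    have h2 : γ ^ (L / 2) * ((Finset.univ.filter fun x => f x ∈ 𝓂).card - ∑ x, T x)
        ≤ ∑ x, (if f x ∈ 𝓂 then chainValue (fun Γ => C Γ x) y w κ γ L ∅ [] else 0) := by
      have e : ((Finset.univ.filter fun x => f x ∈ 𝓂).card : ℝ)
          = ∑ x, if f x ∈ 𝓂 then (1 : ℝ) else 0 := by
        rw [← Finset.sum_filter, Finset.sum_const, nsmul_eq_mul, mul_one]
      rw [e, ← Finset.sum_sub_distrib, Finset.mul_sum]
      refine Finset.sum_le_sum fun x _ => ?_
      have h0 : (0 : ℝ) ≤ γ ^ (L / 2) := by positivity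
      split_ifs
      · exact hmain x
      · nlinarith [hTnn x]
    have h3 : γ ^ (L / 2) * ((Finset.univ.filter fun x => f x ∈ 𝓂).card -
        N * ∑ i ∈ range L, Real.exp κ * ∑ X, revealProb y (i + 1) ∅ X * ((V X).card / N + δ))
        ≤ 𝓂.card * N := by
      refine le_trans ?_ (h2.trans h1)
      refine mul_le_mul_of_nonneg_left ?_ (by positivity)
      linarith
    refine le_of_mul_le_mul_right (le_trans (le_of_eq ?_) h3) hNpos
    field_simp

end Capture

/-- The lifetime cost of one captured coordinate. Expanding the logarithm and summing the geometric
series over `d`, the term of exponent `m + 1` is at most `K / (m + 1) ^ 2`, so the total is at most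
`K * π ^ 2 / 6`. -/
lemma sum_neg_log_one_sub_pow_le {K : ℕ} (hK : 2 ≤ K) (L : ℕ) :
    ∑ d ∈ range L, -Real.log (1 - (1 - 1 / (K : ℝ)) ^ (d + 1)) ≤ 2 * K := by
  have hK0 : (2 : ℝ) ≤ K := by exact_mod_cast hK
  set y : ℝ := 1 - 1 / (K : ℝ) with hy
  have hinv : 1 / (K : ℝ) ≤ 1 / 2 := one_div_le_one_div_of_le (by norm_num) hK0
  have hinv0 : 0 < 1 / (K : ℝ) := by positivity
  have hy0 : 0 < y := by linarith
  have hy1 : y < 1 := by linarith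
  have h1 : HasSum (fun m : ℕ => ∑ d ∈ range L, (y ^ (d + 1)) ^ (m + 1) / ((m : ℝ) + 1))
      (∑ d ∈ range L, -Real.log (1 - y ^ (d + 1))) := by
    refine hasSum_sum fun d _ => Real.hasSum_pow_div_log_of_abs_lt_one ?_
    rw [abs_of_pos (by positivity)]
    exact pow_lt_one₀ hy0.le hy1 (by omega)
  have h2 : HasSum (fun m : ℕ => (K : ℝ) * (1 / ((m + 1 : ℕ) : ℝ) ^ 2))
      (K * (Real.pi ^ 2 / 6)) := by
    refine HasSum.mul_left _ ?_
    have := (hasSum_nat_add_iff' (f := fun n : ℕ => (1 : ℝ) / (n : ℝ) ^ 2) 1).2 hasSum_zeta_two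
    simpa using this
  have h3 := hasSum_le (fun m => ?_) h1 h2
  · refine h3.trans ?_
    have : Real.pi ^ 2 / 6 ≤ 2 := by nlinarith [Real.pi_lt_d2, Real.pi_pos]
    nlinarith
  · have hm : (0 : ℝ) < (m : ℝ) + 1 := by positivity
    set q := y ^ (m + 1) with hq
    have hq0 : 0 < q := by positivity
    have hq1 : q < 1 := pow_lt_one₀ hy0.le hy1 (by omega)
    have e1 : ∑ d ∈ range L, (y ^ (d + 1)) ^ (m + 1) / ((m : ℝ) + 1)
        = q * (∑ d ∈ range L, q ^ d) / (m + 1) := by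
      rw [Finset.mul_sum, Finset.sum_div]
      refine Finset.sum_congr rfl fun d _ => ?_
      rw [hq, ← pow_mul, ← pow_mul, ← pow_add]
      congr 2; ring
    have e2 : ∑ d ∈ range L, q ^ d ≤ 1 / (1 - q) := by
      rw [geom_sum_eq hq1.ne]
      rw [← neg_div_neg_eq, neg_sub, neg_sub]
      have : 0 ≤ q ^ L := by positivity
      have h1q : 0 < 1 - q := by linarith
      gcongr
      linarith
    -- Bernoulli's inequality with `(1 - 1 / K) * (1 + 1 / K) ≤ 1`.
    have e3 : q * (1 + (m + 1) / K) ≤ 1 := by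
      have hb := one_add_mul_le_pow (a := 1 / (K : ℝ)) (by linarith) (m + 1)
      have hc : y * (1 + 1 / K) ≤ 1 := by
        rw [hy]; nlinarith
      calc q * (1 + (m + 1) / K) ≤ q * (1 + 1 / K) ^ (m + 1) := by
            refine mul_le_mul_of_nonneg_left ?_ hq0.le
            push_cast at hb
            calc _ = 1 + ((m : ℝ) + 1) * (1 / K) := by ring
              _ ≤ _ := hb
        _ = (y * (1 + 1 / K)) ^ (m + 1) := by rw [hq, mul_pow]
        _ ≤ 1 := pow_le_one₀ (by positivity) hc
    have e4 : q / (1 - q) ≤ K / (m + 1) := by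
      have h1q : 0 < 1 - q := by linarith
      rw [div_le_div_iff₀ h1q hm]
      have hK' : (0 : ℝ) < K := by linarith
      have : q * ((m : ℝ) + 1) / K ≤ 1 - q := by
        calc _ = q * (1 + (m + 1) / K) - q := by ring
          _ ≤ 1 - q := by linarith
      rw [div_le_iff₀ hK'] at this
      linarith
    rw [e1]
    calc q * (∑ d ∈ range L, q ^ d) / (m + 1) ≤ q * (1 / (1 - q)) / (m + 1) := by gcongr
      _ = (q / (1 - q)) / (m + 1) := by ring
      _ ≤ (K / (m + 1)) / (m + 1) := by gcongr
      _ = K * (1 / ((m + 1 : ℕ) : ℝ) ^ 2) := by push_cast; field_simp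

/-! ### Second moments: a spread class does not reveal the side. -/

section Moment

open scoped Classical

set_option linter.unusedSectionVars false

lemma expect_pi_comp {I Ω Z : Type*} [Fintype I] [Fintype Ω] [Fintype Z] (φ : I → Ω → Z)
    (F : (I → Z) → ℝ) :
    𝔼 o : I → Ω, F (fun g => φ g (o g))
      = ∑ z : I → Z, (∏ g, 𝔼 o, if φ g o = z g then (1 : ℝ) else 0) * F z := by
  have h1 : ∀ z : I → Z, (∏ g, 𝔼 o, if φ g o = z g then (1 : ℝ) else 0)
      = 𝔼 o : I → Ω, if (fun g => φ g (o g)) = z then (1 : ℝ) else 0 := by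
    intro z
    simp_rw [Fintype.expect_eq_sum_div_card]
    rw [Finset.prod_div_distrib, Finset.prod_univ_sum, Fintype.piFinset_univ, Finset.prod_const,
      Fintype.card_fun, Finset.card_univ, Nat.cast_pow]
    congr 1
    refine Finset.sum_congr rfl fun o _ => ?_
    rw [Finset.prod_ite_zero]
    simp [funext_iff]
  simp_rw [h1, Finset.expect_mul]
  rw [← Finset.expect_sum_comm]
  refine Finset.expect_congr rfl fun o _ => ?_
  simp

lemma expect_pi_comp_le {I Ω Z : Type*} [Fintype I] [Fintype Ω] [Fintype Z] (φ : I → Ω → Z)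
    (F : (I → Z) → ℝ) (hF : ∀ z, 0 ≤ F z) (w : I → Z → ℝ)
    (hw : ∀ g z, (𝔼 o, if φ g o = z then (1 : ℝ) else 0) ≤ w g z) :
    𝔼 o : I → Ω, F (fun g => φ g (o g)) ≤ ∑ z : I → Z, (∏ g, w g (z g)) * F z := by
  rw [expect_pi_comp]
  refine Finset.sum_le_sum fun z _ => mul_le_mul_of_nonneg_right ?_ (hF z)
  refine Finset.prod_le_prod (fun g _ => ?_) fun g _ => hw g _
  exact Finset.expect_nonneg fun o _ => by split_ifs <;> simp

lemma expect_pi_prod {I A B : Type*} [Fintype I] [Fintype A] [Fintype B]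
    (F : (I → A) → (I → B) → ℝ) :
    𝔼 a, 𝔼 b, F a b = 𝔼 o : I → A × B, F (fun g => (o g).1) (fun g => (o g).2) := by
  rw [← Finset.expect_product' Finset.univ Finset.univ F, Finset.univ_product_univ]
  refine Fintype.expect_equiv (Equiv.arrowProdEquivProdArrow I (fun _ => A) (fun _ => B)).symm _ _ ?_
  rintro ⟨a, b⟩
  rfl

lemma expect_perm_apply_eq {Y : Type*} [Fintype Y] (p u : Y) :
    (𝔼 τ : Equiv.Perm Y, if τ p = u then (1 : ℝ) else 0) = 1 / Fintype.card Y := by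
  have h1 : ∀ v, (𝔼 τ : Equiv.Perm Y, if τ p = v then (1 : ℝ) else 0)
      = 𝔼 τ : Equiv.Perm Y, if τ p = u then (1 : ℝ) else 0 := by
    intro v
    refine Fintype.expect_equiv (Equiv.mulLeft (Equiv.swap u v)) _ _ fun τ => ?_
    simp only [Equiv.coe_mulLeft, Equiv.Perm.mul_apply]
    have : (Equiv.swap u v) (τ p) = u ↔ τ p = v := by
      rw [Equiv.swap_apply_eq_iff, Equiv.swap_apply_left]
    simp [this]
  have h2 : ∑ v, (𝔼 τ : Equiv.Perm Y, if τ p = v then (1 : ℝ) else 0) = 1 := by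
    rw [← Finset.expect_sum_comm]
    simp
  simp_rw [h1] at h2
  rw [Finset.sum_const, nsmul_eq_mul, Finset.card_univ] at h2
  have : (Fintype.card Y : ℝ) ≠ 0 := by
    intro h; rw [h, zero_mul] at h2; exact zero_ne_one h2
  field_simp
  linarith

/-- The symmetric group acts transitively on ordered pairs of distinct points, so all such target
pairs are equally likely. -/
lemma expect_perm_apply_eq_and {Y : Type*} [Fintype Y] {p p' u u' : Y} (hp : p ≠ p')
    (hu : u ≠ u') :
    (𝔼 τ : Equiv.Perm Y, if τ p = u ∧ τ p' = u' then (1 : ℝ) else 0)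
      = 1 / (Fintype.card Y * (Fintype.card Y - 1)) := by
  set E : Y → Y → ℝ := fun v v' => 𝔼 τ : Equiv.Perm Y, if τ p = v ∧ τ p' = v' then (1 : ℝ) else 0
    with hE
  have hinv : ∀ (ρ : Equiv.Perm Y) v v', E (ρ v) (ρ v') = E v v' := by
    intro ρ v v'
    refine Fintype.expect_equiv (Equiv.mulLeft ρ⁻¹) _ _ fun τ => ?_
    simp only [Equiv.coe_mulLeft, Equiv.Perm.mul_apply, Equiv.Perm.inv_eq_iff_eq]
  have h1 : ∀ v v', v ≠ v' → E v v' = E u u' := by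
    intro v v' hv
    set w := Equiv.swap u v u' with hw
    have hwv : w ≠ v := by
      intro h
      rw [hw, Equiv.swap_apply_eq_iff, Equiv.swap_apply_right] at h
      exact hu h.symm
    have := hinv (Equiv.swap w v' * Equiv.swap u v) u u'
    simp only [Equiv.Perm.mul_apply, Equiv.swap_apply_left] at this
    rw [← hw, Equiv.swap_apply_left, Equiv.swap_apply_of_ne_of_ne hwv.symm hv] at this
    exact this
  have h2 : ∀ v, E v v = 0 := by
    intro v
    refine Finset.expect_eq_zero fun τ _ => ?_
    rw [if_neg]
    rintro ⟨a, b⟩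
    exact hp (τ.injective (a.trans b.symm))
  have h3 : ∑ v', E u v' = 1 / Fintype.card Y := by
    rw [← expect_perm_apply_eq p u]
    simp only [hE]
    rw [← Finset.expect_sum_comm]
    refine Finset.expect_congr rfl fun τ _ => ?_
    by_cases h : τ p = u <;> simp [h]
  have h4 : ∑ v', E u v' = (Fintype.card Y - 1 : ℝ) * E u u' := by
    rw [← Finset.add_sum_erase _ _ (Finset.mem_univ u), h2, zero_add,
      Finset.sum_congr rfl fun v' hv' => h1 u v' (Finset.ne_of_mem_erase hv').symm,
      Finset.sum_const, nsmul_eq_mul, Finset.card_erase_of_mem (Finset.mem_univ u),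
      Finset.card_univ, Nat.cast_sub, Nat.cast_one]
    exact Fintype.card_pos_iff.2 ⟨u⟩
  have hcard : 1 < Fintype.card Y := Fintype.one_lt_card_iff.2 ⟨u, u', hu⟩
  have hc : (1 : ℝ) < Fintype.card Y := by exact_mod_cast hcard
  rw [h4] at h3
  change E u u' = _
  have hc1 : (Fintype.card Y - 1 : ℝ) ≠ 0 := by linarith
  field_simp at h3 ⊢
  linarith

/-- Average of `χ` over the points with the same message as `x`. -/
def condAvg {X 𝓜 : Type*} [Fintype X] (χ : X → ℝ) (M : X → 𝓜) (x : X) : ℝ :=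
  (∑ x' with M x' = M x, χ x') / (Finset.univ.filter fun x' => M x' = M x).card

lemma sum_condAvg {X 𝓜 : Type*} [Fintype X] (χ : X → ℝ) (M : X → 𝓜) (m : 𝓜) :
    ∑ x with M x = m, condAvg χ M x = ∑ x with M x = m, χ x := by
  by_cases h : (Finset.univ.filter fun x => M x = m).Nonempty
  · have h1 : ∀ x ∈ Finset.univ.filter fun x => M x = m, condAvg χ M x
        = (∑ x' with M x' = m, χ x') / (Finset.univ.filter fun x' => M x' = m).card := by
      intro x hx
      rw [condAvg, (Finset.mem_filter.1 hx).2]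
    rw [Finset.sum_congr rfl h1, Finset.sum_const, nsmul_eq_mul]
    have : ((Finset.univ.filter fun x => M x = m).card : ℝ) ≠ 0 := by
      exact_mod_cast (Finset.card_pos.2 h).ne'
    field_simp
  · rw [Finset.not_nonempty_iff_eq_empty] at h
    rw [h]; simp

lemma sum_abs_condAvg {X 𝓜 : Type*} [Fintype X] (χ : X → ℝ) (M : X → 𝓜) (T : Finset 𝓜)
    (hT : ∀ x, M x ∈ T) :
    ∑ x, |condAvg χ M x| = ∑ m ∈ T, |∑ x with M x = m, χ x| := by
  rw [← Finset.sum_fiberwise_of_maps_to (s := Finset.univ) (t := T) (g := M) (fun x _ => hT x)]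
  refine Finset.sum_congr rfl fun m _ => ?_
  have h1 : ∀ x ∈ Finset.univ.filter fun x => M x = m, |condAvg χ M x|
        = |∑ x' with M x' = m, χ x'| / (Finset.univ.filter fun x' => M x' = m).card := by
    intro x hx
    rw [condAvg, (Finset.mem_filter.1 hx).2, abs_div, Nat.abs_cast]
  rw [Finset.sum_congr rfl h1, Finset.sum_const, nsmul_eq_mul]
  by_cases h : (Finset.univ.filter fun x => M x = m).Nonempty
  · have : ((Finset.univ.filter fun x => M x = m).card : ℝ) ≠ 0 := by
      exact_mod_cast (Finset.card_pos.2 h).ne'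
    field_simp
  · rw [Finset.not_nonempty_iff_eq_empty] at h
    rw [h]; simp

lemma condAvg_congr {X 𝓜 𝓜' : Type*} [Fintype X] (χ : X → ℝ) (M : X → 𝓜) (M' : X → 𝓜')
    (h : ∀ x x', M x = M x' ↔ M' x = M' x') (x : X) : condAvg χ M x = condAvg χ M' x := by
  simp only [condAvg, h]

/-- The sign attached to a side. -/
def sideSign (σ : Bool) : ℝ := if σ then 1 else -1

lemma abs_sideSign (σ : Bool) : |sideSign σ| = 1 := by
  cases σ <;> simp [sideSign]

variable {I Y H 𝓜 : Type*} [Fintype I] [Fintype Y] [Fintype H]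

/-- The neighbors of the middle vertex with index `j`: in a revealed group `g ∈ Γ` its private
neighbor, in the other groups the hub on side `σ` with index `a g`. -/
def neighborLabels (ι : Bool × H → Y) (Γ : Finset I) (j : Y) (τ : I → Equiv.Perm Y)
    (x : Bool × (I → H)) : I → Y :=
  fun g => if g ∈ Γ then τ g j else τ g (ι (x.1, x.2 g))

lemma expect_perm_pi_apply (p : I → Y) (F : (I → Y) → ℝ) :
    𝔼 τ : I → Equiv.Perm Y, F (fun g => τ g (p g)) = 𝔼 x, F x := by
  rw [expect_pi_comp (fun g (τ : Equiv.Perm Y) => τ (p g)) F]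
  simp_rw [expect_perm_apply_eq]
  rw [Fintype.expect_eq_sum_div_card, Finset.sum_div]
  refine Finset.sum_congr rfl fun z _ => ?_
  rw [Finset.prod_const, Finset.card_univ, Fintype.card_fun, Nat.cast_pow]
  rw [one_div, inv_pow]
  ring

lemma expect_neighborLabels (ι : Bool × H → Y) (Γ : Finset I) (j : Y) (x : Bool × (I → H))
    (F : (I → Y) → ℝ) :
    𝔼 τ, F (neighborLabels ι Γ j τ x) = 𝔼 z, F z := by
  rw [← expect_perm_pi_apply (fun g => if g ∈ Γ then j else ι (x.1, x.2 g)) F]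
  refine Finset.expect_congr rfl fun τ _ => ?_
  congr 1
  funext g
  simp only [neighborLabels]
  split_ifs <;> rfl

/-- Expand the product over the set `J` of coordinates where the agreement is exploited. Spreadness
bounds each cylinder by `θ ^ |J|`, and the binomial theorem sums the terms. -/
lemma sum_prod_agree_le {Γ : Finset I} {𝒜 : Finset (I → Y)} {θ c : ℝ} (hθ : 0 ≤ θ) (hc : 1 ≤ c)
    (hs : IsSpread θ Γ 𝒜) (u : I → Y) (hu : u ∈ 𝒜) :
    ∑ u' ∈ 𝒜, ∏ g ∈ Γᶜ, (if u g = u' g then c else 1)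
      ≤ (1 + c * θ) ^ Fintype.card I * 𝒜.card := by
  have h1 : ∀ u' ∈ 𝒜, ∏ g ∈ Γᶜ, (if u g = u' g then c else 1)
      = ∑ J ∈ Γᶜ.powerset, (if ∀ g ∈ J, u' g = u g then (c - 1) ^ J.card else 0) := by
    intro u' _
    have : ∀ g, (if u g = u' g then c else 1) = 1 + (if u' g = u g then c - 1 else 0) := by
      intro g
      by_cases h : u g = u' g
      · rw [if_pos h, if_pos h.symm]; ring
      · rw [if_neg h, if_neg (Ne.symm h)]; ring
    simp_rw [this]
    rw [Finset.prod_one_add]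
    refine Finset.sum_congr rfl fun J _ => ?_
    rw [Finset.prod_ite_zero, Finset.prod_const]
    congr
  rw [Finset.sum_congr rfl h1, Finset.sum_comm]
  have h2 : ∀ J ∈ Γᶜ.powerset, ∑ u' ∈ 𝒜, (if ∀ g ∈ J, u' g = u g then (c - 1) ^ J.card else 0)
      ≤ (c * θ) ^ J.card * 𝒜.card := by
    intro J hJ
    rw [← Finset.sum_filter, Finset.sum_const, nsmul_eq_mul]
    change ((coordCylinder 𝒜 J u).card : ℝ) * _ ≤ _
    by_cases hJ0 : J.Nonempty
    · have hd : Disjoint J Γ := by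
        rw [Finset.mem_powerset] at hJ
        exact Finset.disjoint_left.2 fun g hg hg' => Finset.mem_compl.1 (hJ hg) hg'
      calc _ ≤ (θ ^ J.card * 𝒜.card) * c ^ J.card := by
            refine mul_le_mul (hs J hJ0 hd u hu) ?_ (by have : 0 ≤ c - 1 := by linarith
                                                        positivity) (by positivity)
            exact pow_le_pow_left₀ (by linarith) (by linarith) _
        _ = _ := by rw [mul_pow]; ring
    · rw [Finset.not_nonempty_iff_eq_empty] at hJ0
      subst hJ0
      simp [coordCylinder]
  refine (Finset.sum_le_sum h2).trans ?_
  rw [← Finset.sum_mul]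
  refine mul_le_mul_of_nonneg_right ?_ (Nat.cast_nonneg _)
  have h3 := Finset.sum_pow_mul_eq_add_pow (c * θ) 1 Γᶜ
  simp only [one_pow, mul_one] at h3
  rw [h3, add_comm]
  refine pow_le_pow_right₀ ?_ (Finset.card_le_univ _)
  nlinarith

/-- Two random hub indices coincide with probability `1 / |H|` rather than `1 / |Y|`, which gives
the excess on the diagonal. Off the diagonal the pair is no likelier than for independent labels,
because `|H| ≤ |Y|`. -/
lemma expect_pair_labels_le {ι : Bool × H → Y} (hι : Function.Injective ι) [Nonempty H] (σ : Bool)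
    (z : Y × Y) :
    (𝔼 o : Equiv.Perm Y × H × H, if (o.1 (ι (σ, o.2.1)), o.1 (ι (σ, o.2.2))) = z
      then (1 : ℝ) else 0)
      ≤ 1 / (Fintype.card Y : ℝ) ^ 2 *
        (if z.1 = z.2 then (Fintype.card Y : ℝ) / Fintype.card H else 1) := by
  obtain ⟨u, u'⟩ := z
  have hh : (0 : ℝ) < Fintype.card H := by exact_mod_cast Fintype.card_pos (α := H)
  have hle : Fintype.card H ≤ Fintype.card Y :=
    Fintype.card_le_of_injective (fun a => ι (σ, a)) fun a b hab => by simpa using hι hab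
  have hle' : (Fintype.card H : ℝ) ≤ Fintype.card Y := by exact_mod_cast hle
  have hQ : (0 : ℝ) < Fintype.card Y := lt_of_lt_of_le hh hle'
  have hprod : (𝔼 o : Equiv.Perm Y × H × H, if (o.1 (ι (σ, o.2.1)), o.1 (ι (σ, o.2.2))) = (u, u')
      then (1 : ℝ) else 0) = 𝔼 a : H, 𝔼 a' : H, 𝔼 τ : Equiv.Perm Y,
        if τ (ι (σ, a)) = u ∧ τ (ι (σ, a')) = u' then (1 : ℝ) else 0 := by
    rw [← Finset.univ_product_univ, Finset.expect_product, Finset.expect_comm,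
      ← Finset.univ_product_univ, Finset.expect_product]
    simp only [Prod.mk.injEq]
  rw [hprod]
  by_cases huu : u = u'
  · subst huu
    simp only [if_true]
    have h1 : ∀ a a' : H, (𝔼 τ : Equiv.Perm Y, if τ (ι (σ, a)) = u ∧ τ (ι (σ, a')) = u
        then (1 : ℝ) else 0) = if a = a' then 1 / (Fintype.card Y : ℝ) else 0 := by
      intro a a'
      by_cases ha : a = a'
      · subst ha
        simp only [and_self, if_true]
        exact expect_perm_apply_eq _ _
      · rw [if_neg ha]
        refine Finset.expect_eq_zero fun τ _ => if_neg ?_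
        rintro ⟨e1, e2⟩
        have := hι (τ.injective (e1.trans e2.symm))
        exact ha (by simpa using this)
    simp_rw [h1]
    have h2 : ∀ a : H, (𝔼 a' : H, if a = a' then 1 / (Fintype.card Y : ℝ) else 0)
        = 1 / (Fintype.card Y : ℝ) / Fintype.card H := by
      intro a
      rw [Fintype.expect_eq_sum_div_card]
      simp
    simp_rw [h2]
    rw [Fintype.expect_const]
    refine le_of_eq ?_
    field_simp
  · simp only [huu, if_false, mul_one]
    have hcard : 1 < Fintype.card Y := Fintype.one_lt_card_iff.2 ⟨u, u', huu⟩
    have hc : (1 : ℝ) < Fintype.card Y := by exact_mod_cast hcard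
    have h1 : ∀ a a' : H, (𝔼 τ : Equiv.Perm Y, if τ (ι (σ, a)) = u ∧ τ (ι (σ, a')) = u'
        then (1 : ℝ) else 0)
        = 1 / (Fintype.card Y * (Fintype.card Y - 1) : ℝ) * (1 - if a = a' then 1 else 0) := by
      intro a a'
      by_cases ha : a = a'
      · subst ha
        simp only [if_true, sub_self, mul_zero]
        refine Finset.expect_eq_zero fun τ _ => if_neg ?_
        rintro ⟨e1, e2⟩
        exact huu (e1.symm.trans e2)
      · rw [if_neg ha, sub_zero, mul_one]
        refine expect_perm_apply_eq_and ?_ huu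
        intro e
        exact ha (by simpa using hι e)
    simp_rw [h1, ← Finset.mul_expect]
    have h2 : ∀ a : H, (𝔼 a' : H, ((1 : ℝ) - if a = a' then 1 else 0))
        = 1 - 1 / Fintype.card H := by
      intro a
      rw [Finset.expect_sub_distrib, Fintype.expect_const, Fintype.expect_eq_sum_div_card]
      simp
    simp_rw [h2]
    rw [Fintype.expect_const]
    have h3 : 1 - 1 / (Fintype.card H : ℝ) ≤ (Fintype.card Y - 1) / Fintype.card Y := by
      rw [sub_div, div_self hQ.ne']
      have := one_div_le_one_div_of_le hh hle'
      linarith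
    have hc1 : (0 : ℝ) < Fintype.card Y - 1 := by linarith
    calc _ ≤ 1 / (Fintype.card Y * (Fintype.card Y - 1) : ℝ) *
          ((Fintype.card Y - 1) / Fintype.card Y) := by
          refine mul_le_mul_of_nonneg_left h3 (by positivity)
      _ = _ := by field_simp

/-- Fraction of the hub indices on side `σ` whose neighbor labels lie in `𝒜`. -/
def sideFraction (ι : Bool × H → Y) (Γ : Finset I) (j : Y) (𝒜 : Finset (I → Y)) (σ : Bool)
    (τ : I → Equiv.Perm Y) : ℝ :=
  𝔼 a : I → H, if neighborLabels ι Γ j τ (σ, a) ∈ 𝒜 then (1 : ℝ) else 0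

lemma expect_sideFraction [Nonempty H] (ι : Bool × H → Y) (Γ : Finset I) (j : Y)
    (𝒜 : Finset (I → Y)) (σ : Bool) :
    𝔼 τ, sideFraction ι Γ j 𝒜 σ τ = 𝒜.card / (Fintype.card Y : ℝ) ^ Fintype.card I := by
  unfold sideFraction
  rw [Finset.expect_comm]
  have h1 : ∀ a : I → H, (𝔼 τ, if neighborLabels ι Γ j τ (σ, a) ∈ 𝒜 then (1 : ℝ) else 0)
      = 𝒜.card / (Fintype.card Y : ℝ) ^ Fintype.card I := by
    intro a
    rw [expect_neighborLabels ι Γ j (σ, a) fun z => if z ∈ 𝒜 then (1 : ℝ) else 0,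
      Fintype.expect_eq_sum_div_card]
    simp
  simp_rw [h1]
  rw [Fintype.expect_const]

/-- The square is the probability that two independent choices of hubs, under the same matchings,
both land in `𝒜`. They share all revealed labels; elsewhere they behave like independent labels up
to a factor `|Y| / |H|` at each agreement. -/
lemma expect_sideFraction_sq_le {ι : Bool × H → Y} (hι : Function.Injective ι) [Nonempty H]
    {Γ : Finset I} (j : Y) {𝒜 : Finset (I → Y)} (σ : Bool) {θ : ℝ} (hθ : 0 ≤ θ)
    (hs : IsSpread θ Γ 𝒜) :
    𝔼 τ, sideFraction ι Γ j 𝒜 σ τ ^ 2 ≤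
      (1 / (Fintype.card Y : ℝ)) ^ Γ.card * (1 / (Fintype.card Y : ℝ) ^ 2) ^ Γᶜ.card *
        ((1 + Fintype.card Y / Fintype.card H * θ) ^ Fintype.card I * (𝒜.card : ℝ) ^ 2) := by
  have hh : (0 : ℝ) < Fintype.card H := by exact_mod_cast Fintype.card_pos (α := H)
  have hle : (Fintype.card H : ℝ) ≤ Fintype.card Y := by
    exact_mod_cast Fintype.card_le_of_injective (fun a => ι (σ, a)) fun a b hab => by
      simpa using hι hab
  set F : (I → Y × Y) → ℝ := fun z =>
    if (fun g => (z g).1) ∈ 𝒜 ∧ (fun g => (z g).2) ∈ 𝒜 then 1 else 0 with hF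
  set φ : I → Equiv.Perm Y × H × H → Y × Y := fun g o =>
    if g ∈ Γ then (o.1 j, o.1 j) else (o.1 (ι (σ, o.2.1)), o.1 (ι (σ, o.2.2))) with hφ
  set w : I → Y × Y → ℝ := fun g z => if g ∈ Γ then 1 / (Fintype.card Y : ℝ)
    else 1 / (Fintype.card Y : ℝ) ^ 2 *
        (if z.1 = z.2 then (Fintype.card Y : ℝ) / Fintype.card H else 1) with hw
  have h1 : 𝔼 τ, sideFraction ι Γ j 𝒜 σ τ ^ 2
      = 𝔼 o : I → Equiv.Perm Y × H × H, F (fun g => φ g (o g)) := by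
    rw [← expect_pi_prod (fun τ b => F fun g => φ g (τ g, b g))]
    refine Finset.expect_congr rfl fun τ _ => ?_
    rw [← expect_pi_prod (fun a a' => F fun g => φ g (τ g, a g, a' g))]
    rw [sq, sideFraction, Finset.expect_mul_expect]
    refine Finset.expect_congr rfl fun a _ => Finset.expect_congr rfl fun a' _ => ?_
    have e1 : neighborLabels ι Γ j τ (σ, a) = fun g => (φ g (τ g, a g, a' g)).1 := by
      funext g; simp only [neighborLabels, hφ]; split_ifs <;> rfl
    have e2 : neighborLabels ι Γ j τ (σ, a') = fun g => (φ g (τ g, a g, a' g)).2 := by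
      funext g; simp only [neighborLabels, hφ]; split_ifs <;> rfl
    rw [e1, e2]
    simp only [hF]
    split_ifs <;> simp_all
  rw [h1]
  refine (expect_pi_comp_le φ F (fun z => by simp only [hF]; split_ifs <;> simp) w ?_).trans ?_
  · intro g z
    by_cases hg : g ∈ Γ
    · simp only [hφ, hw, hg, if_true]
      have e : (𝔼 o : Equiv.Perm Y × H × H, if o.1 j = z.1 then (1 : ℝ) else 0)
          = 1 / Fintype.card Y := by
        rw [← expect_perm_apply_eq j z.1, ← Finset.univ_product_univ, Finset.expect_product]
        refine Finset.expect_congr rfl fun τ _ => ?_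
        exact Finset.expect_const (Finset.univ_nonempty (α := H × H)) (if τ j = z.1 then (1 : ℝ) else 0)
      rw [← e]
      refine Finset.expect_le_expect fun o _ => ?_
      by_cases h : o.1 j = z.1
      · rw [if_pos h]; split_ifs <;> simp
      · rw [if_neg h, if_neg]
        intro h'
        exact h (by rw [← h'])
    · simp only [hφ, hw, hg, if_false]
      exact expect_pair_labels_le hι σ z
  · have h2 : ∑ z : I → Y × Y, (∏ g, w g (z g)) * F z
        = ∑ u ∈ 𝒜, ∑ u' ∈ 𝒜, ∏ g, w g (u g, u' g) := by
      rw [← Finset.sum_product']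
      have : ∑ x ∈ 𝒜 ×ˢ 𝒜, ∏ g, w g (x.1 g, x.2 g)
          = ∑ x : (I → Y) × (I → Y), (∏ g, w g (x.1 g, x.2 g)) * F fun g => (x.1 g, x.2 g) := by
        rw [← Finset.sum_subset (Finset.subset_univ (𝒜 ×ˢ 𝒜))]
        · refine Finset.sum_congr rfl fun x hx => ?_
          rw [Finset.mem_product] at hx
          simp only [hF]
          rw [if_pos hx, mul_one]
        · intro x _ hx
          rw [Finset.mem_product] at hx
          simp only [hF]
          rw [if_neg hx, mul_zero]
      rw [this]
      exact Fintype.sum_equiv (Equiv.arrowProdEquivProdArrow I (fun _ => Y) (fun _ => Y)) _ _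
        fun z => rfl
    rw [h2]
    have h3 : ∀ u u' : I → Y, ∏ g, w g (u g, u' g)
        = (1 / (Fintype.card Y : ℝ)) ^ Γ.card * (1 / (Fintype.card Y : ℝ) ^ 2) ^ Γᶜ.card *
          ∏ g ∈ Γᶜ, (if u g = u' g then (Fintype.card Y : ℝ) / Fintype.card H else 1) := by
      intro u u'
      rw [← Finset.prod_mul_prod_compl Γ]
      have e1 : ∏ g ∈ Γ, w g (u g, u' g) = (1 / (Fintype.card Y : ℝ)) ^ Γ.card := by
        rw [Finset.prod_congr rfl fun g hg => if_pos hg, Finset.prod_const]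
      have e2 : ∏ g ∈ Γᶜ, w g (u g, u' g) = (1 / (Fintype.card Y : ℝ) ^ 2) ^ Γᶜ.card *
          ∏ g ∈ Γᶜ, (if u g = u' g then (Fintype.card Y : ℝ) / Fintype.card H else 1) := by
        rw [Finset.prod_congr rfl fun g hg => if_neg (Finset.mem_compl.1 hg),
          Finset.prod_mul_distrib, Finset.prod_const]
      rw [e1, e2, mul_assoc]
    simp_rw [h3, ← Finset.mul_sum]
    refine mul_le_mul_of_nonneg_left ?_ (by positivity)
    have hc : 1 ≤ (Fintype.card Y : ℝ) / Fintype.card H := by rwa [le_div_iff₀ hh, one_mul]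
    refine (Finset.sum_le_sum fun u hu => sum_prod_agree_le hθ hc hs u hu).trans (le_of_eq ?_)
    rw [Finset.sum_const, nsmul_eq_mul]
    ring

/-- Let `E` be the event that the labels on `Γ` are those of `𝒜`, `P` its probability and `m` the
density of `𝒜`. Given `E`, each side fraction has mean `m / P` and second moment at most `5 / 4` of
the squared mean, hence is close to `m / P`. Comparing both sides with this common value gains a
factor of two over the trivial bound `2 * m`. -/
lemma expect_abs_sub_sideFraction_le {ι : Bool × H → Y} (hι : Function.Injective ι) [Nonempty H]
    {Γ : Finset I} (j : Y) {𝒜 : Finset (I → Y)} {θ : ℝ} (hθ : 0 ≤ θ)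
    (hθ' : (1 + Fintype.card Y / Fintype.card H * θ) ^ Fintype.card I ≤ 5 / 4)
    (hs : IsSpread θ Γ 𝒜) (hΓ : ∀ x ∈ 𝒜, ∀ x' ∈ 𝒜, ∀ g ∈ Γ, x g = x' g) :
    𝔼 τ, |sideFraction ι Γ j 𝒜 true τ - sideFraction ι Γ j 𝒜 false τ|
      ≤ 𝒜.card / (Fintype.card Y : ℝ) ^ Fintype.card I := by
  have hQ : (0 : ℝ) < Fintype.card Y := by exact_mod_cast Fintype.card_pos_iff.2 ⟨j⟩
  rcases 𝒜.eq_empty_or_nonempty with h𝒜 | ⟨v, hv⟩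
  · subst h𝒜
    simp [sideFraction]
  have hA : (0 : ℝ) < 𝒜.card := by exact_mod_cast Finset.card_pos.2 ⟨v, hv⟩
  set q : ℝ := (Fintype.card Y : ℝ) with hq
  set P : ℝ := (1 / q) ^ Γ.card with hP
  have hPpos : 0 < P := by positivity
  set m : ℝ := 𝒜.card / q ^ Fintype.card I with hm
  have hmpos : 0 < m := by positivity
  set E : (I → Equiv.Perm Y) → ℝ := fun τ => if ∀ g ∈ Γ, τ g j = v g then 1 else 0 with hE
  have hEP : 𝔼 τ, E τ = P := by
    have := expect_perm_pi_apply (I := I) (fun _ => j)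
      fun x : I → Y => if ∀ g ∈ Γ, x g = v g then (1 : ℝ) else 0
    rw [show (𝔼 τ, E τ) = _ from this, Fintype.expect_eq_sum_div_card, ← Finset.sum_filter,
      Finset.sum_const, nsmul_eq_mul, mul_one, card_agree, Fintype.card_fun]
    have hle : Γ.card ≤ Fintype.card I := Finset.card_le_univ _
    rw [hP, Nat.cast_pow, Nat.cast_pow, ← hq, one_div, inv_pow]
    rw [pow_sub₀ _ hQ.ne' hle]
    field_simp
  have hside : ∀ σ, 𝔼 τ, |sideFraction ι Γ j 𝒜 σ τ - m / P * E τ| ≤ m / 2 := by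
    intro σ
    set F := sideFraction ι Γ j 𝒜 σ with hF
    have hFE : ∀ τ, F τ * E τ = F τ := by
      intro τ
      simp only [hE]
      split_ifs with h
      · rw [mul_one]
      · rw [mul_zero]
        symm
        refine Finset.expect_eq_zero fun a _ => if_neg fun hmem => h fun g hg => ?_
        have := hΓ _ hmem _ hv g hg
        simpa [neighborLabels, hg] using this
    have hEE : ∀ τ, E τ * E τ = E τ := by
      intro τ; simp only [hE]; split_ifs <;> simp
    -- Arithmetic-geometric mean inequality with `m / (2 * P)` as the reference deviation; the
    -- factor `5 / 4` then makes the total exactly `m / 2`.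
    have hpt : ∀ τ, |F τ - m / P * E τ| ≤ (P / m * F τ ^ 2 + m / (4 * P) * E τ)
        + (m / P * E τ - 2 * F τ) := by
      intro τ
      by_cases h : E τ = 0
      · have hF0 : F τ = 0 := by rw [← hFE, h, mul_zero]
        simp [h, hF0]
      · have h1 : E τ = 1 := by
          have := hEE τ
          exact mul_left_cancel₀ h (by rw [this, mul_one])
        rw [h1, mul_one, mul_one]
        have h2 : 0 ≤ P / m * (|F τ - m / P| - m / (2 * P)) ^ 2 := by positivity
        have h3 : P / m * (|F τ - m / P| - m / (2 * P)) ^ 2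
            = P / m * |F τ - m / P| ^ 2 - |F τ - m / P| + m / (4 * P) := by
          field_simp
          ring
        rw [sq_abs] at h3
        have h4 : P / m * (F τ - m / P) ^ 2 = P / m * F τ ^ 2 - 2 * F τ + m / P := by
          field_simp
          ring
        linarith
    have hsq : 𝔼 τ, F τ ^ 2 ≤ 5 / 4 * (m ^ 2 / P) := by
      refine (expect_sideFraction_sq_le hι j σ hθ hs).trans ?_
      have hcard : Γ.card + Γᶜ.card = Fintype.card I := Finset.card_add_card_compl Γ
      have e : (1 / q) ^ Γ.card * (1 / q ^ 2) ^ Γᶜ.card * (𝒜.card : ℝ) ^ 2 = m ^ 2 / P := by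
        rw [hm, hP, ← hcard, pow_add, one_div, one_div, inv_pow, inv_pow]
        field_simp
        ring
      calc _ = (1 + q / Fintype.card H * θ) ^ Fintype.card I *
            ((1 / q) ^ Γ.card * (1 / q ^ 2) ^ Γᶜ.card * (𝒜.card : ℝ) ^ 2) := by ring
        _ ≤ _ := by rw [e]; exact mul_le_mul_of_nonneg_right hθ' (by positivity)
    calc _ ≤ 𝔼 τ, ((P / m * F τ ^ 2 + m / (4 * P) * E τ) + (m / P * E τ - 2 * F τ)) :=
          Finset.expect_le_expect fun τ _ => hpt τ
      _ = P / m * (𝔼 τ, F τ ^ 2) + m / (4 * P) * P + (m / P * P - 2 * m) := by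
          rw [Finset.expect_add_distrib, Finset.expect_add_distrib, Finset.expect_sub_distrib,
            ← Finset.mul_expect, ← Finset.mul_expect, ← Finset.mul_expect, ← Finset.mul_expect,
            hEP, expect_sideFraction]
      _ ≤ P / m * (5 / 4 * (m ^ 2 / P)) + m / (4 * P) * P + (m / P * P - 2 * m) := by gcongr
      _ = m / 2 := by field_simp; ring
  calc _ ≤ 𝔼 τ, (|sideFraction ι Γ j 𝒜 true τ - m / P * E τ|
        + |sideFraction ι Γ j 𝒜 false τ - m / P * E τ|) := by
        refine Finset.expect_le_expect fun τ _ => ?_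
        have := abs_sub_le (sideFraction ι Γ j 𝒜 true τ) (m / P * E τ)
          (sideFraction ι Γ j 𝒜 false τ)
        rwa [abs_sub_comm (m / P * E τ)] at this
    _ ≤ m / 2 + m / 2 := by rw [Finset.expect_add_distrib]; exact add_le_add (hside _) (hside _)
    _ = m := by ring

/-- Conditioning on the message splits the inputs into classes. Outside `U` the bias is bounded by
one; on `U` the two sides nearly cancel in every class, and half of the density of `U` is saved. -/
theorem expect_abs_condAvg_sideSign_le {ι : Bool × H → Y} (hι : Function.Injective ι) [Nonempty H]
    (f : (I → Y) → 𝓜) {Γ : Finset I} (j : Y) {U : Finset (I → Y)} {θ : ℝ} (hθ : 0 ≤ θ)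
    (hθ' : (1 + Fintype.card Y / Fintype.card H * θ) ^ Fintype.card I ≤ 5 / 4)
    (hs : ∀ z, IsSpread θ Γ (U.filter fun x => x ∈ messageClass f Γ z)) :
    𝔼 τ, 𝔼 x : Bool × (I → H), |condAvg (fun x : Bool × (I → H) => sideSign x.1)
        (fun x => f (neighborLabels ι Γ j τ x)) x|
      ≤ 1 - 1 / 2 * (U.card / (Fintype.card Y : ℝ) ^ Fintype.card I) := by
  set q : ℝ := (Fintype.card Y : ℝ) with hq
  set X := Bool × (I → H)
  set N : (I → Equiv.Perm Y) → X → (I → Y) := neighborLabels ι Γ j with hN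
  set T : Finset (Finset (I → Y)) := Finset.univ.image (messageClass f Γ) with hT
  set χ : X → ℝ := fun x => sideSign x.1 with hχ
  have hX : (0 : ℝ) < Fintype.card X := by exact_mod_cast Fintype.card_pos (α := X)
  have hagree : ∀ τ x x', ∀ g ∈ Γ, N τ x g = N τ x' g := by
    intro τ x x' g hg
    simp [hN, neighborLabels, hg]
  have hkey : ∀ τ, 𝔼 x, |condAvg χ (fun x => f (N τ x)) x|
      ≤ (1 - 𝔼 x, if N τ x ∈ U then (1 : ℝ) else 0) +
        ∑ S ∈ T, 1 / 2 * |sideFraction ι Γ j (U.filter (· ∈ S)) true τ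
          - sideFraction ι Γ j (U.filter (· ∈ S)) false τ| := by
    intro τ
    set M : X → Finset (I → Y) := fun x => messageClass f Γ (N τ x) with hM
    -- For fixed `τ` and `j` the revealed labels do not depend on `x`, so the message and its class
    -- carry the same information.
    have hcong : ∀ x, condAvg χ (fun x => f (N τ x)) x = condAvg χ M x := by
      refine condAvg_congr _ _ _ fun x x' => ?_
      simp only [hM]
      constructor
      · intro h
        exact messageClass_eq (mem_messageClass.2 ⟨h, hagree τ x x'⟩)
      · intro h
        have := self_mem_messageClass f Γ (N τ x)
        rw [h] at this
        exact (mem_messageClass.1 this).1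
    have hMT : ∀ x, M x ∈ T := fun x => Finset.mem_image_of_mem _ (Finset.mem_univ _)
    simp_rw [hcong]
    have hsplit : ∀ S ∈ T, |∑ x with M x = S, χ x| ≤
        ∑ x with M x = S, (if N τ x ∈ U then (0 : ℝ) else 1) +
        |∑ x, if N τ x ∈ U ∧ N τ x ∈ S then χ x else 0| := by
      intro S hS
      obtain ⟨z, -, rfl⟩ := Finset.mem_image.1 hS
      have hMS : ∀ x, M x = messageClass f Γ z ↔ N τ x ∈ messageClass f Γ z := fun x =>
        ⟨fun h => h ▸ self_mem_messageClass f Γ _, fun h => messageClass_eq h⟩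
      have e : ∑ x with M x = messageClass f Γ z, χ x
          = ∑ x with M x = messageClass f Γ z, (if N τ x ∈ U then 0 else χ x)
            + ∑ x, if N τ x ∈ U ∧ N τ x ∈ messageClass f Γ z then χ x else 0 := by
        rw [Finset.sum_filter, Finset.sum_filter, ← Finset.sum_add_distrib]
        refine Finset.sum_congr rfl fun x _ => ?_
        by_cases h1 : N τ x ∈ messageClass f Γ z
        · simp only [(hMS x).2 h1, h1]
          split_ifs <;> simp_all
        · have h2 := mt (hMS x).1 h1
          simp [h1, h2]
      rw [e]
      refine (abs_add_le _ _).trans (add_le_add_left ?_ _)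
      refine (Finset.abs_sum_le_sum_abs _ _).trans (Finset.sum_le_sum fun x _ => ?_)
      split_ifs
      · simp
      · exact (abs_sideSign _).le
    have hfrac : ∀ S : Finset (I → Y), |∑ x, if N τ x ∈ U ∧ N τ x ∈ S then χ x else 0|
        = Fintype.card X * (1 / 2 * |sideFraction ι Γ j (U.filter (· ∈ S)) true τ
          - sideFraction ι Γ j (U.filter (· ∈ S)) false τ|) := by
      intro S
      have hcX : (Fintype.card X : ℝ) = 2 * Fintype.card (I → H) := by
        simp [X]
      have hcH : (0 : ℝ) < Fintype.card (I → H) := by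
        exact_mod_cast Fintype.card_pos (α := I → H)
      have e : ∑ x, (if N τ x ∈ U ∧ N τ x ∈ S then χ x else 0)
          = Fintype.card (I → H) * (sideFraction ι Γ j (U.filter (· ∈ S)) true τ
          - sideFraction ι Γ j (U.filter (· ∈ S)) false τ) := by
        rw [Fintype.sum_prod_type, Fintype.sum_bool]
        unfold sideFraction
        rw [mul_sub, Fintype.card_mul_expect, Fintype.card_mul_expect, sub_eq_add_neg,
          ← Finset.sum_neg_distrib]
        congr 1
        all_goals
          refine Finset.sum_congr rfl fun a _ => ?_
          simp only [Finset.mem_filter]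
          split_ifs <;> simp [hχ, sideSign]
      rw [e, abs_mul, abs_of_pos hcH, hcX]
      ring
    have hsum : ∑ x, |condAvg χ M x| ≤ ∑ x, (if N τ x ∈ U then (0 : ℝ) else 1) +
        ∑ S ∈ T, Fintype.card X * (1 / 2 * |sideFraction ι Γ j (U.filter (· ∈ S)) true τ
          - sideFraction ι Γ j (U.filter (· ∈ S)) false τ|) := by
      have e0 : ∑ x, |condAvg χ M x| = ∑ m ∈ T, |∑ x with M x = m, χ x| := by
        rw [sum_abs_condAvg χ M T hMT]
        congr!
      rw [e0]
      refine (Finset.sum_le_sum hsplit).trans ?_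
      rw [Finset.sum_add_distrib, Finset.sum_fiberwise_of_maps_to fun x _ => hMT x]
      simp_rw [hfrac]
      exact le_rfl
    have h1 : 1 - (𝔼 x, if N τ x ∈ U then (1 : ℝ) else 0)
        = (∑ x, (if N τ x ∈ U then (0 : ℝ) else 1)) / Fintype.card X := by
      rw [← Fintype.expect_eq_sum_div_card]
      nth_rewrite 1 [← Fintype.expect_const (ι := X) (1 : ℝ)]
      rw [← Finset.expect_sub_distrib]
      refine Finset.expect_congr rfl fun x _ => ?_
      split_ifs <;> simp
    rw [h1, Fintype.expect_eq_sum_div_card, div_le_iff₀ hX, add_mul, div_mul_cancel₀ _ hX.ne',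
      Finset.sum_mul]
    refine hsum.trans (le_of_eq ?_)
    congr 1
    exact Finset.sum_congr rfl fun S _ => mul_comm _ _
  refine (Finset.expect_le_expect fun τ _ => hkey τ).trans ?_
  rw [Finset.expect_add_distrib, Finset.expect_sub_distrib, Fintype.expect_const,
    Finset.expect_sum_comm]
  have hU : (𝔼 τ, 𝔼 x, if N τ x ∈ U then (1 : ℝ) else 0) = U.card / q ^ Fintype.card I := by
    rw [Finset.expect_comm]
    have : ∀ x : X, (𝔼 τ, if N τ x ∈ U then (1 : ℝ) else 0) = U.card / q ^ Fintype.card I := by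
      intro x
      rw [hN, expect_neighborLabels ι Γ j x fun z => if z ∈ U then (1 : ℝ) else 0,
        Fintype.expect_eq_sum_div_card]
      simp [hq]
    simp_rw [this]
    rw [Fintype.expect_const]
  have hS : ∑ S ∈ T, (𝔼 τ, 1 / 2 * |sideFraction ι Γ j (U.filter (· ∈ S)) true τ
          - sideFraction ι Γ j (U.filter (· ∈ S)) false τ|)
      ≤ ∑ S ∈ T, 1 / 2 * ((U.filter (· ∈ S)).card / q ^ Fintype.card I) := by
    refine Finset.sum_le_sum fun S hS => ?_
    obtain ⟨z, -, rfl⟩ := Finset.mem_image.1 hS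
    rw [← Finset.mul_expect]
    refine mul_le_mul_of_nonneg_left ?_ (by norm_num)
    refine expect_abs_sub_sideFraction_le hι j hθ hθ' (hs z) ?_
    intro x hx x' hx' g hg
    have h1 := (mem_messageClass.1 (Finset.mem_filter.1 hx).2).2 g hg
    have h2 := (mem_messageClass.1 (Finset.mem_filter.1 hx').2).2 g hg
    rw [h1, h2]
  have hcount : ∑ S ∈ T, ((U.filter (· ∈ S)).card : ℝ) = U.card := by
    have := Finset.card_eq_sum_card_fiberwise (s := U) (t := T) (f := messageClass f Γ)
      fun x _ => Finset.mem_image_of_mem _ (Finset.mem_univ _)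
    rw [this]
    push_cast
    refine Finset.sum_congr rfl fun S hS => ?_
    obtain ⟨z, -, rfl⟩ := Finset.mem_image.1 hS
    congr 2
    ext x
    simp only [Finset.mem_filter]
    refine and_congr_right fun _ => ⟨fun h => messageClass_eq h, fun h => ?_⟩
    rw [← h]; exact self_mem_messageClass f Γ x
  have hfin : ∑ S ∈ T, 1 / 2 * ((U.filter (· ∈ S)).card / q ^ Fintype.card I)
      = 1 / 2 * (U.card / q ^ Fintype.card I) := by
    rw [← Finset.mul_sum, ← Finset.sum_div, hcount]
  rw [hU]
  linarith

end Moment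

/-! ### What a short common message can add to individual messages. -/

section Leakage

open scoped Classical

set_option linter.unusedSectionVars false

lemma condAvg_abs_le {X 𝓜 : Type*} [Fintype X] {χ : X → ℝ} (hχ : ∀ x, |χ x| ≤ 1) (M : X → 𝓜)
    (x : X) : |condAvg χ M x| ≤ 1 := by
  have hpos : (0 : ℝ) < (Finset.univ.filter fun x' => M x' = M x).card := by
    exact_mod_cast Finset.card_pos.2 ⟨x, by simp⟩
  rw [condAvg, abs_div, Nat.abs_cast, div_le_one hpos]
  refine (Finset.abs_sum_le_sum_abs _ _).trans ?_
  refine (Finset.sum_le_sum fun x' _ => hχ x').trans ?_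
  simp

lemma exp_le_one_add_add_sq {u : ℝ} (hu : |u| ≤ 1) : Real.exp u ≤ 1 + u + u ^ 2 := by
  have := Real.abs_exp_sub_one_sub_id_le hu
  have := le_abs_self (Real.exp u - 1 - u)
  linarith

variable {J X 𝓜 ζ : Type*} [Fintype J] [Fintype X]

/-- Given all individual messages, the terms are independent, have mean zero and are bounded by 2,
while the coefficients are constants. The moment generating function therefore factorizes, with a
factor of at most `exp (4 * t ^ 2)` for each index. -/
lemma expect_exp_sum_le [Nonempty X] {ψ : J → X → ℝ} (hψ : ∀ j x, |ψ j x| ≤ 2) (M : J → X → 𝓜)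
    (hψ0 : ∀ j m, ∑ x with M j x = m, ψ j x = 0) (ε : J → (J → 𝓜) → ℝ)
    (hε : ∀ j m, |ε j m| ≤ 1) {t : ℝ} (ht : 0 < t) (ht' : t ≤ 1 / 2) :
    𝔼 ω : J → X, Real.exp (t * ∑ j, ε j (fun i => M i (ω i)) * ψ j (ω j))
      ≤ Real.exp (4 * t ^ 2 * Fintype.card J) := by
  have hfib : ∀ j m (e : ℝ), |e| ≤ 1 → ∑ x with M j x = m, Real.exp (t * (e * ψ j x))
      ≤ (Finset.univ.filter fun x => M j x = m).card * Real.exp (4 * t ^ 2) := by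
    intro j m e he
    have h1 : ∀ x, Real.exp (t * (e * ψ j x)) ≤ 1 + 4 * t ^ 2 + t * e * ψ j x := by
      intro x
      have h2 : |e * ψ j x| ≤ 2 := by
        rw [abs_mul]
        nlinarith [hψ j x, abs_nonneg e, abs_nonneg (ψ j x)]
      have h3 : |t * (e * ψ j x)| ≤ 1 := by
        rw [abs_mul, abs_of_pos ht]
        nlinarith [abs_nonneg (e * ψ j x)]
      have h4 := exp_le_one_add_add_sq h3
      have h5 : (e * ψ j x) ^ 2 ≤ 4 := by
        rw [← sq_abs]; nlinarith [abs_nonneg (e * ψ j x)]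
      have h6 : (t * (e * ψ j x)) ^ 2 ≤ 4 * t ^ 2 := by
        rw [mul_pow]; nlinarith [sq_nonneg t]
      linarith
    refine (Finset.sum_le_sum fun x _ => h1 x).trans ?_
    rw [Finset.sum_add_distrib, ← Finset.mul_sum, hψ0, mul_zero, add_zero, Finset.sum_const,
      nsmul_eq_mul]
    refine mul_le_mul_of_nonneg_left ?_ (Nat.cast_nonneg _)
    have := Real.add_one_le_exp (4 * t ^ 2)
    linarith
  set T : Finset (J → 𝓜) := Finset.univ.image fun ω : J → X => fun i => M i (ω i) with hT
  have hmaps : ∀ ω ∈ (Finset.univ : Finset (J → X)), (fun i => M i (ω i)) ∈ T := fun ω hω =>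
    Finset.mem_image_of_mem _ hω
  have hfil : ∀ m : J → 𝓜, (Finset.univ.filter fun ω : J → X => (fun i => M i (ω i)) = m)
      = Fintype.piFinset fun j => Finset.univ.filter fun x => M j x = m j := by
    intro m
    ext ω
    simp [funext_iff]
  have hpos : (0 : ℝ) < Fintype.card (J → X) := by exact_mod_cast Fintype.card_pos
  rw [Fintype.expect_eq_sum_div_card, div_le_iff₀ hpos]
  rw [← Finset.sum_fiberwise_of_maps_to hmaps]
  have hm : ∀ m ∈ T, ∑ ω : J → X with (fun i => M i (ω i)) = m,
      Real.exp (t * ∑ j, ε j (fun i => M i (ω i)) * ψ j (ω j))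
      ≤ Real.exp (4 * t ^ 2 * Fintype.card J) *
        (Finset.univ.filter fun ω : J → X => (fun i => M i (ω i)) = m).card := by
    intro m _
    have e1 : ∑ ω : J → X with (fun i => M i (ω i)) = m,
        Real.exp (t * ∑ j, ε j (fun i => M i (ω i)) * ψ j (ω j))
        = ∑ ω : J → X with (fun i => M i (ω i)) = m, ∏ j, Real.exp (t * (ε j m * ψ j (ω j))) := by
      refine Finset.sum_congr rfl fun ω hω => ?_
      rw [(Finset.mem_filter.1 hω).2, Finset.mul_sum, Real.exp_sum]
    rw [e1, hfil, ← Finset.prod_univ_sum (fun j => Finset.univ.filter fun x => M j x = m j)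
      (fun j x => Real.exp (t * (ε j m * ψ j x))), Fintype.card_piFinset]
    refine (Finset.prod_le_prod (fun j _ => Finset.sum_nonneg fun x _ => (Real.exp_pos _).le)
      fun j _ => hfib j (m j) (ε j m) (hε j m)).trans (le_of_eq ?_)
    rw [Finset.prod_mul_distrib, Finset.prod_const, ← Real.exp_nat_mul, Finset.card_univ]
    push_cast
    rw [mul_comm]
    congr 2
    ring
  refine (Finset.sum_le_sum hm).trans (le_of_eq ?_)
  rw [← Finset.mul_sum]
  congr 1
  have := Finset.card_eq_sum_card_fiberwise (s := (Finset.univ : Finset (J → X))) (t := T)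
    (f := fun ω i => M i (ω i)) fun ω hω => Finset.mem_coe.2 (hmaps ω (Finset.mem_univ _))
  rw [Finset.card_univ] at this
  rw [this]
  push_cast
  congr!

lemma expect_apply_eq [Nonempty X] (j : J) (F : X → ℝ) : 𝔼 ω : J → X, F (ω j) = 𝔼 x, F x := by
  have h1 : 𝔼 ω : J → X, F (ω j) = 𝔼 p : X × ({i // i ≠ j} → X), F p.1 :=
    Fintype.expect_equiv (Equiv.funSplitAt j X) _ _ fun ω => rfl
  rw [h1, ← Finset.univ_product_univ, Finset.expect_product]
  refine Finset.expect_congr rfl fun x _ => ?_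
  exact Finset.expect_const (Finset.univ_nonempty (α := {i // i ≠ j} → X)) (F x)

/-- The total correlation of independent signs with a common message of few values and individual
messages exceeds that with the individual messages alone by little. -/
lemma expect_sum_sign_le [Nonempty X] {χ : X → ℝ} (hχ : ∀ x, |χ x| ≤ 1) (M : J → X → 𝓜)
    (Z : (J → X) → ζ) (Zs : Finset ζ) (hZs : Zs.Nonempty) (ε : J → (J → 𝓜) → ζ → ℝ)
    (hε : ∀ j m z, |ε j m z| ≤ 1) {t : ℝ} (ht : 0 < t) (ht' : t ≤ 1 / 2) :
    𝔼 ω : J → X, ∑ j, ε j (fun i => M i (ω i)) (Z ω) * χ (ω j)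
      ≤ ∑ j, (𝔼 x, |condAvg χ (M j) x|) + (Real.log Zs.card / t + 4 * t * Fintype.card J)
        + 2 * Fintype.card J * 𝔼 ω, if Z ω ∈ Zs then (0 : ℝ) else 1 := by
  obtain ⟨z₀, hz₀⟩ := hZs
  -- Exceptional values of the common message are replaced by a default, so that a union bound over
  -- `Zs` is possible; they are charged to the last term of the bound.
  set Z' : (J → X) → ζ := fun ω => if Z ω ∈ Zs then Z ω else z₀ with hZ'
  have hZ'mem : ∀ ω, Z' ω ∈ Zs := by
    intro ω; simp only [hZ']; split_ifs <;> assumption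
  set ψ : J → X → ℝ := fun j x => χ x - condAvg χ (M j) x with hψ
  set Mω : (J → X) → (J → 𝓜) := fun ω i => M i (ω i) with hMω
  have hψ2 : ∀ j x, |ψ j x| ≤ 2 := by
    intro j x
    have h1 := hχ x
    have h2 := condAvg_abs_le hχ (M j) x
    have := abs_sub (χ x) (condAvg χ (M j) x)
    simp only [hψ]
    linarith
  have hψ0 : ∀ j m, ∑ x with M j x = m, ψ j x = 0 := by
    intro j m
    simp only [hψ]
    rw [Finset.sum_sub_distrib, sum_condAvg, sub_self]
  set S : (J → X) → ℝ := fun ω => ∑ j, ε j (Mω ω) (Z' ω) * ψ j (ω j) with hS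
  set N : ℝ := ((Fintype.card J : ℕ) : ℝ) with hN
  have hcardpos : (0 : ℝ) < Zs.card := by exact_mod_cast Finset.card_pos.2 ⟨z₀, hz₀⟩
  set b : ℝ := Real.log Zs.card + 4 * t ^ 2 * N with hb
  have hexpS : 𝔼 ω, Real.exp (t * S ω) ≤ Real.exp b := by
    calc 𝔼 ω, Real.exp (t * S ω)
        ≤ 𝔼 ω, ∑ z ∈ Zs, Real.exp (t * ∑ j, ε j (Mω ω) z * ψ j (ω j)) := by
          refine Finset.expect_le_expect fun ω _ => ?_
          exact Finset.single_le_sum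
            (f := fun z => Real.exp (t * ∑ j, ε j (Mω ω) z * ψ j (ω j)))
            (fun z _ => (Real.exp_pos _).le) (hZ'mem ω)
      _ = ∑ z ∈ Zs, 𝔼 ω, Real.exp (t * ∑ j, ε j (Mω ω) z * ψ j (ω j)) :=
          Finset.expect_sum_comm _ _ _
      _ ≤ ∑ z ∈ Zs, Real.exp (4 * t ^ 2 * N) := Finset.sum_le_sum fun z _ =>
          expect_exp_sum_le hψ2 M hψ0 (fun j m => ε j m z) (fun j m => hε j m z) ht ht'
      _ = Real.exp b := by
          rw [Finset.sum_const, nsmul_eq_mul, hb, Real.exp_add, Real.exp_log hcardpos]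
  have hES : 𝔼 ω, S ω ≤ Real.log Zs.card / t + 4 * t * N := by
    -- The tangent line inequality at `b` turns the exponential moment bound into a bound on the
    -- mean.
    have h1 : ∀ ω, t * S ω ≤ Real.exp (-b) * Real.exp (t * S ω) + (b - 1) := by
      intro ω
      rw [← Real.exp_add]
      have := Real.add_one_le_exp (-b + t * S ω)
      linarith
    have h2 : t * 𝔼 ω, S ω ≤ b := by
      rw [Finset.mul_expect]
      refine (Finset.expect_le_expect fun ω _ => h1 ω).trans ?_
      rw [Finset.expect_add_distrib, Fintype.expect_const, ← Finset.mul_expect]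
      have : Real.exp (-b) * 𝔼 ω, Real.exp (t * S ω) ≤ Real.exp (-b) * Real.exp b :=
        mul_le_mul_of_nonneg_left hexpS (Real.exp_pos _).le
      rw [← Real.exp_add, neg_add_cancel, Real.exp_zero] at this
      linarith
    have e : Real.log Zs.card / t + 4 * t * N = b / t := by
      rw [hb]; field_simp
    rw [e, le_div_iff₀ ht]
    linarith
  have hpt : ∀ ω, ∑ j, ε j (Mω ω) (Z ω) * χ (ω j)
      ≤ ∑ j, |condAvg χ (M j) (ω j)| + S ω + 2 * N * (if Z ω ∈ Zs then (0 : ℝ) else 1) := by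
    intro ω
    have hbase : ∑ j, ε j (Mω ω) (Z' ω) * χ (ω j) ≤ ∑ j, |condAvg χ (M j) (ω j)| + S ω := by
      simp only [hS]
      rw [← Finset.sum_add_distrib]
      refine Finset.sum_le_sum fun j _ => ?_
      have h1 : ε j (Mω ω) (Z' ω) * χ (ω j) = ε j (Mω ω) (Z' ω) * condAvg χ (M j) (ω j)
          + ε j (Mω ω) (Z' ω) * ψ j (ω j) := by simp only [hψ]; ring
      rw [h1]
      have h2 := le_abs_self (ε j (Mω ω) (Z' ω) * condAvg χ (M j) (ω j))
      rw [abs_mul] at h2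
      have h3 := hε j (Mω ω) (Z' ω)
      nlinarith [abs_nonneg (condAvg χ (M j) (ω j))]
    by_cases hz : Z ω ∈ Zs
    · have : Z' ω = Z ω := if_pos hz
      rw [this] at hbase
      rw [if_pos hz, mul_zero, add_zero]
      exact hbase
    · rw [if_neg hz, mul_one]
      have h1 : ∀ z, |∑ j, ε j (Mω ω) z * χ (ω j)| ≤ N := by
        intro z
        refine (Finset.abs_sum_le_sum_abs _ _).trans ?_
        calc _ ≤ ∑ j : J, (1 : ℝ) := Finset.sum_le_sum fun j _ => by
              rw [abs_mul]
              nlinarith [hε j (Mω ω) z, hχ (ω j), abs_nonneg (ε j (Mω ω) z),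
                abs_nonneg (χ (ω j))]
          _ = N := by simp [hN]
      have h2 := le_of_abs_le (h1 (Z ω))
      have h3 := neg_le_of_abs_le (h1 (Z' ω))
      linarith
  refine (Finset.expect_le_expect fun ω _ => hpt ω).trans ?_
  rw [Finset.expect_add_distrib, Finset.expect_add_distrib, Finset.expect_sum_comm,
    ← Finset.mul_expect]
  have hmarg : ∀ j, (𝔼 ω : J → X, |condAvg χ (M j) (ω j)|) = 𝔼 x, |condAvg χ (M j) x| := by
    exact fun j => expect_apply_eq j fun x => |condAvg χ (M j) x|
  simp_rw [hmarg]
  linarith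

end Leakage

/-! ### The referee's information about the side of the special vertex of one unit. -/

section UnitBias

open scoped Classical

set_option linter.unusedSectionVars false

/-- Bit strings of length at most `n`. -/
def shortLists : ℕ → Finset (List Bool)
  | 0 => {[]}
  | n + 1 => insert [] ((Finset.univ ×ˢ shortLists n).image fun p => p.1 :: p.2)

lemma mem_shortLists {n : ℕ} {l : List Bool} : l ∈ shortLists n ↔ l.length ≤ n := by
  induction n generalizing l with
  | zero => simp [shortLists]
  | succ n ih =>
    cases l with
    | nil => simp [shortLists]
    | cons b l => simp [shortLists, ih]

lemma card_shortLists_le (n : ℕ) : (shortLists n).card + 1 ≤ 2 ^ (n + 1) := by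
  induction n with
  | zero => simp [shortLists]
  | succ n ih =>
    have h1 := Finset.card_insert_le ([] : List Bool)
      ((Finset.univ ×ˢ shortLists n).image fun p : Bool × List Bool => p.1 :: p.2)
    have h2 := Finset.card_image_le (s := Finset.univ ×ˢ shortLists n)
      (f := fun p : Bool × List Bool => p.1 :: p.2)
    rw [Finset.card_product] at h2
    simp only [Finset.card_univ, Fintype.card_bool] at h2
    simp only [shortLists]
    rw [pow_succ]
    omega

lemma expect_prod {α β : Type*} [Fintype α] [Fintype β] (F : α × β → ℝ) :
    𝔼 p, F p = 𝔼 a, 𝔼 b, F (a, b) := by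
  rw [← Finset.univ_product_univ, Finset.expect_product]

lemma expect_pi_uniform {I Ω Z : Type*} [Fintype I] [Fintype Ω] [Fintype Z] (φ : I → Ω → Z)
    (hφ : ∀ g z, (𝔼 o, if φ g o = z then (1 : ℝ) else 0) = 1 / Fintype.card Z)
    (F : (I → Z) → ℝ) : 𝔼 o : I → Ω, F (fun g => φ g (o g)) = 𝔼 z, F z := by
  rw [expect_pi_comp φ F]
  simp_rw [hφ]
  rw [Fintype.expect_eq_sum_div_card, Finset.sum_div]
  refine Finset.sum_congr rfl fun z _ => ?_
  rw [Finset.prod_const, Finset.card_univ, Fintype.card_fun, Nat.cast_pow, one_div, inv_pow]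
  ring

variable {A I Y H Ξ : Type*} [Fintype A] [Fintype I] [Fintype Y] [Fintype H] [Fintype Ξ]

/-- Replace the side of the middle vertex `j` by `b`. -/
def setSide (j : Y) (b : Bool) (ω : Y → Bool × (I → H)) : Y → Bool × (I → H) :=
  fun i => if i = j then (b, (ω i).2) else ω i

/-- Flipping the side of `j` preserves the uniform law, so correlation with the side is half the
difference of the means under the two prescribed sides. -/
lemma expect_sideSign_mul (j : Y) (F : (Y → Bool × (I → H)) → ℝ) :
    𝔼 ω, sideSign (ω j).1 * F ω
      = 1 / 2 * ((𝔼 ω, F (setSide j true ω)) - 𝔼 ω, F (setSide j false ω)) := by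
  set fl : (Y → Bool × (I → H)) → (Y → Bool × (I → H)) := fun ω => setSide j (!(ω j).1) ω with hfl
  have hinv : Function.Involutive fl := by
    intro ω
    funext i
    simp only [hfl, setSide]
    by_cases h : i = j
    · subst h; simp
    · simp [h]
  have h1 : 𝔼 ω, sideSign (ω j).1 * F ω = 𝔼 ω, sideSign (fl ω j).1 * F (fl ω) :=
    (Fintype.expect_equiv hinv.toPerm _ _ fun ω => rfl).symm
  have h2 : 𝔼 ω, sideSign (ω j).1 * F ω
      = 1 / 2 * 𝔼 ω, (sideSign (ω j).1 * F ω + sideSign (fl ω j).1 * F (fl ω)) := by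
    rw [Finset.expect_add_distrib, ← h1]; ring
  rw [h2, ← Finset.expect_sub_distrib]
  congr 1
  refine Finset.expect_congr rfl fun ω _ => ?_
  have h3 : ω = setSide j (ω j).1 ω := by
    funext i
    simp only [setSide]
    split_ifs with h
    · subst h; rfl
    · rfl
  have h4 : (fl ω j).1 = !(ω j).1 := by simp [hfl, setSide]
  rw [h4]
  simp only [hfl]
  cases hb : (ω j).1
  · rw [hb] at h3
    simp only [Bool.not_false, sideSign]
    nth_rewrite 1 [h3]
    simp
    ring
  · rw [hb] at h3
    simp only [Bool.not_true, sideSign]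
    nth_rewrite 1 [h3]
    simp
    ring

/-- What the referee sees of one unit: the public part `(a, j, ξ, τ)` of the sample, the messages of
the middle vertices and the messages of the hubs. -/
abbrev UnitView (A I Y H Ξ : Type*) : Type _ :=
  (A × Y × Ξ × (I → Equiv.Perm Y)) × (Y → List Bool) × (I × Bool × H → List Bool)

/-- The view of a unit for message functions `mid` of the middle vertices and `hub` of the hubs. -/
def unitView (ι : Bool × H → Y) (Gam : Ξ → Finset I) (mid : A → Y → (I → Y) → List Bool)
    (hub : A → I → Y → Bool → Set Y → List Bool) (p : A × Y × Ξ × (I → Equiv.Perm Y))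
    (ω : Y → Bool × (I → H)) : UnitView A I Y H Ξ :=
  (p, fun j => mid p.1 j (neighborLabels ι (Gam p.2.2.1) j p.2.2.2 (ω j)),
    fun q => hub p.1 q.1 (p.2.2.2 q.1 (ι q.2)) q.2.1 {j | (ω j).1 = q.2.1 ∧ (ω j).2 q.1 = q.2.2})

/-- The marginal law of what a single hub sees: its label is uniform, and each middle vertex
independently chooses a uniform side and hub index. This is the law that the hub-like inputs
reproduce. -/
lemma expect_hub_length [Nonempty Y] [Nonempty H] (ι : Bool × H → Y) (k : I → Y → Bool → Set Y → ℝ)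
    (q : I × Bool × H) :
    (𝔼 τ : I → Equiv.Perm Y, 𝔼 ω : Y → Bool × (I → H), k q.1 (τ q.1 (ι q.2)) q.2.1
        {j | (ω j).1 = q.2.1 ∧ (ω j).2 q.1 = q.2.2})
      = 𝔼 y, 𝔼 r : Y → Bool × H, k q.1 y q.2.1 {j | r j = q.2} := by
  have h1 : ∀ y, (𝔼 ω : Y → Bool × (I → H), k q.1 y q.2.1
        {j | (ω j).1 = q.2.1 ∧ (ω j).2 q.1 = q.2.2})
      = 𝔼 r : Y → Bool × H, k q.1 y q.2.1 {j | r j = q.2} := by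
    intro y
    rw [← expect_pi_uniform (fun (_ : Y) (o : Bool × (I → H)) => (o.1, o.2 q.1)) ?_
      fun r : Y → Bool × H => k q.1 y q.2.1 {j | r j = q.2}]
    · refine Finset.expect_congr rfl fun ω _ => ?_
      congr 1
      ext j
      simp [Prod.ext_iff]
    · rintro - ⟨σ, a⟩
      rw [expect_prod]
      simp only [Prod.mk.injEq]
      have : ∀ b : Bool, (𝔼 o : I → H, if b = σ ∧ o q.1 = a then (1 : ℝ) else 0)
          = if b = σ then 1 / (Fintype.card H : ℝ) else 0 := by
        intro b
        by_cases hb : b = σ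
        · simp only [hb, true_and, if_true]
          rw [expect_apply_eq q.1 fun x : H => if x = a then (1 : ℝ) else 0,
            Fintype.expect_eq_sum_div_card]
          simp
        · simp [hb]
      simp_rw [this]
      rw [Fintype.expect_eq_sum_div_card]
      simp
      ring
  simp_rw [h1]
  rw [expect_perm_pi_apply (fun _ => ι q.2) fun x : I → Y =>
    𝔼 r : Y → Bool × H, k q.1 (x q.1) q.2.1 {j | r j = q.2}]
  exact expect_apply_eq q.1 fun y => 𝔼 r : Y → Bool × H, k q.1 y q.2.1 {j | r j = q.2}

lemma expect_expect_sign_le {J X 𝓜 ζ : Type*} [Fintype J] [Nonempty J] [Fintype X] [Nonempty X]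
    {χ : X → ℝ} (hχ : ∀ x, |χ x| ≤ 1) (M : J → X → 𝓜)
    (Z : (J → X) → ζ) (Zs : Finset ζ) (hZs : Zs.Nonempty) (bad : (J → X) → ℝ)
    (hbad0 : ∀ ω, 0 ≤ bad ω) (hbad : ∀ ω, Z ω ∉ Zs → 1 ≤ bad ω) (ε : J → (J → 𝓜) → ζ → ℝ)
    (hε : ∀ j m z, |ε j m z| ≤ 1) {t : ℝ} (ht : 0 < t) (ht' : t ≤ 1 / 2) :
    𝔼 j, 𝔼 ω : J → X, χ (ω j) * ε j (fun i => M i (ω i)) (Z ω)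
      ≤ (𝔼 j, 𝔼 x, |condAvg χ (M j) x|) + (Real.log Zs.card / (t * Fintype.card J) + 4 * t)
        + 2 * 𝔼 ω, bad ω := by
  have hq : (0 : ℝ) < Fintype.card J := by exact_mod_cast Fintype.card_pos (α := J)
  have h := expect_sum_sign_le hχ M Z Zs hZs ε hε ht ht'
  have h1 : (𝔼 ω, if Z ω ∈ Zs then (0 : ℝ) else 1) ≤ 𝔼 ω, bad ω := by
    refine Finset.expect_le_expect fun ω _ => ?_
    split_ifs with hz
    · exact hbad0 ω
    · exact hbad ω hz
  rw [Finset.expect_sum_comm] at h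
  simp_rw [mul_comm (χ _)]
  rw [Fintype.expect_eq_sum_div_card, div_le_iff₀ hq, Fintype.expect_eq_sum_div_card]
  refine h.trans ?_
  have h2 := mul_le_mul_of_nonneg_left h1 hq.le
  generalize (∑ j, 𝔼 x, |condAvg χ (M j) x|) = S at *
  generalize Real.log Zs.card = lz at *
  have e2 : (S / Fintype.card J + (lz / (t * Fintype.card J) + 4 * t) + 2 * 𝔼 ω, bad ω)
      * Fintype.card J = S + (lz / t + 4 * t * Fintype.card J)
        + 2 * (Fintype.card J * 𝔼 ω, bad ω) := by
    field_simp
  rw [e2]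
  linarith

/-- The message vector of the hubs of one unit. -/
def hubView (ι : Bool × H → Y) (hub : I → Y → Bool → Set Y → List Bool) (τ : I → Equiv.Perm Y)
    (ω : Y → Bool × (I → H)) : I × Bool × H → List Bool :=
  fun q => hub q.1 (τ q.1 (ι q.2)) q.2.1 {j | (ω j).1 = q.2.1 ∧ (ω j).2 q.1 = q.2.2}

lemma exists_finset_short_messages (P : Type*) [Fintype P] (W : ℕ) :
    ∃ Zs : Finset (P → List Bool), Zs.Nonempty ∧ (∀ z, z ∉ Zs → ∃ p, W < (z p).length) ∧
      Real.log Zs.card ≤ Fintype.card P * (W + 1) := by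
  refine ⟨Fintype.piFinset fun _ : P => shortLists W,
    ⟨fun _ => [], Fintype.mem_piFinset.2 fun _ => mem_shortLists.2 (Nat.zero_le _)⟩,
    fun z hz => ?_, ?_⟩
  · rw [Fintype.mem_piFinset] at hz
    push Not at hz
    obtain ⟨p, hp⟩ := hz
    rw [mem_shortLists, not_le] at hp
    exact ⟨p, hp⟩
  have h0 : (0 : ℝ) < (shortLists W).card := by
    exact_mod_cast Finset.card_pos.2 ⟨[], mem_shortLists.2 (Nat.zero_le _)⟩
  rw [Fintype.card_piFinset, Finset.prod_const, Finset.card_univ, Nat.cast_pow, Real.log_pow]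
  refine mul_le_mul_of_nonneg_left ?_ (Nat.cast_nonneg _)
  have h1 : ((shortLists W).card : ℝ) ≤ 2 ^ (W + 1) := by
    have := card_shortLists_le W
    exact_mod_cast (by omega : (shortLists W).card ≤ 2 ^ (W + 1))
  refine (Real.log_le_log h0 h1).trans ?_
  rw [Real.log_pow]
  push_cast
  have := Real.log_two_lt_d9
  nlinarith

lemma expect_sum_hubView_length [Nonempty Y] [Nonempty H] (ι : Bool × H → Y)
    (hub : I → Y → Bool → Set Y → List Bool) :
    𝔼 τ : I → Equiv.Perm Y, 𝔼 ω, ∑ p : I × Bool × H, ((hubView ι hub τ ω p).length : ℝ)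
      = Fintype.card (Bool × H) / Fintype.card Y * 𝔼 r : Y → Bool × H, 𝔼 c : Bool × H, ∑ g, ∑ y,
          ((hub g y c.1 {j | r j = c}).length : ℝ) := by
  have e : ∀ r : Y → Bool × H, (𝔼 c : Bool × H, ∑ g, ∑ y,
      ((hub g y c.1 {j | r j = c}).length : ℝ))
      = (∑ c : Bool × H, ∑ g, ∑ y, ((hub g y c.1 {j | r j = c}).length : ℝ))
        / Fintype.card (Bool × H) := fun r => Fintype.expect_eq_sum_div_card _
  simp_rw [e]
  rw [← Finset.expect_div]
  have hne : (Fintype.card (Bool × H) : ℝ) ≠ 0 := by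
    exact_mod_cast (Fintype.card_pos (α := Bool × H)).ne'
  have e1 : ∀ τ : I → Equiv.Perm Y, (𝔼 ω, ∑ p : I × Bool × H,
      ((hubView ι hub τ ω p).length : ℝ))
      = ∑ p : I × Bool × H, 𝔼 ω, ((hubView ι hub τ ω p).length : ℝ) := fun τ =>
    Finset.expect_sum_comm _ _ _
  simp_rw [e1]
  rw [Finset.expect_sum_comm]
  have e2 : ∀ p : I × Bool × H, (𝔼 τ : I → Equiv.Perm Y, 𝔼 ω,
      ((hubView ι hub τ ω p).length : ℝ))
      = 𝔼 y, 𝔼 r : Y → Bool × H, ((hub p.1 y p.2.1 {j | r j = p.2}).length : ℝ) := fun p =>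
    expect_hub_length ι (fun g y σ R => ((hub g y σ R).length : ℝ)) p
  simp_rw [e2]
  rw [Fintype.sum_prod_type, Finset.sum_comm]
  simp_rw [fun (g : I) (c : Bool × H) => Fintype.expect_eq_sum_div_card (fun y =>
    𝔼 r : Y → Bool × H, ((hub g y c.1 {j | r j = c}).length : ℝ))]
  simp_rw [Finset.expect_sum_comm]
  simp_rw [← Finset.sum_div]
  field_simp

/-- Markov's inequality: if messages longer than `C` have probability above `1 / 4`, the mean length
exceeds `C / 4`, and the right-hand side is at least the trivial bound 1. -/
lemma expect_abs_condAvg_le_of_expect_length [Nonempty Y] [Nonempty H] [Nonempty Ξ]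
    {ι : Bool × H → Y} {Gam : Ξ → Finset I}
    {C : ℕ} (hC : 0 < C) {δ : ℝ} (hδ : 0 ≤ δ) (f : (I → Y) → List Bool) (j : Y)
    (hcore : (3 / 4 ≤ 𝔼 x, if (f x).length ≤ C then (1 : ℝ) else 0) →
      𝔼 ξ, 𝔼 τ, 𝔼 x : Bool × (I → H), |condAvg (fun x : Bool × (I → H) => sideSign x.1)
        (fun x => f (neighborLabels ι (Gam ξ) j τ x)) x| ≤ 1 - δ) :
    𝔼 ξ, 𝔼 τ, 𝔼 x : Bool × (I → H), |condAvg (fun x : Bool × (I → H) => sideSign x.1)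
        (fun x => f (neighborLabels ι (Gam ξ) j τ x)) x|
      ≤ (1 - δ) + δ * (4 / C) * 𝔼 x, ((f x).length : ℝ) := by
  have hCpos : (0 : ℝ) < C := by exact_mod_cast hC
  by_cases hc : 3 / 4 ≤ 𝔼 x, if (f x).length ≤ C then (1 : ℝ) else 0
  · refine (hcore hc).trans ?_
    have : 0 ≤ 𝔼 x, ((f x).length : ℝ) :=
      Finset.expect_nonneg fun x _ => Nat.cast_nonneg _
    have : 0 ≤ δ * (4 / C) * 𝔼 x, ((f x).length : ℝ) := by positivity
    linarith
  · push Not at hc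
    have h2 : 1 - (𝔼 x, if (f x).length ≤ C then (1 : ℝ) else 0)
        ≤ 1 / C * 𝔼 x, ((f x).length : ℝ) := by
      rw [Finset.mul_expect]
      nth_rewrite 1 [← Fintype.expect_const (ι := I → Y) (1 : ℝ)]
      rw [← Finset.expect_sub_distrib]
      refine Finset.expect_le_expect fun x _ => ?_
      split_ifs with h
      · simp only [sub_self]; positivity
      · rw [not_le] at h
        have h3 : (C : ℝ) ≤ (f x).length := by exact_mod_cast h.le
        rw [one_div, ← div_eq_inv_mul, le_div_iff₀ hCpos]
        linarith
    have h3 : 𝔼 ξ, 𝔼 τ, 𝔼 x : Bool × (I → H),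
        |condAvg (fun x : Bool × (I → H) => sideSign x.1)
        (fun x => f (neighborLabels ι (Gam ξ) j τ x)) x| ≤ 1 := by
      refine Finset.expect_le Finset.univ_nonempty fun ξ _ => ?_
      refine Finset.expect_le Finset.univ_nonempty fun τ _ => ?_
      refine Finset.expect_le Finset.univ_nonempty fun x _ => ?_
      exact condAvg_abs_le (fun x => (abs_sideSign _).le) _ _
    have h4 : 1 ≤ 4 / C * 𝔼 x, ((f x).length : ℝ) := by
      have e : 4 / C * (𝔼 x, ((f x).length : ℝ))
          = 4 * (1 / C * 𝔼 x, ((f x).length : ℝ)) := by ring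
      rw [e]; linarith
    have h5 := mul_le_mul_of_nonneg_left h4 hδ
    rw [← mul_assoc] at h5
    linarith

/-- The special vertex `j` is uniform, so only the average correlation over all middle vertices
matters. It is at most the bias given by the individual messages, plus the leakage of hub messages
of at most `W` bits, plus the probability of a longer hub message; the latter is small because the
hubs are a random fraction `2 * |H| / |Y|` of the labels. -/
theorem expect_sideSign_mul_view_le [Nonempty A] [Nonempty Y] [Nonempty H] [Nonempty Ξ]
    {ι : Bool × H → Y} {Gam : Ξ → Finset I}
    {mid : A → Y → (I → Y) → List Bool} {hub : A → I → Y → Bool → Set Y → List Bool}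
    {C : ℕ} (hC : 0 < C) {δ : ℝ} (hδ : 0 ≤ δ)
    (hcore : ∀ (f : (I → Y) → List Bool) (j : Y),
      (3 / 4 ≤ 𝔼 x, if (f x).length ≤ C then (1 : ℝ) else 0) →
      𝔼 ξ, 𝔼 τ, 𝔼 x : Bool × (I → H), |condAvg (fun x : Bool × (I → H) => sideSign x.1)
        (fun x => f (neighborLabels ι (Gam ξ) j τ x)) x| ≤ 1 - δ)
    (hmid : 𝔼 a, 𝔼 j, 𝔼 x, ((mid a j x).length : ℝ) ≤ C / 8) {B : ℝ}
    (hhub : 𝔼 a, 𝔼 r : Y → Bool × H, 𝔼 c : Bool × H, ∑ g, ∑ y,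
      ((hub a g y c.1 {j | r j = c}).length : ℝ) ≤ B)
    {W : ℕ} (hW : 0 < W) {t : ℝ} (ht : 0 < t) (ht' : t ≤ 1 / 2)
    (G : UnitView A I Y H Ξ → ℝ) (hG : ∀ v, |G v| ≤ 1) :
    𝔼 a, 𝔼 j, 𝔼 ξ, 𝔼 τ, 𝔼 ω, sideSign (ω j).1 * G (unitView ι Gam mid hub (a, j, ξ, τ) ω)
      ≤ 1 - δ / 2 + (Fintype.card (I × Bool × H) * (W + 1) / (t * Fintype.card Y) + 4 * t)
        + 2 * (Fintype.card (Bool × H) * B / (Fintype.card Y * W)) := by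
  have hqpos : (0 : ℝ) < Fintype.card Y := by exact_mod_cast Fintype.card_pos (α := Y)
  have hWpos : (0 : ℝ) < W := by exact_mod_cast hW
  have hCpos : (0 : ℝ) < C := by exact_mod_cast hC
  obtain ⟨bad, hbad⟩ : ∃ bad : A → (I → Equiv.Perm Y) → (Y → Bool × (I → H)) → ℝ,
      bad = fun a τ ω => 1 / W * ∑ p, ((hubView ι (hub a) τ ω p).length : ℝ) := ⟨_, rfl⟩
  obtain ⟨bias, hbias⟩ : ∃ bias : A → Y → Ξ → (I → Equiv.Perm Y) → ℝ,
      bias = fun a j ξ τ => 𝔼 x : Bool × (I → H),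
        |condAvg (fun x : Bool × (I → H) => sideSign x.1)
          (fun x => mid a j (neighborLabels ι (Gam ξ) j τ x)) x| := ⟨_, rfl⟩
  obtain ⟨D, hD⟩ : ∃ D : ℝ, D = Fintype.card (I × Bool × H) * (W + 1) / (t * Fintype.card Y)
      + 4 * t := ⟨_, rfl⟩
  obtain ⟨Zs, hZne, hZmem, hZlog⟩ := exists_finset_short_messages (I × Bool × H) W
  have hleak : ∀ a ξ τ, 𝔼 j, 𝔼 ω, sideSign (ω j).1 * G (unitView ι Gam mid hub (a, j, ξ, τ) ω)
      ≤ (𝔼 j, bias a j ξ τ) + D + 2 * 𝔼 ω, bad a τ ω := by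
    intro a ξ τ
    have h := expect_expect_sign_le (J := Y) (X := Bool × (I → H)) (χ := fun x => sideSign x.1)
      (fun x => (abs_sideSign _).le) (fun j x => mid a j (neighborLabels ι (Gam ξ) j τ x))
      (hubView ι (hub a) τ) Zs hZne
      (bad a τ) ?_ ?_ (fun j M z => G ((a, j, ξ, τ), M, z)) (fun j M z => hG _) ht ht'
    · rw [hbias, hD]
      refine h.trans (add_le_add (add_le_add le_rfl (add_le_add ?_ le_rfl)) le_rfl)
      exact div_le_div_of_nonneg_right hZlog (by positivity)
    · intro ω
      rw [hbad]
      positivity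
    · intro ω h
      obtain ⟨p, hp⟩ := hZmem _ h
      have h2 : ((hubView ι (hub a) τ ω p).length : ℝ)
          ≤ ∑ p, ((hubView ι (hub a) τ ω p).length : ℝ) :=
        Finset.single_le_sum (f := fun p => ((hubView ι (hub a) τ ω p).length : ℝ))
          (fun _ _ => Nat.cast_nonneg _) (Finset.mem_univ p)
      have h3 : (W : ℝ) ≤ (hubView ι (hub a) τ ω p).length := by exact_mod_cast hp.le
      simp only [hbad]
      rw [one_div, ← div_eq_inv_mul, le_div_iff₀ hWpos]
      linarith
  have hbadavg : 𝔼 a, 𝔼 τ, 𝔼 ω, bad a τ ω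
      ≤ Fintype.card (Bool × H) * B / (Fintype.card Y * W) := by
    rw [hbad]
    simp_rw [← Finset.mul_expect, expect_sum_hubView_length]
    rw [← Finset.mul_expect]
    calc _ ≤ 1 / W * (Fintype.card (Bool × H) / Fintype.card Y * B) := by gcongr
      _ = _ := by field_simp
  have hbiasavg : 𝔼 a, 𝔼 j, 𝔼 ξ, 𝔼 τ, bias a j ξ τ ≤ 1 - δ / 2 := by
    rw [hbias]
    calc _ ≤ 𝔼 a, 𝔼 j, ((1 - δ) + δ * (4 / C) * 𝔼 x, ((mid a j x).length : ℝ)) :=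
          Finset.expect_le_expect fun a _ => Finset.expect_le_expect fun j _ =>
            expect_abs_condAvg_le_of_expect_length hC hδ (mid a j) j (hcore (mid a j) j)
      _ = (1 - δ) + δ * (4 / C) * 𝔼 a, 𝔼 j, 𝔼 x, ((mid a j x).length : ℝ) := by
          simp_rw [Finset.expect_add_distrib, Fintype.expect_const, ← Finset.mul_expect]
      _ ≤ (1 - δ) + δ * (4 / C) * (C / 8) := by gcongr
      _ = _ := by field_simp; ring
  rw [← hD]
  calc _ = 𝔼 a, 𝔼 ξ, 𝔼 τ, 𝔼 j, 𝔼 ω,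
        sideSign (ω j).1 * G (unitView ι Gam mid hub (a, j, ξ, τ) ω) := by
        refine Finset.expect_congr rfl fun a _ => ?_
        rw [Finset.expect_comm]
        refine Finset.expect_congr rfl fun ξ _ => ?_
        rw [Finset.expect_comm]
    _ ≤ 𝔼 a, 𝔼 ξ, 𝔼 τ, ((𝔼 j, bias a j ξ τ) + D + 2 * 𝔼 ω, bad a τ ω) :=
        Finset.expect_le_expect fun a _ => Finset.expect_le_expect fun ξ _ =>
          Finset.expect_le_expect fun τ _ => hleak a ξ τ
    _ = (𝔼 a, 𝔼 j, 𝔼 ξ, 𝔼 τ, bias a j ξ τ) + D + 2 * 𝔼 a, 𝔼 τ, 𝔼 ω, bad a τ ω := by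
        simp_rw [Finset.expect_add_distrib, Fintype.expect_const, ← Finset.mul_expect]
        congr 2
        refine Finset.expect_congr rfl fun a _ => ?_
        rw [Finset.expect_comm (s := (Finset.univ : Finset Y))]
        refine Finset.expect_congr rfl fun ξ _ => ?_
        rw [Finset.expect_comm]
    _ ≤ _ := by linarith

end UnitBias

/-! ### Averaging over the random revealed set: short messages keep the side hidden. -/

section Core

open scoped Classical

set_option linter.unusedSectionVars false

variable {I Y H : Type*} [Fintype I] [Fintype Y] [Fintype H]

lemma card_filter_le_fin {N m : ℕ} :
    (Finset.univ.filter fun o : Fin N => m ≤ (o : ℕ)).card = N - m := by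
  have h : ((Finset.univ.filter fun o : Fin N => m ≤ (o : ℕ)).map Fin.valEmbedding)
      = Finset.Ico m N := by
    ext a
    simp only [Finset.mem_map, Finset.mem_filter, Finset.mem_univ, true_and,
      Fin.valEmbedding_apply, Finset.mem_Ico]
    constructor
    · rintro ⟨o, ho, rfl⟩; exact ⟨ho, o.2⟩
    · rintro ⟨h1, h2⟩; exact ⟨⟨a, h2⟩, h1, rfl⟩
  rw [← Finset.card_map Fin.valEmbedding, h, Nat.card_Ico]

lemma expect_pi_prod_apply {Ω : Type*} [Fintype Ω] (F : I → Ω → ℝ) :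
    𝔼 o : I → Ω, ∏ g, F g (o g) = ∏ g, 𝔼 x, F g x := by
  simp_rw [Fintype.expect_eq_sum_div_card]
  rw [Finset.prod_div_distrib, Finset.prod_univ_sum, Fintype.piFinset_univ, Finset.prod_const,
    Finset.card_univ, Fintype.card_fun, Nat.cast_pow]

/-- Independent uniform integers compared with a threshold realize the reveal law on a finite
uniform sample space. -/
lemma expect_threshold {N m : ℕ} (hN : 0 < N) (hm : m ≤ N) {y : ℝ} {d : ℕ}
    (hy : y ^ d = m / N) (v : Finset I → ℝ) :
    𝔼 ξ : I → Fin N, v (Finset.univ.filter fun g => m ≤ (ξ g : ℕ))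
      = ∑ X, revealProb y d ∅ X * v X := by
  have : Nonempty (Fin N) := ⟨⟨0, hN⟩⟩
  have hNpos : (0 : ℝ) < N := by exact_mod_cast hN
  have h1 : ∀ ξ : I → Fin N, v (Finset.univ.filter fun g => m ≤ (ξ g : ℕ))
      = ∑ X, (∏ g, if (m ≤ (ξ g : ℕ) ↔ g ∈ X) then (1 : ℝ) else 0) * v X := by
    intro ξ
    rw [Finset.sum_eq_single (Finset.univ.filter fun g => m ≤ (ξ g : ℕ))]
    · rw [Finset.prod_eq_one, one_mul]
      intro g _
      simp
    · intro X _ hX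
      rw [Finset.prod_eq_zero_iff.2, zero_mul]
      by_contra hcon
      push Not at hcon
      apply hX
      ext g
      have := hcon g (Finset.mem_univ _)
      simp only [Finset.mem_filter, Finset.mem_univ, true_and]
      by_contra h2
      exact this (if_neg (by tauto))
    · simp
  simp_rw [h1]
  rw [Finset.expect_sum_comm]
  refine Finset.sum_congr rfl fun X _ => ?_
  rw [← Finset.expect_mul,
    expect_pi_prod_apply fun g (o : Fin N) => if (m ≤ (o : ℕ) ↔ g ∈ X) then (1 : ℝ) else 0]
  congr 1
  have h2 : ∀ g, (𝔼 o : Fin N, if (m ≤ (o : ℕ) ↔ g ∈ X) then (1 : ℝ) else 0)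
      = if g ∈ X then 1 - y ^ d else y ^ d := by
    intro g
    rw [Fintype.expect_eq_sum_div_card, Fintype.card_fin, Finset.sum_boole]
    split_ifs with h
    · simp only [h, iff_true]
      rw [card_filter_le_fin, hy, Nat.cast_sub hm]
      field_simp
    · simp only [h, iff_false]
      have h3 := Finset.card_filter_add_card_filter_not (s := (Finset.univ : Finset (Fin N)))
        (fun o => m ≤ (o : ℕ))
      rw [card_filter_le_fin, Finset.card_univ, Fintype.card_fin] at h3
      rw [hy]
      congr 2
      omega
  simp_rw [h2]
  rw [revealProb, if_pos (Finset.empty_subset _), Finset.prod_ite, Finset.prod_const,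
    Finset.prod_const, Finset.sdiff_empty]
  congr 3
  · ext; simp
  · ext; simp

/-- A random set of coordinates, proper and nonempty, whose law dominates, away from the trivial
sets, the average over `L` rounds of the set of revealed coordinates. -/
def revealSet (K L : ℕ) (g₀ : I) (ξ : Fin L × (I → Fin (K ^ L))) : Finset I :=
  if (Finset.univ.filter fun g => (K - 1) ^ (ξ.1 + 1 : ℕ) * K ^ (L - (ξ.1 + 1)) ≤ (ξ.2 g : ℕ)) = ∅
      ∨ (Finset.univ.filter fun g => (K - 1) ^ (ξ.1 + 1 : ℕ) * K ^ (L - (ξ.1 + 1)) ≤ (ξ.2 g : ℕ))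
        = Finset.univ
  then {g₀}
  else Finset.univ.filter fun g => (K - 1) ^ (ξ.1 + 1 : ℕ) * K ^ (L - (ξ.1 + 1)) ≤ (ξ.2 g : ℕ)

lemma revealSet_nonempty (K L : ℕ) (g₀ : I) (ξ) : (revealSet K L g₀ ξ).Nonempty := by
  unfold revealSet
  split_ifs with h
  · exact ⟨g₀, by simp⟩
  · push Not at h
    exact h.1

lemma exists_notMem_revealSet [Nontrivial I] (K L : ℕ) (g₀ : I) (ξ) :
    ∃ g, g ∉ revealSet K L g₀ ξ := by
  unfold revealSet
  split_ifs with h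
  · obtain ⟨g, hg⟩ := exists_ne g₀
    exact ⟨g, by simpa using hg⟩
  · push Not at h
    by_contra hcon
    push Not at hcon
    exact h.2 (Finset.eq_univ_of_forall hcon)

/-- Replacing the empty and the full set affects the mean of `u` by at most their probabilities,
which are largest in the first and in the last round respectively. -/
lemma le_expect_revealSet {K L : ℕ} (hK : 2 ≤ K) (hL : 0 < L) (g₀ : I) {u : Finset I → ℝ}
    (hu0 : ∀ X, 0 ≤ u X) (hu1 : ∀ X, u X ≤ 1) :
    1 / L * (∑ i ∈ range L, ∑ X, revealProb (1 - 1 / K : ℝ) (i + 1) ∅ X * u X)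
        - ((1 - 1 / K : ℝ) ^ Fintype.card I + (1 - (1 - 1 / K : ℝ) ^ L) ^ Fintype.card I)
      ≤ 𝔼 ξ, u (revealSet K L g₀ ξ) := by
  set y : ℝ := 1 - 1 / K with hy
  have hKpos : (0 : ℝ) < K := by exact_mod_cast (by omega : 0 < K)
  have hy0 : 0 ≤ y := by
    rw [hy, sub_nonneg, div_le_one hKpos]; exact_mod_cast (by omega : 1 ≤ K)
  have hy1 : y ≤ 1 := by
    rw [hy]; have : (0 : ℝ) ≤ 1 / K := by positivity
    linarith
  have hLpos : (0 : ℝ) < L := by exact_mod_cast hL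
  have : Nonempty (Fin L) := ⟨⟨0, hL⟩⟩
  have : Nonempty (Fin (K ^ L)) := ⟨⟨0, by positivity⟩⟩
  obtain ⟨v, hv⟩ : ∃ v : Finset I → ℝ, v = fun X => u X - (if X = ∅ then 1 else 0)
    - (if X = Finset.univ then 1 else 0) := ⟨_, rfl⟩
  have h1 : ∀ ξ : Fin L × (I → Fin (K ^ L)),
      v (Finset.univ.filter fun g => (K - 1) ^ (ξ.1 + 1 : ℕ) * K ^ (L - (ξ.1 + 1)) ≤ (ξ.2 g : ℕ))
        ≤ u (revealSet K L g₀ ξ) := by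
    intro ξ
    unfold revealSet
    rw [hv]
    split_ifs with h
    · have := hu0 {g₀}
      rcases h with h | h
      · have := hu1 ∅
        simp only [h]
        split_ifs <;> linarith
      · have := hu1 Finset.univ
        simp only [h]
        split_ifs <;> linarith
    · push Not at h
      simp only
      split_ifs with h3 h4 h4
      · exact absurd h3 h.1.ne_empty
      · exact absurd h3 h.1.ne_empty
      · exact absurd h4 h.2
      · simp
  refine le_trans ?_ (Finset.expect_le_expect fun ξ _ => h1 ξ)
  rw [expect_prod]
  have h2 : ∀ i : Fin L, (𝔼 ξ : I → Fin (K ^ L), v (Finset.univ.filter fun g =>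
      (K - 1) ^ (i + 1 : ℕ) * K ^ (L - (i + 1)) ≤ (ξ g : ℕ)))
      = ∑ X, revealProb y (i + 1) ∅ X * v X := by
    intro i
    have hi : (i : ℕ) + 1 ≤ L := i.2
    refine expect_threshold (by positivity) ?_ ?_ v
    · calc (K - 1) ^ (i + 1 : ℕ) * K ^ (L - (i + 1)) ≤ K ^ (i + 1 : ℕ) * K ^ (L - (i + 1)) := by
            gcongr; omega
        _ = K ^ L := by rw [← pow_add]; congr 1; omega
    · have e : (K : ℝ) ^ L = K ^ (i + 1 : ℕ) * K ^ (L - (i + 1)) := by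
        rw [← pow_add]; congr 1; omega
      push_cast [Nat.cast_sub (by omega : 1 ≤ K)]
      rw [e, mul_div_mul_right _ _ (by positivity), ← div_pow, hy]
      congr 1
      field_simp
  simp only [h2]
  have h3 : ∀ i : Fin L, (∑ X : Finset I, revealProb y (i + 1) ∅ X * u X)
      - (y ^ Fintype.card I + (1 - y ^ L) ^ Fintype.card I)
      ≤ ∑ X, revealProb y (i + 1) ∅ X * v X := by
    intro i
    have hi : (i : ℕ) + 1 ≤ L := i.2
    have e : ∑ X : Finset I, revealProb y (i + 1) ∅ X * v X = (∑ X : Finset I, revealProb y (i + 1) ∅ X * u X)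
        - revealProb y (i + 1) ∅ (∅ : Finset I) - revealProb y (i + 1) ∅ (Finset.univ : Finset I) := by
      rw [hv]
      simp only [mul_sub, Finset.sum_sub_distrib, mul_ite, mul_one, mul_zero]
      simp
    rw [e]
    have e1 : revealProb y (i + 1) ∅ (∅ : Finset I) ≤ y ^ Fintype.card I := by
      simp only [revealProb, Finset.empty_subset, if_true, Finset.sdiff_empty, Finset.card_empty,
        pow_zero, one_mul, Finset.compl_empty, Finset.card_univ]
      refine pow_le_pow_left₀ (by positivity) ?_ _
      exact pow_le_of_le_one hy0 hy1 (by omega)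
    have e2 : revealProb y (i + 1) ∅ (Finset.univ : Finset I) ≤ (1 - y ^ L) ^ Fintype.card I := by
      simp only [revealProb, Finset.subset_univ, if_true, Finset.sdiff_empty, Finset.card_univ,
        Finset.compl_univ, Finset.card_empty, pow_zero, mul_one]
      have : y ^ L ≤ y ^ ((i : ℕ) + 1) := pow_le_pow_of_le_one hy0 hy1 hi
      have : y ^ ((i : ℕ) + 1) ≤ 1 := pow_le_one₀ hy0 hy1
      refine pow_le_pow_left₀ (by linarith) (by linarith) _
    linarith
  refine le_trans (le_of_eq ?_) (Finset.expect_le_expect fun i _ => h3 i)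
  rw [Finset.expect_sub_distrib, Fintype.expect_const, Fintype.expect_eq_sum_div_card,
    Fintype.card_fin, Fin.sum_univ_eq_sum_range (fun i => ∑ X : Finset I, revealProb y (i + 1) ∅ X * u X) L]
  ring

/-- Apply `exists_spread_family` to the bit strings of length at most `C`. They are too few for the
`γ ^ (L / 2)` required, so the spread parts have total weight at least `3 / 8 * exp (-(2 * K))` over
the `L` rounds. A uniformly chosen round keeps a share `1 / L` of it, apart from the trivial sets.
-/
theorem expect_abs_condAvg_neighborLabels_le [Nonempty Y] [Nonempty H] [Nonempty I]
    {ι : Bool × H → Y} (hι : Function.Injective ι) {K L : ℕ} (hK : 2 ≤ K) (hL : 0 < L) (g₀ : I)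
    {θ δ : ℝ} (hθ : 0 < θ) (hδ : 0 ≤ δ) (hδ1 : δ ≤ 1)
    (hθ' : (1 + Fintype.card Y / Fintype.card H * θ) ^ Fintype.card I ≤ 5 / 4)
    (hγ : 1 ≤ Fintype.card Y * (θ * δ)) (hδL : Real.exp (2 * K) * (L * δ) ≤ 1 / 8)
    (hη : Real.exp (2 * K) * (L * ((1 - 1 / K : ℝ) ^ Fintype.card I
      + (1 - (1 - 1 / K : ℝ) ^ L) ^ Fintype.card I)) ≤ 1 / 8) {C : ℕ}
    (hC : (2 : ℝ) ^ (C + 1) * 4 ≤ (Fintype.card Y * (θ * δ)) ^ (L / 2))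
    (f : (I → Y) → List Bool) (j : Y)
    (hf : 3 / 4 ≤ 𝔼 x, if (f x).length ≤ C then (1 : ℝ) else 0) :
    𝔼 ξ, 𝔼 τ, 𝔼 x : Bool × (I → H), |condAvg (fun x : Bool × (I → H) => sideSign x.1)
        (fun x => f (neighborLabels ι (revealSet K L g₀ ξ) j τ x)) x|
      ≤ 1 - Real.exp (-(2 * K)) / (8 * L) := by
  have hKpos : (0 : ℝ) < K := by exact_mod_cast (by omega : 0 < K)
  have hLpos : (0 : ℝ) < L := by exact_mod_cast hL
  have : Nonempty (Fin L) := ⟨⟨0, hL⟩⟩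
  have : Nonempty (Fin (K ^ L)) := ⟨⟨0, by positivity⟩⟩
  obtain ⟨U, hU, hfam⟩ := exists_spread_family f hθ hδ hδ1
  obtain ⟨u, hu⟩ : ∃ u : Finset I → ℝ, u = fun X => ((U X).card : ℝ) / Fintype.card (I → Y) := ⟨_, rfl⟩
  have hcpos : (0 : ℝ) < Fintype.card (I → Y) := by exact_mod_cast Fintype.card_pos
  have hu0 : ∀ X, 0 ≤ u X := by intro X; rw [hu]; positivity
  have hu1 : ∀ X, u X ≤ 1 := by
    intro X
    rw [hu]
    simp only
    rw [div_le_one hcpos]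
    exact_mod_cast Finset.card_le_univ _
  have hyK : (1 : ℝ) / K ≤ 1 := by
    rw [div_le_one hKpos]; exact_mod_cast (by omega : 1 ≤ K)
  obtain ⟨p, h2, h1⟩ : ∃ p : ℝ, 3 / 4 ≤ p ∧ (Fintype.card Y * (θ * δ)) ^ (L / 2) *
      (p - ∑ i ∈ range L, Real.exp (2 * K) * ∑ X, revealProb (1 - 1 / K : ℝ) (i + 1) ∅ X *
      ((U X).card / Fintype.card (I → Y) + δ)) ≤ (shortLists C).card := by
    refine ⟨_, ?_, hfam (shortLists C) (1 - 1 / K) (2 * K) L (by linarith)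
      (by have : (0 : ℝ) < 1 / K := by positivity
          linarith) (by positivity) hγ (sum_neg_log_one_sub_pow_le hK L)⟩
    rw [Fintype.expect_eq_sum_div_card, Finset.sum_boole] at hf
    simp only [mem_shortLists]
    convert hf
  obtain ⟨S, hS⟩ : ∃ S : ℝ, S = ∑ i ∈ range L, ∑ X, revealProb (1 - 1 / K : ℝ) (i + 1) ∅ X * u X :=
    ⟨_, rfl⟩
  have h3 : ∑ i ∈ range L, Real.exp (2 * K) * ∑ X, revealProb (1 - 1 / K : ℝ) (i + 1) ∅ X *
      ((U X).card / Fintype.card (I → Y) + δ) = Real.exp (2 * K) * (S + L * δ) := by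
    rw [← Finset.mul_sum, hS, hu]
    congr 1
    simp only [mul_add, Finset.sum_add_distrib, ← Finset.sum_mul, sum_revealProb, one_mul]
    rw [Finset.sum_const, Finset.card_range, nsmul_eq_mul]
  rw [h3] at h1
  have h4 : ((shortLists C).card : ℝ) + 1 ≤ 2 ^ (C + 1) := by exact_mod_cast card_shortLists_le C
  have hg : 0 < (Fintype.card Y * (θ * δ)) ^ (L / 2) := lt_of_lt_of_le (by positivity) hC
  have h5 : 3 / 8 ≤ Real.exp (2 * K) * S := by
    -- Otherwise at least `3 / 4 - 3 / 8 - 1 / 8 = 1 / 4` of the probability remains, and Kraft asks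
    -- for at least `2 ^ (C + 1)` messages.
    by_contra hcon
    push Not at hcon
    rw [mul_add] at h1
    have : (Fintype.card Y * (θ * δ)) ^ (L / 2) * (1 / 4)
        ≤ (Fintype.card Y * (θ * δ)) ^ (L / 2) * _ :=
      mul_le_mul_of_nonneg_left (show (1 : ℝ) / 4 ≤ p
          - (Real.exp (2 * K) * S + Real.exp (2 * K) * (L * δ)) by linarith) hg.le
    have := this.trans h1
    linarith
  have h6 := le_expect_revealSet hK hL g₀ hu0 hu1
  rw [← hS] at h6
  have h7 : Real.exp (-(2 * K)) / (4 * L) ≤ 𝔼 ξ, u (revealSet K L g₀ ξ) := by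
    refine le_trans ?_ h6
    obtain ⟨η, hη'⟩ : ∃ η : ℝ, η = (1 - 1 / K : ℝ) ^ Fintype.card I
      + (1 - (1 - 1 / K : ℝ) ^ L) ^ Fintype.card I := ⟨_, rfl⟩
    rw [← hη'] at hη ⊢
    have hE := Real.exp_pos (2 * (K : ℝ))
    rw [Real.exp_neg]
    rw [show 1 / (L : ℝ) * S - η = (Real.exp (2 * K))⁻¹ / L *
      (Real.exp (2 * K) * S - Real.exp (2 * K) * (L * η)) by field_simp]
    rw [show (Real.exp (2 * (K : ℝ)))⁻¹ / (4 * L) = (Real.exp (2 * K))⁻¹ / L * (1 / 4) by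
      field_simp]
    exact mul_le_mul_of_nonneg_left (by linarith) (by positivity)
  have h8 : ∀ ξ, 𝔼 τ, 𝔼 x : Bool × (I → H), |condAvg (fun x : Bool × (I → H) => sideSign x.1)
        (fun x => f (neighborLabels ι (revealSet K L g₀ ξ) j τ x)) x|
      ≤ 1 - 1 / 2 * u (revealSet K L g₀ ξ) := by
    intro ξ
    have := expect_abs_condAvg_sideSign_le hι f j hθ.le hθ' (hU (revealSet K L g₀ ξ))
    rw [hu]
    simpa using this
  refine (Finset.expect_le_expect fun ξ _ => h8 ξ).trans ?_
  rw [Finset.expect_sub_distrib, Fintype.expect_const, ← Finset.mul_expect]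
  rw [show Real.exp (-(2 * (K : ℝ))) / (8 * L) = 1 / 2 * (Real.exp (-(2 * K)) / (4 * L)) by
    field_simp; norm_num]
  linarith

end Core

/-! ### Overlapping laws and the parity lemma. -/

section Parity

open scoped Classical

set_option linter.unusedSectionVars false

variable {Ω 𝒱 : Type*} [Fintype Ω] [Nonempty Ω] [Fintype 𝒱]

/-- The law of a function on a finite set with the uniform distribution. -/
def law (V : Ω → 𝒱) (v : 𝒱) : ℝ := 𝔼 ω, if V ω = v then (1 : ℝ) else 0

lemma law_nonneg (V : Ω → 𝒱) (v : 𝒱) : 0 ≤ law V v :=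
  Finset.expect_nonneg fun ω _ => by split_ifs <;> norm_num

lemma expect_comp_eq_sum_law (V : Ω → 𝒱) (G : 𝒱 → ℝ) : 𝔼 ω, G (V ω) = ∑ v, law V v * G v := by
  simp_rw [law, Finset.expect_mul]
  rw [← Finset.expect_sum_comm]
  refine Finset.expect_congr rfl fun ω _ => ?_
  simp

lemma expect_pi_comp_law {I : Type*} [Fintype I] [DecidableEq I] (φ : I → Ω → 𝒱)
    (F : (I → 𝒱) → ℝ) :
    𝔼 o : I → Ω, F (fun g => φ g (o g)) = ∑ z : I → 𝒱, (∏ g, law (φ g) (z g)) * F z := by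
  convert expect_pi_comp φ F
  rfl

lemma expect_pi_prod_apply_of_decidableEq {I : Type*} [Fintype I] [DecidableEq I]
    (F : I → Ω → ℝ) : 𝔼 o : I → Ω, ∏ g, F g (o g) = ∏ g, 𝔼 x, F g x := by
  convert expect_pi_prod_apply F

lemma sum_law (V : Ω → 𝒱) : ∑ v, law V v = 1 := by
  have := expect_comp_eq_sum_law V fun _ => 1
  simpa using this.symm

lemma sum_abs_sub_eq {p q : 𝒱 → ℝ} (hp : ∑ v, p v = 1) (hq : ∑ v, q v = 1) :
    ∑ v, |p v - q v| = 2 - 2 * ∑ v, min (p v) (q v) := by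
  have h : ∀ v, |p v - q v| = p v + q v - 2 * min (p v) (q v) := by
    intro v
    rcases le_total (p v) (q v) with h | h
    · rw [abs_of_nonpos (by linarith), min_eq_left h]; ring
    · rw [abs_of_nonneg (by linarith), min_eq_right h]; ring
  simp_rw [h]
  rw [Finset.sum_sub_distrib, Finset.sum_add_distrib, hp, hq, ← Finset.mul_sum]
  norm_num

/-- The sign of the difference of the laws is the best test function; it computes the total
variation distance, which is one minus the overlap. -/
lemma le_sum_min_law {V V' : Ω → 𝒱} {o : ℝ}
    (h : ∀ G : 𝒱 → ℝ, (∀ v, |G v| ≤ 1) → 1 / 2 * ((𝔼 ω, G (V ω)) - 𝔼 ω, G (V' ω)) ≤ 1 - o) :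
    o ≤ ∑ v, min (law V v) (law V' v) := by
  have h1 := h (fun v => SignType.sign (law V v - law V' v)) fun v => by
    rcases SignType.sign (law V v - law V' v) with _ | _ | _ <;> simp
  rw [expect_comp_eq_sum_law V fun v => (SignType.sign (law V v - law V' v) : ℝ),
    expect_comp_eq_sum_law V' fun v => (SignType.sign (law V v - law V' v) : ℝ), ← Finset.sum_sub_distrib] at h1
  have h2 : ∑ v, |law V v - law V' v| = ∑ v, (law V v * SignType.sign (law V v - law V' v)
      - law V' v * SignType.sign (law V v - law V' v)) := by
    refine Finset.sum_congr rfl fun v _ => ?_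
    rw [← sub_mul, self_mul_sign]
  rw [← h2, sum_abs_sub_eq (sum_law V) (sum_law V')] at h1
  linarith

/-- The two units of a stage carry opposite bits. The overlap of the two product laws is at least
the product of the overlaps, since a product of minima is below both products. -/
lemma sum_abs_law_mul_sub_le {V V' W W' : Ω → 𝒱} {o₁ o₂ : ℝ} (ho : 0 ≤ o₂)
    (h₁ : o₁ ≤ ∑ v, min (law V v) (law V' v)) (h₂ : o₂ ≤ ∑ v, min (law W v) (law W' v)) :
    ∑ p : 𝒱 × 𝒱, |1 / 2 * (law V p.1 * law W' p.2 - law V' p.1 * law W p.2)| ≤ 1 - o₁ * o₂ := by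
  have hs : ∀ V W : Ω → 𝒱, ∑ p : 𝒱 × 𝒱, law V p.1 * law W p.2 = 1 := by
    intro V W
    rw [Fintype.sum_prod_type]
    simp_rw [← Finset.mul_sum, sum_law, mul_one]
    exact sum_law V
  simp_rw [abs_mul]
  rw [← Finset.mul_sum, sum_abs_sub_eq (p := fun p : 𝒱 × 𝒱 => law V p.1 * law W' p.2)
    (q := fun p : 𝒱 × 𝒱 => law V' p.1 * law W p.2) (hs _ _) (hs _ _)]
  have h3 : (∑ v, min (law V v) (law V' v)) * (∑ v, min (law W v) (law W' v))
      ≤ ∑ p : 𝒱 × 𝒱, min (law V p.1 * law W' p.2) (law V' p.1 * law W p.2) := by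
    rw [Finset.sum_mul_sum, ← Finset.sum_product', Finset.univ_product_univ]
    refine Finset.sum_le_sum fun p _ => le_min ?_ ?_
    · exact mul_le_mul (min_le_left _ _) (min_le_right _ _)
        (le_min (law_nonneg _ _) (law_nonneg _ _)) (law_nonneg _ _)
    · exact mul_le_mul (min_le_right _ _) (min_le_left _ _)
        (le_min (law_nonneg _ _) (law_nonneg _ _)) (law_nonneg _ _)
  have h4 : o₁ * o₂ ≤ (∑ v, min (law V v) (law V' v)) * (∑ v, min (law W v) (law W' v)) :=
    mul_le_mul h₁ h₂ ho (Finset.sum_nonneg fun v _ => le_min (law_nonneg _ _) (law_nonneg _ _))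
  rw [abs_of_nonneg (by norm_num : (0 : ℝ) ≤ 1 / 2)]
  linarith

variable {B : Type*} [Fintype B] [DecidableEq B]

/-- Averaging over independent bits turns the signed mean into a sum against a product of signed
measures, one per stage. Its total variation is the product of the stagewise ones. -/
lemma abs_expect_prod_sideSign_mul_le (V : B × Bool → Bool → Ω → 𝒱) {o : B × Bool → ℝ}
    (ho : ∀ u, 0 ≤ o u)
    (hV : ∀ u, ∀ G : 𝒱 → ℝ, (∀ v, |G v| ≤ 1) →
      1 / 2 * ((𝔼 ω, G (V u true ω)) - 𝔼 ω, G (V u false ω)) ≤ 1 - o u)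
    (G : (B × Bool → 𝒱) → ℝ) (hG : ∀ v, |G v| ≤ 1) :
    |𝔼 b : B → Bool, 𝔼 ω : B × Bool → Ω,
        (∏ i, sideSign (b i)) * G (fun u => V u (xor (b u.1) u.2) (ω u))|
      ≤ ∏ i, (1 - o (i, false) * o (i, true)) := by
  obtain ⟨D, hD⟩ : ∃ D : B → 𝒱 × 𝒱 → ℝ, D = fun i p => 1 / 2 *
      (law (V (i, false) true) p.1 * law (V (i, true) false) p.2
        - law (V (i, false) false) p.1 * law (V (i, true) true) p.2) := ⟨_, rfl⟩
  have h1 : ∀ b : B → Bool, (𝔼 ω : B × Bool → Ω,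
        (∏ i, sideSign (b i)) * G (fun u => V u (xor (b u.1) u.2) (ω u)))
      = ∑ v : B × Bool → 𝒱, (∏ i, sideSign (b i) * (law (V (i, false) (b i)) (v (i, false))
        * law (V (i, true) (!b i)) (v (i, true)))) * G v := by
    intro b
    rw [← Finset.mul_expect, expect_pi_comp_law (fun u => V u (xor (b u.1) u.2)) G, Finset.mul_sum]
    refine Finset.sum_congr rfl fun v _ => ?_
    rw [← mul_assoc, Finset.prod_mul_distrib, Fintype.prod_prod_type]
    congr 2
    refine Finset.prod_congr rfl fun i _ => ?_
    rw [Fintype.prod_bool, mul_comm]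
    simp [law]
  have h2 : (𝔼 b : B → Bool, 𝔼 ω : B × Bool → Ω,
        (∏ i, sideSign (b i)) * G (fun u => V u (xor (b u.1) u.2) (ω u)))
      = ∑ v : B × Bool → 𝒱, (∏ i, D i (v (i, false), v (i, true))) * G v := by
    simp_rw [h1]
    rw [Finset.expect_sum_comm]
    refine Finset.sum_congr rfl fun v _ => ?_
    rw [← Finset.expect_mul, expect_pi_prod_apply_of_decidableEq fun i (c : Bool) => sideSign c *
      (law (V (i, false) c) (v (i, false)) * law (V (i, true) (!c)) (v (i, true)))]
    congr 1
    refine Finset.prod_congr rfl fun i _ => ?_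
    rw [Fintype.expect_eq_sum_div_card, Fintype.sum_bool, hD]
    simp [sideSign]
    ring
  rw [h2]
  calc _ ≤ ∑ v : B × Bool → 𝒱, ∏ i, |D i (v (i, false), v (i, true))| := by
        refine (Finset.abs_sum_le_sum_abs _ _).trans (Finset.sum_le_sum fun v _ => ?_)
        rw [abs_mul, Finset.abs_prod]
        exact mul_le_of_le_one_right (Finset.prod_nonneg fun i _ => abs_nonneg _) (hG v)
    _ = ∑ w : B → 𝒱 × 𝒱, ∏ i, |D i (w i)| := by
        refine Fintype.sum_equiv ⟨fun v i => (v (i, false), v (i, true)),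
          fun w u => if u.2 then (w u.1).2 else (w u.1).1, fun v => ?_, fun w => ?_⟩ _ _ fun v => rfl
        · funext ⟨i, c⟩
          cases c <;> simp
        · funext i
          simp
    _ = ∏ i, ∑ p, |D i p| := by
        rw [Finset.prod_univ_sum, Fintype.piFinset_univ]
    _ ≤ _ := by
        refine Finset.prod_le_prod (fun i _ => Finset.sum_nonneg fun p _ => abs_nonneg _)
          fun i _ => ?_
        rw [hD]
        exact sum_abs_law_mul_sub_le (ho _) (le_sum_min_law (hV (i, false)))
          (le_sum_min_law (hV (i, true)))

/-- Parity of independent bits is hard to predict from pairs of views, each of which has laws under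
its two bits that overlap. -/
theorem abs_expect_prod_sideSign_mul_view_le {𝒱 : Type*} (V : B × Bool → Bool → Ω → 𝒱)
    {o : B × Bool → ℝ} (ho : ∀ u, 0 ≤ o u)
    (hV : ∀ u, ∀ G : 𝒱 → ℝ, (∀ v, |G v| ≤ 1) →
      1 / 2 * ((𝔼 ω, G (V u true ω)) - 𝔼 ω, G (V u false ω)) ≤ 1 - o u)
    (G : (B × Bool → 𝒱) → ℝ) (hG : ∀ v, |G v| ≤ 1) :
    |𝔼 b : B → Bool, 𝔼 ω : B × Bool → Ω,
        (∏ i, sideSign (b i)) * G (fun u => V u (xor (b u.1) u.2) (ω u))|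
      ≤ ∏ i, (1 - o (i, false) * o (i, true)) := by
  -- Message vectors form an infinite type, but only finitely many views occur; the argument runs on
  -- these.
  obtain ⟨S, hS⟩ : ∃ S : Finset 𝒱, S = Finset.univ.image
    fun p : (B × Bool) × Bool × Ω => V p.1 p.2.1 p.2.2 := ⟨_, rfl⟩
  have hmem : ∀ u c ω, V u c ω ∈ S := fun u c ω => by
    rw [hS]; exact Finset.mem_image.2 ⟨(u, c, ω), Finset.mem_univ _, rfl⟩
  refine abs_expect_prod_sideSign_mul_le (𝒱 := S) (fun u c ω => ⟨V u c ω, hmem u c ω⟩) ho ?_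
    (fun v => G fun u => v u) fun v => hG _
  intro u G' hG'
  have := hV u (fun v => if h : v ∈ S then G' ⟨v, h⟩ else 0) fun v => by
    split_ifs with h
    · exact hG' _
    · simp
  simpa [hmem] using this

end Parity

/-! ### The hard graphs and their connectivity. -/

section ChainGraph

open scoped Classical

set_option linter.unusedSectionVars false

/-- Vertices of the input graphs: those of the units, the terminals, and the remaining ones. -/
abbrev ChainVertex (k s : ℕ) (Y R : Type*) : Type _ :=
  ((Fin k × Bool) × Fin (s + 1) × Y) ⊕ (Fin (k + 1) × Bool) ⊕ R

variable {k s : ℕ} {Y R : Type*}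

/-- The terminal of unit `u` on the right (`t.1 = true`) or left, on side `t.2`. -/
def terminal (u : Fin k × Bool) (t : Bool × Bool) : Fin (k + 1) × Bool :=
  if t.1 then (u.1.succ, t.2) else (u.1.castSucc, t.2)

/-- The adjacency relation of `chainGraph`. -/
def chainAdj (E : Fin k × Bool → SimpleGraph (Fin (s + 1) × Y))
    (att : Fin k × Bool → Fin (s + 1) × Y → Option (Bool × Bool)) :
    ChainVertex k s Y R → ChainVertex k s Y R → Prop
  | .inl (u, p), .inl (u', p') => u = u' ∧ (E u).Adj p p'
  | .inl (u, p), .inr (.inl t) => ∃ e, att u p = some e ∧ terminal u e = t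
  | .inr (.inl t), .inl (u, p) => ∃ e, att u p = some e ∧ terminal u e = t
  | .inr (.inl t), .inr (.inl t') =>
      (t = (Fin.last k, false) ∧ t' = (0, true)) ∨ (t' = (Fin.last k, false) ∧ t = (0, true))
  | .inr (.inl t), .inr (.inr _) => t = (0, false)
  | .inr (.inr _), .inr (.inl t) => t = (0, false)
  | .inl _, .inr (.inr _) => False
  | .inr (.inr _), .inl _ => False
  | .inr (.inr _), .inr (.inr _) => False

/-- Units with inner graphs `E u` whose vertices are attached to terminals as `att u` says. -/
def chainGraph (E : Fin k × Bool → SimpleGraph (Fin (s + 1) × Y))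
    (att : Fin k × Bool → Fin (s + 1) × Y → Option (Bool × Bool)) :
    SimpleGraph (ChainVertex k s Y R) where
  Adj := chainAdj E att
  symm := ⟨by
    rintro (⟨u, p⟩ | t | r) (⟨u', p'⟩ | t' | r') h
    · obtain ⟨rfl, h⟩ := h
      exact ⟨rfl, h.symm⟩
    · exact h
    · exact h
    · exact h
    · exact h.symm
    · exact h
    · exact h
    · exact h
    · exact h⟩
  loopless := ⟨by
    rintro (⟨u, p⟩ | t | r) h
    · exact (E u).loopless.irrefl _ h.2
    · rcases h with ⟨h1, h2⟩ | ⟨h1, h2⟩ <;> simp [h1] at h2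
    · exact h⟩

/-- Neighborhood of a vertex of unit `u` with inner neighborhood `N` and attachment `o`. -/
def unitNeighborhood (u : Fin k × Bool) (N : Set (Fin (s + 1) × Y)) (o : Option (Bool × Bool)) :
    Set (ChainVertex k s Y R) :=
  {v | (∃ q ∈ N, v = .inl (u, q)) ∨ ∃ e, o = some e ∧ v = .inr (.inl (terminal u e))}

lemma chainGraph_neighborSet_inl (E : Fin k × Bool → SimpleGraph (Fin (s + 1) × Y))
    (att : Fin k × Bool → Fin (s + 1) × Y → Option (Bool × Bool)) (u p) :
    (chainGraph (R := R) E att).neighborSet (.inl (u, p))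
      = unitNeighborhood u ((E u).neighborSet p) (att u p) := by
  ext v
  rw [SimpleGraph.mem_neighborSet]
  rcases v with ⟨u', p'⟩ | t | r
  · simp only [chainGraph, chainAdj, unitNeighborhood, SimpleGraph.mem_neighborSet,
      Set.mem_ofPred_eq, Sum.inl.injEq, Prod.mk.injEq, reduceCtorEq, and_false, exists_false,
      or_false]
    constructor
    · rintro ⟨rfl, h⟩; exact ⟨p', h, rfl, rfl⟩
    · rintro ⟨q, h, rfl, rfl⟩; exact ⟨rfl, h⟩
  · simp [chainGraph, chainAdj, unitNeighborhood, eq_comm]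
  · simp [chainGraph, chainAdj, unitNeighborhood]

lemma chainGraph_neighborSet_inr (E E' : Fin k × Bool → SimpleGraph (Fin (s + 1) × Y))
    (att : Fin k × Bool → Fin (s + 1) × Y → Option (Bool × Bool)) (x) :
    (chainGraph (R := R) E att).neighborSet (.inr x)
      = (chainGraph (R := R) E' att).neighborSet (.inr x) := by
  ext v
  simp only [SimpleGraph.mem_neighborSet]
  rcases v with ⟨u', p'⟩ | t | r <;> rcases x with x | x <;> rfl

/-- The bipartite graph in which `(a, j)` has the neighbors `x j g` in the groups other than `a`. -/
def starGraph (a : Fin (s + 1)) (x : Y → Fin s → Y) : SimpleGraph (Fin (s + 1) × Y) where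
  Adj p q := (∃ j g, p = (a, j) ∧ q = (a.succAbove g, x j g)) ∨
    ∃ j g, q = (a, j) ∧ p = (a.succAbove g, x j g)
  symm := ⟨fun _ _ h => h.symm⟩
  loopless := ⟨by
    rintro p (⟨j, g, rfl, h⟩ | ⟨j, g, rfl, h⟩) <;>
      exact absurd (congrArg Prod.fst h).symm (Fin.succAbove_ne a g)⟩

lemma starGraph_neighborSet_center (a : Fin (s + 1)) (x : Y → Fin s → Y) (j : Y) :
    (starGraph a x).neighborSet (a, j) = {q | ∃ g, q = (a.succAbove g, x j g)} := by
  ext q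
  simp only [SimpleGraph.mem_neighborSet, starGraph, Set.mem_ofPred_eq]
  constructor
  · rintro (⟨j', g, h, rfl⟩ | ⟨j', g, rfl, h⟩)
    · obtain rfl : j = j' := congrArg Prod.snd h
      exact ⟨g, rfl⟩
    · exact absurd (congrArg Prod.fst h).symm (Fin.succAbove_ne a g)
  · rintro ⟨g, rfl⟩
    exact Or.inl ⟨j, g, rfl, rfl⟩

lemma starGraph_neighborSet_succAbove (a : Fin (s + 1)) (x : Y → Fin s → Y) (g : Fin s) (y : Y) :
    (starGraph a x).neighborSet (a.succAbove g, y) = {q | ∃ j, x j g = y ∧ q = (a, j)} := by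
  ext q
  simp only [SimpleGraph.mem_neighborSet, starGraph, Set.mem_ofPred_eq]
  constructor
  · rintro (⟨j', g', h, rfl⟩ | ⟨j', g', rfl, h⟩)
    · exact absurd (congrArg Prod.fst h) (Fin.succAbove_ne a g)
    · rw [Prod.mk.injEq, Fin.succAbove_right_inj] at h
      obtain ⟨rfl, rfl⟩ := h
      exact ⟨j', rfl, rfl⟩
  · rintro ⟨j, rfl, rfl⟩
    exact Or.inr ⟨j, g, rfl, rfl⟩

lemma forall_group (a : Fin (s + 1)) {P : Fin (s + 1) × Y → Prop} (h1 : ∀ j, P (a, j))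
    (h2 : ∀ g y, P (a.succAbove g, y)) (p) : P p := by
  obtain ⟨i, y⟩ := p
  rcases Fin.eq_self_or_eq_succAbove a i with rfl | ⟨g, rfl⟩
  · exact h1 y
  · exact h2 g y

variable {H Ξ : Type*}

/-- The public part of the sample of one unit: its group of middle vertices, its special middle
vertex, the randomness of the revealed set and the matchings. -/
abbrev PublicPart (s : ℕ) (Y Ξ : Type*) : Type _ :=
  Fin (s + 1) × Y × Ξ × (Fin s → Equiv.Perm Y)

/-- The side encoded by a label. -/
def labelSide (ι : Bool × H → Y) (y : Y) : Bool := decide (∃ h, ι (true, h) = y)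

lemma labelSide_apply {ι : Bool × H → Y} (hι : Function.Injective ι) (σ : Bool) (h : H) :
    labelSide ι (ι (σ, h)) = σ := by
  unfold labelSide
  cases σ
  · rw [decide_eq_false_iff_not]
    rintro ⟨h', e⟩
    simpa using hι e
  · rw [decide_eq_true_iff]
    exact ⟨h, rfl⟩

/-- The attachments of a unit to the terminals. -/
def hardAttachment (ι : Bool × H → Y) (Gam : Ξ → Finset (Fin s)) (c : Bool)
    (p : PublicPart s Y Ξ) (q : Fin (s + 1) × Y) : Option (Bool × Bool) :=
  Fin.insertNth (α := fun _ => Y → Option (Bool × Bool)) p.1 (fun _ => none)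
    (fun g y => if g ∈ Gam p.2.2.1 then (if y = p.2.2.2 g p.2.1 then some (false, c) else none)
      else some (true, labelSide ι ((p.2.2.2 g).symm y))) q.1 q.2

/-- The inner graph of a unit. -/
def hardInner (ι : Bool × H → Y) (Gam : Ξ → Finset (Fin s))
    (p : PublicPart s Y Ξ) (ω : Y → Bool × (Fin s → H)) : SimpleGraph (Fin (s + 1) × Y) :=
  starGraph p.1 fun j => neighborLabels ι (Gam p.2.2.1) j p.2.2.2 (ω j)

lemma hardAttachment_center (ι : Bool × H → Y) (Gam : Ξ → Finset (Fin s)) (c : Bool)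
    (p : PublicPart s Y Ξ) (j : Y) : hardAttachment ι Gam c p (p.1, j) = none := by
  simp [hardAttachment]

lemma hardAttachment_succAbove (ι : Bool × H → Y) (Gam : Ξ → Finset (Fin s)) (c : Bool)
    (p : PublicPart s Y Ξ) (g y) : hardAttachment ι Gam c p (p.1.succAbove g, y) =
      if g ∈ Gam p.2.2.1 then (if y = p.2.2.2 g p.2.1 then some (false, c) else none)
      else some (true, labelSide ι ((p.2.2.2 g).symm y)) := by
  simp [hardAttachment]

/-- The hard input graphs. -/
def hardGraph (R : Type*) (ι : Bool × H → Y) (Gam : Ξ → Finset (Fin s))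
    (S : Fin k × Bool → PublicPart s Y Ξ × (Y → Bool × (Fin s → H))) :
    SimpleGraph (ChainVertex k s Y R) :=
  chainGraph (fun u => hardInner ι Gam (S u).1 (S u).2)
    fun u => hardAttachment ι Gam u.2 (S u).1

/-- The parity of the first `m` bits. -/
def prefixParity (b : Fin k → Bool) : ℕ → Bool
  | 0 => false
  | m + 1 => xor (prefixParity b m) (if h : m < k then b ⟨m, h⟩ else false)

lemma prefixParity_succ (b : Fin k → Bool) (i : Fin k) :
    prefixParity b (i.succ : Fin (k + 1)) = xor (prefixParity b (i.castSucc : Fin (k + 1))) (b i) := by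
  simp [prefixParity]

lemma hardGraph_adj_left {ι : Bool × H → Y} {Gam : Ξ → Finset (Fin s)}
    (S : Fin k × Bool → PublicPart s Y Ξ × (Y → Bool × (Fin s → H))) (u j g) :
    (hardGraph R ι Gam S).Adj (.inl (u, (S u).1.1, j)) (.inl (u, (S u).1.1.succAbove g,
      neighborLabels ι (Gam (S u).1.2.2.1) j (S u).1.2.2.2 ((S u).2 j) g)) :=
  ⟨rfl, Or.inl ⟨j, g, rfl, rfl⟩⟩

lemma hardGraph_adj_terminal {ι : Bool × H → Y} {Gam : Ξ → Finset (Fin s)}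
    (S : Fin k × Bool → PublicPart s Y Ξ × (Y → Bool × (Fin s → H))) {u q e}
    (h : hardAttachment ι Gam u.2 (S u).1 q = some e) :
    (hardGraph R ι Gam S).Adj (.inl (u, q)) (.inr (.inl (terminal u e))) :=
  ⟨e, h, rfl⟩

lemma neighborLabels_of_notMem {ι : Bool × H → Y} {Γ : Finset (Fin s)} {g : Fin s} (hg : g ∉ Γ)
    (j : Y) (τ : Fin s → Equiv.Perm Y) (x : Bool × (Fin s → H)) :
    neighborLabels ι Γ j τ x g = τ g (ι (x.1, x.2 g)) := if_neg hg

lemma neighborLabels_of_mem {ι : Bool × H → Y} {Γ : Finset (Fin s)} {g : Fin s} (hg : g ∈ Γ)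
    (j : Y) (τ : Fin s → Equiv.Perm Y) (x : Bool × (Fin s → H)) :
    neighborLabels ι Γ j τ x g = τ g j := if_pos hg

/-- An unrevealed group leads from a middle vertex through its hub to the right terminal on its
side. -/
lemma hardGraph_reachable_middle {ι : Bool × H → Y} (hι : Function.Injective ι)
    {Gam : Ξ → Finset (Fin s)} (hΓ' : ∀ ξ, ∃ g, g ∉ Gam ξ)
    (S : Fin k × Bool → PublicPart s Y Ξ × (Y → Bool × (Fin s → H))) (u j) :
    (hardGraph R ι Gam S).Reachable (.inl (u, (S u).1.1, j))
      (.inr (.inl (u.1.succ, ((S u).2 j).1))) := by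
  obtain ⟨g, hg⟩ := hΓ' (S u).1.2.2.1
  have h1 := (hardGraph_adj_left (R := R) (ι := ι) (Gam := Gam) S u j g).reachable
  rw [neighborLabels_of_notMem hg] at h1
  refine h1.trans ?_
  have h2 : hardAttachment ι Gam u.2 (S u).1 ((S u).1.1.succAbove g,
      (S u).1.2.2.2 g (ι (((S u).2 j).1, ((S u).2 j).2 g))) = some (true, ((S u).2 j).1) := by
    rw [hardAttachment_succAbove, if_neg hg, Equiv.symm_apply_apply, labelSide_apply hι]
  exact (hardGraph_adj_terminal S h2).reachable

/-- No vertex of a unit is stranded: in a revealed group the matching provides a middle vertex, and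
in an unrevealed group every vertex is attached to a terminal, hub or not. -/
lemma hardGraph_reachable_unit {ι : Bool × H → Y} (hι : Function.Injective ι)
    {Gam : Ξ → Finset (Fin s)} (hΓ' : ∀ ξ, ∃ g, g ∉ Gam ξ)
    (S : Fin k × Bool → PublicPart s Y Ξ × (Y → Bool × (Fin s → H))) (u q) :
    ∃ t, (hardGraph R ι Gam S).Reachable (.inl (u, q)) (.inr (.inl t)) := by
  refine forall_group (S u).1.1 (P := fun q => ∃ t, (hardGraph R ι Gam S).Reachable (.inl (u, q))
    (.inr (.inl t))) (fun j => ⟨_, hardGraph_reachable_middle hι hΓ' S u j⟩) (fun g y => ?_) q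
  by_cases hg : g ∈ Gam (S u).1.2.2.1
  · have h1 := (hardGraph_adj_left (R := R) (ι := ι) (Gam := Gam) S u
      (((S u).1.2.2.2 g).symm y) g).reachable
    rw [neighborLabels_of_mem hg, Equiv.apply_symm_apply] at h1
    exact ⟨_, h1.symm.trans (hardGraph_reachable_middle hι hΓ' S u _)⟩
  · exact ⟨_, (hardGraph_adj_terminal S
      (by rw [hardAttachment_succAbove, if_neg hg])).reachable⟩

/-- The path runs from the left terminal to the private neighbor of the special middle vertex, then
through this vertex to the right terminal on its side. -/
lemma hardGraph_reachable_step {ι : Bool × H → Y} (hι : Function.Injective ι)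
    {Gam : Ξ → Finset (Fin s)} (hΓ : ∀ ξ, (Gam ξ).Nonempty) (hΓ' : ∀ ξ, ∃ g, g ∉ Gam ξ)
    (S : Fin k × Bool → PublicPart s Y Ξ × (Y → Bool × (Fin s → H))) {b : Fin k → Bool}
    (hS : ∀ u, ((S u).2 (S u).1.2.1).1 = xor (b u.1) u.2) (i : Fin k) (c : Bool) :
    (hardGraph R ι Gam S).Reachable (.inr (.inl (i.castSucc, c)))
      (.inr (.inl (i.succ, xor (b i) c))) := by
  obtain ⟨g, hg⟩ := hΓ (S (i, c)).1.2.2.1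
  have h1 := (hardGraph_adj_left (R := R) (ι := ι) (Gam := Gam) S (i, c)
    (S (i, c)).1.2.1 g).reachable
  rw [neighborLabels_of_mem hg] at h1
  have h2 := hardGraph_reachable_middle (R := R) hι hΓ' S (i, c) (S (i, c)).1.2.1
  rw [hS] at h2
  refine SimpleGraph.Reachable.trans ?_ (h1.symm.trans h2)
  have h3 : hardAttachment ι Gam c (S (i, c)).1 ((S (i, c)).1.1.succAbove g,
      (S (i, c)).1.2.2.2 g (S (i, c)).1.2.1) = some (false, c) := by
    rw [hardAttachment_succAbove, if_pos hg, if_pos rfl]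
  exact (hardGraph_adj_terminal (u := (i, c)) S h3).reachable.symm

lemma hardGraph_reachable_zero {ι : Bool × H → Y} (hι : Function.Injective ι)
    {Gam : Ξ → Finset (Fin s)} (hΓ : ∀ ξ, (Gam ξ).Nonempty) (hΓ' : ∀ ξ, ∃ g, g ∉ Gam ξ)
    (S : Fin k × Bool → PublicPart s Y Ξ × (Y → Bool × (Fin s → H))) {b : Fin k → Bool}
    (hS : ∀ u, ((S u).2 (S u).1.2.1).1 = xor (b u.1) u.2) (i : Fin (k + 1)) :
    ∀ c, (hardGraph R ι Gam S).Reachable (.inr (.inl (0, c)))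
      (.inr (.inl (i, xor c (prefixParity b i)))) := by
  induction i using Fin.induction with
  | zero => intro c; simp [prefixParity]
  | succ i ih =>
    intro c
    refine (ih c).trans ?_
    have := hardGraph_reachable_step (R := R) hι hΓ hΓ' S hS i (xor c (prefixParity b i.castSucc))
    rw [prefixParity_succ]
    convert this using 4
    cases b i <;> cases c <;> simp

/-- A two-colouring of the vertices that is constant on connected components. -/
def hardColor (ι : Bool × H → Y) (Gam : Ξ → Finset (Fin s))
    (S : Fin k × Bool → PublicPart s Y Ξ × (Y → Bool × (Fin s → H))) (b : Fin k → Bool) :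
    ChainVertex k s Y R → Bool
  | .inl (u, q) => xor (prefixParity b (u.1.succ : Fin (k + 1)))
      (Fin.insertNth (α := fun _ => Y → Bool) (S u).1.1 (fun j => ((S u).2 j).1)
        (fun g y => if g ∈ Gam (S u).1.2.2.1 then ((S u).2 (((S u).1.2.2.2 g).symm y)).1
          else labelSide ι (((S u).1.2.2.2 g).symm y)) q.1 q.2)
  | .inr (.inl t) => xor (prefixParity b t.1) t.2
  | .inr (.inr _) => false

/-- The colour records which strand a vertex belongs to, named by the index of the strand at
position 0. Odd parity is needed only for the closing edge, which then joins two ends of the same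
strand. -/
lemma hardColor_eq_of_adj {ι : Bool × H → Y} (hι : Function.Injective ι)
    {Gam : Ξ → Finset (Fin s)}
    (S : Fin k × Bool → PublicPart s Y Ξ × (Y → Bool × (Fin s → H))) {b : Fin k → Bool}
    (hS : ∀ u, ((S u).2 (S u).1.2.1).1 = xor (b u.1) u.2) (hb : prefixParity b k = true)
    {v w : ChainVertex k s Y R} (h : (hardGraph R ι Gam S).Adj v w) :
    hardColor ι Gam S b v = hardColor ι Gam S b w := by
  have hin : ∀ u j g, hardColor (R := R) ι Gam S b (.inl (u, (S u).1.1, j))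
      = hardColor (R := R) ι Gam S b (.inl (u, (S u).1.1.succAbove g,
        neighborLabels ι (Gam (S u).1.2.2.1) j (S u).1.2.2.2 ((S u).2 j) g)) := by
    intro u j g
    simp only [hardColor, Fin.insertNth_apply_same, Fin.insertNth_apply_succAbove]
    congr 1
    split_ifs with hg
    · rw [neighborLabels_of_mem hg, Equiv.symm_apply_apply]
    · rw [neighborLabels_of_notMem hg, Equiv.symm_apply_apply, labelSide_apply hι]
  have hatt : ∀ u q e, hardAttachment ι Gam u.2 (S u).1 q = some e →
      hardColor (R := R) ι Gam S b (.inl (u, q))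
        = hardColor (R := R) ι Gam S b (.inr (.inl (terminal u e))) := by
    intro u q e
    refine forall_group (S u).1.1 (P := fun q => hardAttachment ι Gam u.2 (S u).1 q = some e →
      hardColor (R := R) ι Gam S b (.inl (u, q))
        = hardColor (R := R) ι Gam S b (.inr (.inl (terminal u e)))) (fun j h => ?_)
        (fun g y h => ?_) q
    · rw [hardAttachment_center] at h
      exact absurd h (by simp)
    · rw [hardAttachment_succAbove] at h
      simp only [hardColor, Fin.insertNth_apply_succAbove]
      split_ifs at h with hg hy
      · obtain rfl := Option.some.inj h
        rw [if_pos hg, hy, Equiv.symm_apply_apply, hS, prefixParity_succ]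
        simp only [terminal]
        cases b u.1 <;> cases u.2 <;> simp
      · obtain rfl := Option.some.inj h
        rw [if_neg hg]
        simp [terminal]
  rcases v with ⟨u, p⟩ | t | r <;> rcases w with ⟨u', p'⟩ | t' | r'
  · obtain ⟨rfl, ⟨j, g, rfl, rfl⟩ | ⟨j, g, rfl, rfl⟩⟩ := h
    · exact hin _ _ _
    · exact (hin _ _ _).symm
  · obtain ⟨e, he, rfl⟩ := h
    exact hatt _ _ _ he
  · exact absurd h id
  · obtain ⟨e, he, rfl⟩ := h
    exact (hatt _ _ _ he).symm
  · rcases h with ⟨rfl, rfl⟩ | ⟨rfl, rfl⟩ <;> simp [hardColor, hb, prefixParity]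
  · obtain rfl : t = (0, false) := h
    simp [hardColor, prefixParity]
  · exact absurd h id
  · obtain rfl : t' = (0, false) := h
    simp [hardColor, prefixParity]
  · exact absurd h id

/-- With even parity the closing edge joins the end of strand `false` to the start of strand `true`;
with odd parity `hardColor` separates the two strands. -/
theorem hardGraph_connected_iff {ι : Bool × H → Y} (hι : Function.Injective ι)
    {Gam : Ξ → Finset (Fin s)} (hΓ : ∀ ξ, (Gam ξ).Nonempty) (hΓ' : ∀ ξ, ∃ g, g ∉ Gam ξ)
    (S : Fin k × Bool → PublicPart s Y Ξ × (Y → Bool × (Fin s → H))) {b : Fin k → Bool}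
    (hS : ∀ u, ((S u).2 (S u).1.2.1).1 = xor (b u.1) u.2) :
    (hardGraph R ι Gam S).Connected ↔ prefixParity b k = false := by
  constructor
  · intro h
    by_contra hb
    rw [Bool.not_eq_false] at hb
    have h1 : ∀ v w, (hardGraph R ι Gam S).Reachable v w →
        hardColor ι Gam S b v = hardColor ι Gam S b w := by
      rintro v w ⟨p⟩
      induction p with
      | nil => rfl
      | cons hadj _ ih => exact (hardColor_eq_of_adj hι S hS hb hadj).trans ih
    have h2 := h1 _ _ (h.preconnected (.inr (.inl (0, false))) (.inr (.inl (0, true))))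
    simp [hardColor, prefixParity] at h2
  · intro hb
    have h0 : ∀ c, (hardGraph R ι Gam S).Reachable (.inr (.inl (0, c)))
        (.inr (.inl (0, false))) := by
      intro c
      cases c
      · exact SimpleGraph.Reachable.refl _
      · have h1 := hardGraph_reachable_zero (R := R) hι hΓ hΓ' S hS (Fin.last k) false
        rw [Fin.val_last, hb] at h1
        have h2 : (hardGraph R ι Gam S).Adj (.inr (.inl (Fin.last k, false)))
            (.inr (.inl (0, true))) := Or.inl ⟨rfl, rfl⟩
        exact (h1.trans h2.reachable).symm
    have ht : ∀ t, (hardGraph R ι Gam S).Reachable (.inr (.inl t)) (.inr (.inl (0, false))) := by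
      rintro ⟨i, c⟩
      have h1 := hardGraph_reachable_zero (R := R) hι hΓ hΓ' S hS i (xor c (prefixParity b i))
      rw [Bool.xor_assoc, Bool.xor_self, Bool.xor_false] at h1
      exact h1.symm.trans (h0 _)
    have hv : ∀ v, (hardGraph R ι Gam S).Reachable v (.inr (.inl (0, false))) := by
      rintro (⟨u, q⟩ | t | r)
      · obtain ⟨t, h⟩ := hardGraph_reachable_unit (R := R) hι hΓ' S u q
        exact h.trans (ht t)
      · exact ht t
      · have h2 : (hardGraph R ι Gam S).Adj (.inr (.inr r)) (.inr (.inl (0, false))) :=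
          show ((0 : Fin (k + 1)), false) = (0, false) from rfl
        exact h2.reachable
    have : Nonempty (ChainVertex k s Y R) := ⟨.inr (.inl (0, false))⟩
    exact ⟨fun v w => (hv v).trans (hv w).symm⟩

end ChainGraph

/-! ### From messages on the hard graph to independent views of the units. -/

section Views

open scoped Classical

set_option linter.unusedSectionVars false

variable {k s : ℕ} {Y R H Ξ : Type*}

/-- The message of a middle vertex `j` of unit `u` whose group is `a` and whose neighbors are the
`x g` in the other groups. -/
def midMessage (sk : ChainVertex k s Y R → Set (ChainVertex k s Y R) → List Bool)
    (u : Fin k × Bool) (a : Fin (s + 1)) (j : Y) (x : Fin s → Y) : List Bool :=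
  sk (.inl (u, a, j)) (unitNeighborhood u {q | ∃ g, q = (a.succAbove g, x g)} none)

/-- The message of a hub of unit `u` attached to side `σ` whose neighbors are the middle vertices in
`T`. -/
def hubMessage (sk : ChainVertex k s Y R → Set (ChainVertex k s Y R) → List Bool)
    (u : Fin k × Bool) (a : Fin (s + 1)) (g : Fin s) (y : Y) (σ : Bool) (T : Set Y) : List Bool :=
  sk (.inl (u, a.succAbove g, y)) (unitNeighborhood u {q | ∃ j ∈ T, q = (a, j)} (some (true, σ)))

/-- Only middle vertices and hubs have neighborhoods that depend on the hidden choices `ω`. Vertices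
in revealed groups see their matched middle vertex, other labels in unrevealed groups see no middle
vertex, and terminals and remaining vertices have fixed neighborhoods given the public part. -/
lemma message_hardGraph_congr (sk : ChainVertex k s Y R → Set (ChainVertex k s Y R) → List Bool)
    {ι : Bool × H → Y} (hι : Function.Injective ι) (Gam : Ξ → Finset (Fin s))
    (p : Fin k × Bool → PublicPart s Y Ξ) {ω ω' : Fin k × Bool → Y → Bool × (Fin s → H)}
    (h : ∀ u, unitView ι Gam (midMessage sk u) (hubMessage sk u) (p u) (ω u)
      = unitView ι Gam (midMessage sk u) (hubMessage sk u) (p u) (ω' u)) (v) :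
    sk v ((hardGraph R ι Gam fun u => (p u, ω u)).neighborSet v)
      = sk v ((hardGraph R ι Gam fun u => (p u, ω' u)).neighborSet v) := by
  rcases v with ⟨u, q⟩ | x
  · simp only [hardGraph]
    rw [chainGraph_neighborSet_inl, chainGraph_neighborSet_inl]
    have hu := h u
    simp only [unitView, Prod.mk.injEq, true_and] at hu
    obtain ⟨hM, hZ⟩ := hu
    refine forall_group (p u).1 (P := fun q => sk (.inl (u, q)) (unitNeighborhood u
      ((hardInner ι Gam (p u) (ω u)).neighborSet q) (hardAttachment ι Gam u.2 (p u) q))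
      = sk (.inl (u, q)) (unitNeighborhood u
      ((hardInner ι Gam (p u) (ω' u)).neighborSet q) (hardAttachment ι Gam u.2 (p u) q)))
      (fun j => ?_) (fun g y => ?_) q
    · have := congrFun hM j
      simp only [midMessage] at this
      rw [hardAttachment_center, hardInner, hardInner, starGraph_neighborSet_center,
        starGraph_neighborSet_center]
      exact this
    · rw [hardAttachment_succAbove, hardInner, hardInner, starGraph_neighborSet_succAbove,
        starGraph_neighborSet_succAbove]
      by_cases hg : g ∈ Gam (p u).2.2.1
      · simp only [neighborLabels_of_mem hg]
      · simp only [neighborLabels_of_notMem hg, if_neg hg]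
        by_cases hy : ∃ c, ι c = ((p u).2.2.2 g).symm y
        · obtain ⟨⟨σ, a⟩, hc⟩ := hy
          have hy' : y = (p u).2.2.2 g (ι (σ, a)) := by rw [hc, Equiv.apply_symm_apply]
          have := congrFun hZ (g, σ, a)
          simp only [hubMessage] at this
          rw [← hc, labelSide_apply hι]
          rw [← hy'] at this
          have e : ∀ o : Y → Bool × (Fin s → H),
              {q : Fin (s + 1) × Y | ∃ j, ((p u).2.2.2 g) (ι ((o j).1, (o j).2 g)) = y ∧
                q = ((p u).1, j)}
              = {q | ∃ j ∈ {j | (o j).1 = σ ∧ (o j).2 g = a}, q = ((p u).1, j)} := by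
            intro o
            ext q
            simp only [hy', EmbeddingLike.apply_eq_iff_eq, hι.eq_iff, Prod.mk.injEq,
              Set.mem_ofPred_eq]
          rw [e, e]
          exact this
        · have e : ∀ o : Y → Bool × (Fin s → H),
              {q : Fin (s + 1) × Y | ∃ j, ((p u).2.2.2 g) (ι ((o j).1, (o j).2 g)) = y ∧
                q = ((p u).1, j)} = ∅ := by
            intro o
            ext q
            simp only [Set.mem_ofPred_eq, Set.mem_empty_iff_false, iff_false]
            rintro ⟨j, hj, -⟩
            exact hy ⟨_, by rw [← hj, Equiv.symm_apply_apply]⟩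
          rw [e, e]
  · rw [hardGraph, hardGraph, chainGraph_neighborSet_inr]

lemma exists_referee_of_views (sk : ChainVertex k s Y R → Set (ChainVertex k s Y R) → List Bool)
    (ref : (ChainVertex k s Y R → List Bool) → Bool)
    {ι : Bool × H → Y} (hι : Function.Injective ι) (Gam : Ξ → Finset (Fin s)) :
    ∃ F : (Fin k × Bool → UnitView (Fin (s + 1)) (Fin s) Y H Ξ) → Bool,
      ∀ S : Fin k × Bool → PublicPart s Y Ξ × (Y → Bool × (Fin s → H)),
        ref (fun v => sk v ((hardGraph R ι Gam S).neighborSet v))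
          = F fun u => unitView ι Gam (midMessage sk u) (hubMessage sk u) (S u).1 (S u).2 := by
  have hfac : Function.FactorsThrough
      (fun S : Fin k × Bool → PublicPart s Y Ξ × (Y → Bool × (Fin s → H)) =>
        ref (fun v => sk v ((hardGraph R ι Gam S).neighborSet v)))
      (fun S u => unitView ι Gam (midMessage sk u) (hubMessage sk u) (S u).1 (S u).2) := by
    intro S S' h
    have hp : ∀ u, (S u).1 = (S' u).1 := fun u => by
      have := congrArg Prod.fst (congrFun h u)
      exact this
    have hS : S = fun u => ((S u).1, (S u).2) := rfl
    have hS' : S' = fun u => ((S u).1, (S' u).2) := by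
      funext u; rw [hp]
    have := message_hardGraph_congr sk hι Gam (fun u => (S u).1) (ω := fun u => (S u).2)
      (ω' := fun u => (S' u).2) fun u => by
        have := congrFun h u
        simp only at this
        rw [this, hp]
    simp only
    congr 1
    funext v
    have h1 := this v
    rw [← hS, ← hS'] at h1
    exact h1
  obtain ⟨F, hF⟩ := (Function.factorsThrough_iff _).1 hfac
  exact ⟨F, fun S => congrFun hF S⟩

lemma prefixParity_castSucc (b : Fin (k + 1) → Bool) (m : ℕ) (hm : m ≤ k) :
    prefixParity b m = prefixParity (fun i : Fin k => b i.castSucc) m := by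
  induction m with
  | zero => rfl
  | succ m ih =>
    simp only [prefixParity]
    rw [ih (by omega), dif_pos (by omega), dif_pos (by omega)]
    rfl

/-- Since `true` has sign `1`, the product counts the bits equal to `false`; this explains the
factor `(-1) ^ k` and the negation. -/
lemma prod_sideSign_eq (b : Fin k → Bool) :
    ∏ i, sideSign (b i) = (-1) ^ k * sideSign (!(prefixParity b k)) := by
  induction k with
  | zero => simp [prefixParity, sideSign]
  | succ k ih =>
    rw [Fin.prod_univ_castSucc, ih fun i => b i.castSucc]
    have e : prefixParity b (k + 1) = xor (prefixParity (fun i : Fin k => b i.castSucc) k)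
        (b (Fin.last k)) := by
      simp only [prefixParity]
      rw [dif_pos (by omega), prefixParity_castSucc b k le_rfl]
      rfl
    rw [e, pow_succ]
    cases prefixParity (fun i : Fin k => b i.castSucc) k <;> cases b (Fin.last k) <;>
      simp [sideSign]

variable [Fintype Y] [Fintype H] [Fintype Ξ]

/-- The sample of one unit. -/
abbrev UnitSample (s : ℕ) (Y H Ξ : Type*) : Type _ :=
  PublicPart s Y Ξ × (Y → Bool × (Fin s → H))

/-- Prescribe the side of the special middle vertex. -/
def specialSide (c : Bool) (z : UnitSample s Y H Ξ) : UnitSample s Y H Ξ :=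
  (z.1, setSide z.1.2.1 c z.2)

lemma expect_sideSign_mul_of_decidableEq {I : Type*} [Fintype I] [DecidableEq I] (j : Y)
    (F : (Y → Bool × (I → H)) → ℝ) :
    𝔼 ω, sideSign (ω j).1 * F ω
      = 1 / 2 * ((𝔼 ω, F (setSide j true ω)) - 𝔼 ω, F (setSide j false ω)) := by
  convert expect_sideSign_mul j F

lemma expect_sub_specialSide (F : UnitSample s Y H Ξ → ℝ) :
    1 / 2 * ((𝔼 z, F (specialSide true z)) - 𝔼 z, F (specialSide false z))
      = 𝔼 a, 𝔼 j, 𝔼 ξ, 𝔼 τ, 𝔼 ω, sideSign (ω j).1 * F ((a, j, ξ, τ), ω) := by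
  rw [expect_prod, expect_prod, expect_prod, expect_prod]
  simp only [expect_prod (α := Y) (β := Ξ × (Fin s → Equiv.Perm Y)),
    expect_prod (α := Ξ) (β := Fin s → Equiv.Perm Y)]
  simp only [expect_sideSign_mul_of_decidableEq, ← Finset.mul_expect, Finset.expect_sub_distrib, specialSide]

/-- The hard graph with bits `b` and unit samples `z`. -/
def hardInput (R : Type*) (ι : Bool × H → Y) (Gam : Ξ → Finset (Fin s)) (b : Fin k → Bool)
    (z : Fin k × Bool → UnitSample s Y H Ξ) : SimpleGraph (ChainVertex k s Y R) :=
  hardGraph R ι Gam fun u => specialSide (xor (b u.1) u.2) (z u)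

lemma hardInput_connected_iff {ι : Bool × H → Y} (hι : Function.Injective ι)
    {Gam : Ξ → Finset (Fin s)} (hΓ : ∀ ξ, (Gam ξ).Nonempty) (hΓ' : ∀ ξ, ∃ g, g ∉ Gam ξ)
    (b : Fin k → Bool) (z : Fin k × Bool → UnitSample s Y H Ξ) :
    (hardInput R ι Gam b z).Connected ↔ prefixParity b k = false :=
  hardGraph_connected_iff hι hΓ hΓ' _ fun u => by simp [specialSide, setSide]

/-- Whether the referee decides connectivity of `G` correctly, as a number. -/
def correctness {V : Type*} (sk : V → Set V → List Bool) (ref : (V → List Bool) → Bool)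
    (G : SimpleGraph V) : ℝ :=
  if ref (fun v => sk v (G.neighborSet v)) = true ↔ G.Connected then 1 else 0

/-- Being correct means predicting the parity, up to a global sign. The referee's answer depends on
the unit views alone, so the parity lemma bounds its advantage. -/
theorem expect_hardInput_correct_le [Nonempty Y] [Nonempty H] [Nonempty Ξ]
    (sk : ChainVertex k s Y R → Set (ChainVertex k s Y R) → List Bool)
    (ref : (ChainVertex k s Y R → List Bool) → Bool)
    {ι : Bool × H → Y} (hι : Function.Injective ι)
    {Gam : Ξ → Finset (Fin s)} (hΓ : ∀ ξ, (Gam ξ).Nonempty) (hΓ' : ∀ ξ, ∃ g, g ∉ Gam ξ)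
    {o : Fin k × Bool → ℝ} (ho : ∀ u, 0 ≤ o u)
    (hview : ∀ u, ∀ G : UnitView (Fin (s + 1)) (Fin s) Y H Ξ → ℝ, (∀ v, |G v| ≤ 1) →
      𝔼 a, 𝔼 j, 𝔼 ξ, 𝔼 τ, 𝔼 ω, sideSign (ω j).1 *
        G (unitView ι Gam (midMessage sk u) (hubMessage sk u) (a, j, ξ, τ) ω) ≤ 1 - o u) :
    𝔼 b : Fin k → Bool, 𝔼 z : Fin k × Bool → UnitSample s Y H Ξ,
        correctness sk ref (hardInput R ι Gam b z)
      ≤ 1 / 2 + 1 / 2 * ∏ i, (1 - o (i, false) * o (i, true)) := by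
  obtain ⟨F, hF⟩ := exists_referee_of_views sk ref hι Gam
  have h1 := abs_expect_prod_sideSign_mul_view_le
    (V := fun (u : Fin k × Bool) c (z : UnitSample s Y H Ξ) =>
      unitView ι Gam (midMessage sk u) (hubMessage sk u) (specialSide c z).1 (specialSide c z).2)
    ho (fun u G hG => by
      rw [expect_sub_specialSide fun z => G (unitView ι Gam (midMessage sk u) (hubMessage sk u)
        z.1 z.2)]
      exact hview u G hG) (fun v => sideSign (F v)) fun v => (abs_sideSign _).le
  have h2 : ∀ (b : Fin k → Bool) (z : Fin k × Bool → UnitSample s Y H Ξ),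
      correctness sk ref (hardInput R ι Gam b z)
      = 1 / 2 + 1 / 2 * ((-1) ^ k * ((∏ i, sideSign (b i)) * sideSign (F fun u =>
        unitView ι Gam (midMessage sk u) (hubMessage sk u) (specialSide (xor (b u.1) u.2) (z u)).1
          (specialSide (xor (b u.1) u.2) (z u)).2))) := by
    intro b z
    have hk : (-1 : ℝ) ^ k * (-1) ^ k = 1 := by rw [← mul_pow]; norm_num
    have e : ∀ x y : ℝ, (-1) ^ k * ((-1) ^ k * x * y) = x * y := by
      intro x y
      rw [mul_assoc, ← mul_assoc, hk, one_mul]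
    rw [correctness, hardInput_connected_iff hι hΓ hΓ', hardInput, hF, prod_sideSign_eq, e]
    generalize (F fun u => unitView ι Gam (midMessage sk u) (hubMessage sk u)
      (specialSide (xor (b u.1) u.2) (z u)).1 (specialSide (xor (b u.1) u.2) (z u)).2) = f
    cases f <;> cases prefixParity b k <;> norm_num [sideSign]
  simp_rw [h2]
  simp only [Finset.expect_add_distrib, Fintype.expect_const, ← Finset.mul_expect]
  have h3 : ∀ x y : ℝ, |x| ≤ y → (-1) ^ k * x ≤ y := by
    intro x y h
    refine (le_abs_self _).trans ?_
    rw [abs_mul, abs_pow, abs_neg, abs_one, one_pow, one_mul]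
    exact h
  have h4 := h3 _ _ h1
  simp only [← Finset.mul_expect] at h4
  linarith

end Views

/-! ### Auxiliary inputs that charge both kinds of messages to the total size. -/

section Costs

open scoped Classical

set_option linter.unusedSectionVars false

lemma expect_apply_eq_of_decidableEq {J X : Type*} [Fintype J] [DecidableEq J] [Fintype X]
    [Nonempty X] (j : J) (F : X → ℝ) : 𝔼 ω : J → X, F (ω j) = 𝔼 x, F x := by
  convert expect_apply_eq j F

/-- Translating by independent uniform elements at the distinct places `e i` leaves the law of `c`
unchanged. -/
lemma expect_comp_sub {I J Y : Type*} [Fintype I] [DecidableEq I] [Fintype J] [DecidableEq J]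
    [Fintype Y] [Nonempty Y] [AddCommGroup Y] {e : I → J} (he : Function.Injective e) (y : Y)
    (F : (I → Y) → ℝ) : 𝔼 c : J → Y, F (fun i => c (e i) - y) = 𝔼 x, F x := by
  have h1 : ∀ x : I → Y, 𝔼 c : J → Y, F (fun i => c (e i) - y)
      = 𝔼 c : J → Y, F (fun i => x i + (c (e i) - y)) := by
    intro x
    refine (Fintype.expect_equiv (Equiv.addRight (Function.extend e x 0)) _ _ fun c => ?_).symm
    congr 1
    funext i
    simp only [Equiv.coe_addRight, Pi.add_apply, he.extend_apply]
    abel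
  have h2 : 𝔼 c : J → Y, F (fun i => c (e i) - y)
      = 𝔼 x : I → Y, 𝔼 c : J → Y, F (fun i => x i + (c (e i) - y)) := by
    rw [← Finset.expect_congr rfl fun x _ => h1 x, Fintype.expect_const]
  rw [h2, Finset.expect_comm]
  have h3 : ∀ c : J → Y, (𝔼 x : I → Y, F (fun i => x i + (c (e i) - y))) = 𝔼 x, F x := fun c =>
    Fintype.expect_equiv (Equiv.addRight fun i => c (e i) - y) _ _ fun x => rfl
  rw [Finset.expect_congr rfl fun c _ => h3 c, Fintype.expect_const]

variable {k s : ℕ} {Y R H : Type*}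

/-- The total length of the messages on an input graph. -/
def messageSize {V : Type*} [Fintype V] (sk : V → Set V → List Bool) (G : SimpleGraph V) : ℝ :=
  ∑ v, ((sk v (G.neighborSet v)).length : ℝ)

lemma messageSize_nonneg {V : Type*} [Fintype V] (sk : V → Set V → List Bool)
    (G : SimpleGraph V) : 0 ≤ messageSize sk G :=
  Finset.sum_nonneg fun _ _ => Nat.cast_nonneg _

lemma sum_unit_le_messageSize [Fintype Y] [Fintype R]
    (sk : ChainVertex k s Y R → Set (ChainVertex k s Y R) → List Bool)
    (E : Fin k × Bool → SimpleGraph (Fin (s + 1) × Y))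
    (att : Fin k × Bool → Fin (s + 1) × Y → Option (Bool × Bool)) :
    ∑ u, ∑ a, ∑ y, ((sk (.inl (u, a, y))
        (unitNeighborhood u ((E u).neighborSet (a, y)) (att u (a, y)))).length : ℝ)
      ≤ messageSize sk (chainGraph E att) := by
  rw [messageSize, Fintype.sum_sum_type]
  have h : ∑ x : (Fin k × Bool) × (Fin (s + 1) × Y), ((sk (.inl x)
      ((chainGraph (R := R) E att).neighborSet (.inl x))).length : ℝ)
      = ∑ u, ∑ a, ∑ y, ((sk (.inl (u, a, y))
        (unitNeighborhood u ((E u).neighborSet (a, y)) (att u (a, y)))).length : ℝ) := by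
    rw [Fintype.sum_prod_type]
    refine Finset.sum_congr rfl fun u _ => ?_
    rw [Fintype.sum_prod_type]
    simp_rw [chainGraph_neighborSet_inl]
  have : 0 ≤ ∑ x, ((sk (.inr x)
    ((chainGraph (R := R) E att).neighborSet (.inr x))).length : ℝ) :=
    Finset.sum_nonneg fun _ _ => Nat.cast_nonneg _
  linarith

/-- Vertices of different groups are adjacent if their labels have the sum prescribed for the two
groups. -/
def sumGraph [AddCommGroup Y] (c : Sym2 (Fin (s + 1)) → Y) : SimpleGraph (Fin (s + 1) × Y) where
  Adj p q := p.1 ≠ q.1 ∧ p.2 + q.2 = c s(p.1, q.1)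
  symm := ⟨fun p q h => ⟨h.1.symm, by rw [add_comm, h.2, Sym2.eq_swap]⟩⟩
  loopless := ⟨fun p h => h.1 rfl⟩

lemma sumGraph_neighborSet [AddCommGroup Y] (c : Sym2 (Fin (s + 1)) → Y) (a : Fin (s + 1)) (y : Y) :
    (sumGraph c).neighborSet (a, y)
      = {q | ∃ g, q = (a.succAbove g, c s(a, a.succAbove g) - y)} := by
  ext ⟨b, z⟩
  simp only [SimpleGraph.mem_neighborSet, sumGraph, Set.mem_ofPred_eq, Prod.mk.injEq]
  constructor
  · rintro ⟨h1, h2⟩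
    rcases Fin.eq_self_or_eq_succAbove a b with rfl | ⟨g, rfl⟩
    · exact absurd rfl h1
    · exact ⟨g, rfl, by rw [← h2]; abel⟩
  · rintro ⟨g, rfl, rfl⟩
    exact ⟨(Fin.succAbove_ne a g).symm, by abel⟩

/-- Input graphs in which all vertices of the units look like middle vertices. -/
def midInput (R : Type*) [AddCommGroup Y] (c : Fin k × Bool → Sym2 (Fin (s + 1)) → Y) :
    SimpleGraph (ChainVertex k s Y R) :=
  chainGraph (fun u => sumGraph (c u)) fun _ _ => none

/-- In `sumGraph` every vertex has exactly one neighbor in each other group. Different pairs of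
groups have independent sums, so the neighbors of a fixed vertex are independent and uniform, as for
a middle vertex. -/
lemma sum_midMessage_le [Fintype Y] [Fintype R] [AddCommGroup Y]
    (sk : ChainVertex k s Y R → Set (ChainVertex k s Y R) → List Bool) :
    ∑ u, (((s + 1 : ℕ) : ℝ) * Fintype.card Y *
        𝔼 a, 𝔼 j, 𝔼 x, ((midMessage sk u a j x).length : ℝ))
      ≤ 𝔼 c, messageSize sk (midInput R c) := by
  have hY : (Fintype.card Y : ℝ) ≠ 0 := by
    exact_mod_cast (Fintype.card_pos_iff.2 ⟨(0 : Y)⟩).ne'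
  have h1 : ∀ c : Fin k × Bool → Sym2 (Fin (s + 1)) → Y,
      ∑ u, ∑ a, ∑ y, ((midMessage sk u a y
        fun g => c u s(a, a.succAbove g) - y).length : ℝ) ≤ messageSize sk (midInput R c) := by
    intro c
    refine le_trans (le_of_eq ?_) (sum_unit_le_messageSize sk _ _)
    simp_rw [sumGraph_neighborSet]
    rfl
  refine le_trans (le_of_eq ?_) (Finset.expect_le_expect fun c _ => h1 c)
  simp_rw [Finset.expect_sum_comm]
  refine Finset.sum_congr rfl fun u _ => ?_
  have h2 : ∀ a y, (𝔼 c : Fin k × Bool → Sym2 (Fin (s + 1)) → Y, ((midMessage sk u a y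
        fun g => c u s(a, a.succAbove g) - y).length : ℝ))
      = 𝔼 x, ((midMessage sk u a y x).length : ℝ) := by
    intro a y
    rw [expect_apply_eq_of_decidableEq u fun d : Sym2 (Fin (s + 1)) → Y => ((midMessage sk u a y
        fun g => d s(a, a.succAbove g) - y).length : ℝ)]
    refine expect_comp_sub (e := fun g => s(a, a.succAbove g)) ?_ y
      fun x => ((midMessage sk u a y x).length : ℝ)
    intro g g' h
    simpa using h
  simp_rw [h2]
  rw [Fintype.expect_eq_sum_div_card, Fintype.card_fin]
  simp_rw [Fintype.expect_eq_sum_div_card (fun j : Y => _)]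
  rw [← Finset.sum_div]
  have : ((s + 1 : ℕ) : ℝ) ≠ 0 := by positivity
  field_simp

/-- All vertices outside of group `a` are adjacent to the vertices of group `a` with labels in `T`. -/
def hubGraph (a : Fin (s + 1)) (T : Set Y) : SimpleGraph (Fin (s + 1) × Y) where
  Adj p q := (p.1 = a ∧ p.2 ∈ T ∧ q.1 ≠ a) ∨ (q.1 = a ∧ q.2 ∈ T ∧ p.1 ≠ a)
  symm := ⟨fun _ _ h => h.symm⟩
  loopless := ⟨fun _ h => h.elim (fun h => h.2.2 h.1) fun h => h.2.2 h.1⟩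

lemma hubGraph_neighborSet (a : Fin (s + 1)) (T : Set Y) (g : Fin s) (y : Y) :
    (hubGraph a T).neighborSet (a.succAbove g, y) = {q | ∃ j ∈ T, q = (a, j)} := by
  ext ⟨b, z⟩
  have := Fin.succAbove_ne a g
  simp only [SimpleGraph.mem_neighborSet, hubGraph, Set.mem_ofPred_eq, Prod.mk.injEq]
  constructor
  · rintro (h | ⟨rfl, h, -⟩)
    · exact absurd h.1 this
    · exact ⟨z, h, rfl, rfl⟩
  · rintro ⟨j, h, rfl, rfl⟩
    exact Or.inr ⟨rfl, h, this⟩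

/-- Input graphs in which all vertices of the units outside of one group look like hubs. -/
def hubInput (R : Type*) (z : Fin k × Bool → Fin (s + 1) × (Y → Bool × H) × (Bool × H)) :
    SimpleGraph (ChainVertex k s Y R) :=
  chainGraph (fun u => hubGraph (z u).1 {j | (z u).2.1 j = (z u).2.2})
    fun u q => if q.1 = (z u).1 then none else some (true, (z u).2.2.1)

/-- All labels outside the group `a` imitate one and the same hub, so the total length bounds the
sum of hub messages over all labels, not only over the few hubs of a hard input. -/
lemma sum_hubMessage_le [Fintype Y] [Fintype R] [Fintype H] [Nonempty H]
    (sk : ChainVertex k s Y R → Set (ChainVertex k s Y R) → List Bool) :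
    ∑ u, (𝔼 a, 𝔼 r : Y → Bool × H, 𝔼 c : Bool × H, ∑ g, ∑ y,
        ((hubMessage sk u a g y c.1 {j | r j = c}).length : ℝ))
      ≤ 𝔼 z : Fin k × Bool → Fin (s + 1) × (Y → Bool × H) × (Bool × H),
        messageSize sk (hubInput R z) := by
  have h1 : ∀ z : Fin k × Bool → Fin (s + 1) × (Y → Bool × H) × (Bool × H),
      ∑ u, ∑ g, ∑ y, ((hubMessage sk u (z u).1 g y (z u).2.2.1
        {j | (z u).2.1 j = (z u).2.2}).length : ℝ) ≤ messageSize sk (hubInput R z) := by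
    intro z
    refine le_trans ?_ (sum_unit_le_messageSize sk _ _)
    refine Finset.sum_le_sum fun u _ => ?_
    rw [Fin.sum_univ_succAbove _ (z u).1]
    refine le_trans (le_of_eq ?_) (le_add_of_nonneg_left
      (Finset.sum_nonneg fun _ _ => Nat.cast_nonneg _))
    simp_rw [hubGraph_neighborSet, if_neg (Fin.succAbove_ne (z u).1 _)]
    rfl
  refine le_trans (le_of_eq ?_) (Finset.expect_le_expect fun z _ => h1 z)
  rw [Finset.expect_sum_comm]
  refine Finset.sum_congr rfl fun u _ => ?_
  rw [expect_apply_eq_of_decidableEq u fun w : Fin (s + 1) × (Y → Bool × H) × (Bool × H) =>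
    ∑ g, ∑ y, ((hubMessage sk u w.1 g y w.2.2.1 {j | w.2.1 j = w.2.2}).length : ℝ)]
  rw [expect_prod]
  refine Finset.expect_congr rfl fun a _ => ?_
  rw [expect_prod]

end Costs

/-! ### Deterministic schemes with small messages fail on the hard inputs. -/

section Deterministic

open scoped Classical

set_option linter.unusedSectionVars false

/-- The numerical conditions on the parameters of the construction: groups of size `q`, `s + 1`
groups, `2 * h` hub values, `L` rounds with rate `1 / K`, typical middle messages of at most `C` bits
and hub messages of at most `W` bits, total hub cost `T` of a unit, resulting overlap `δ₂`. -/
structure SketchParameters (q h s K L C W : ℕ) (θ δ t T δ₂ : ℝ) : Prop where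
  two_le_K : 2 ≤ K
  L_pos : 0 < L
  two_le_s : 2 ≤ s
  θ_pos : 0 < θ
  δ_nonneg : 0 ≤ δ
  δ_le_one : δ ≤ 1
  spread_le : (1 + (q : ℝ) / h * θ) ^ s ≤ 5 / 4
  one_le_gain : 1 ≤ q * (θ * δ)
  leftover_le : Real.exp (2 * K) * (L * δ) ≤ 1 / 8
  trivial_le : Real.exp (2 * K) * (L * ((1 - 1 / K : ℝ) ^ s + (1 - (1 - 1 / K : ℝ) ^ L) ^ s)) ≤ 1 / 8
  gain_ge : (2 : ℝ) ^ (C + 1) * 4 ≤ (q * (θ * δ)) ^ (L / 2)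
  C_pos : 0 < C
  W_pos : 0 < W
  t_pos : 0 < t
  t_le : t ≤ 1 / 2
  overlap_nonneg : 0 ≤ δ₂
  overlap_le_one : δ₂ ≤ 1
  overlap_le : δ₂ ≤ Real.exp (-(2 * K)) / (8 * L) / 2 - ((s * (2 * h)) * (W + 1) / (t * q) + 4 * t)
    - 2 * ((2 * h) * T / (q * W))

variable {A I Y H : Type*} [Fintype A] [Fintype I] [Fintype Y] [Fintype H]

lemma expect_sideSign_mul_view_le_of_parameters [Nonempty A] [Nonempty Y] [Nonempty H]
    [DecidableEq I] {ι : Bool × H → Y} (hι : Function.Injective ι) {K L C W : ℕ}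
    {θ δ t T δ₂ : ℝ} (hp : SketchParameters (Fintype.card Y) (Fintype.card H) (Fintype.card I)
      K L C W θ δ t T δ₂) (g₀ : I)
    {mid : A → Y → (I → Y) → List Bool} {hub : A → I → Y → Bool → Set Y → List Bool}
    (hmid : 𝔼 a, 𝔼 j, 𝔼 x, ((mid a j x).length : ℝ) ≤ C / 8)
    (hhub : 𝔼 a, 𝔼 r : Y → Bool × H, 𝔼 c : Bool × H, ∑ g, ∑ y,
      ((hub a g y c.1 {j | r j = c}).length : ℝ) ≤ T)
    (G : UnitView A I Y H (Fin L × (I → Fin (K ^ L))) → ℝ) (hG : ∀ v, |G v| ≤ 1) :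
    𝔼 a, 𝔼 j, 𝔼 ξ, 𝔼 τ, 𝔼 ω, sideSign (ω j).1 *
      G (unitView ι (revealSet K L g₀) mid hub (a, j, ξ, τ) ω) ≤ 1 - δ₂ := by
  rename_i inst
  obtain rfl : inst = fun a b => Classical.propDecidable _ := Subsingleton.elim _ _
  have : Nonempty I := ⟨g₀⟩
  have hL := hp.L_pos
  have hK := hp.two_le_K
  have : Nonempty (Fin L) := ⟨⟨0, hL⟩⟩
  have : Nonempty (Fin (K ^ L)) := ⟨⟨0, by positivity⟩⟩
  have h1 := expect_sideSign_mul_view_le (A := A) (ι := ι) (Gam := revealSet K L g₀) (mid := mid)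
    (hub := hub) hp.C_pos (δ := Real.exp (-(2 * K)) / (8 * L)) (by positivity)
    (fun f j hf => expect_abs_condAvg_neighborLabels_le hι hK hL g₀ hp.θ_pos hp.δ_nonneg hp.δ_le_one
      hp.spread_le hp.one_le_gain hp.leftover_le hp.trivial_le hp.gain_ge f j hf)
    hmid hhub hp.W_pos hp.t_pos hp.t_le G hG
  refine h1.trans ?_
  have := hp.overlap_le
  simp only [Fintype.card_prod, Fintype.card_bool]
  push_cast
  linarith

lemma card_filter_lt_mul_le {U : Type*} [Fintype U] {m : U → ℝ} (hm : ∀ u, 0 ≤ m u) {c : ℝ} :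
    ((Finset.univ.filter fun u => c < m u).card : ℝ) * c ≤ ∑ u, m u := by
  calc ((Finset.univ.filter fun u => c < m u).card : ℝ) * c
      = ∑ u with c < m u, c := by rw [Finset.sum_const, nsmul_eq_mul]
    _ ≤ ∑ u with c < m u, m u := Finset.sum_le_sum fun u hu => (Finset.mem_filter.1 hu).2.le
    _ ≤ ∑ u, m u := Finset.sum_le_sum_of_subset_of_nonneg (Finset.filter_subset _ _)
        fun u _ _ => hm u

/-- By Markov's inequality at most `k / 4` units have a too large `m`, and at most `k / 4` a too
large `c`. At least `k / 2` stages have two good units, and each contributes a factor `1 - δ ^ 2`.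
-/
lemma prod_one_sub_mul_le {k : ℕ} {m c : Fin k × Bool → ℝ} (hm0 : ∀ u, 0 ≤ m u)
    (hc0 : ∀ u, 0 ≤ c u) {M T δ : ℝ} (hM : 0 < M) (hT : 0 < T) (hmsum : ∑ u, m u ≤ k * (M / 4))
    (hcsum : ∑ u, c u ≤ k * (T / 4)) (hδ0 : 0 ≤ δ) (hδ1 : δ ≤ 1) :
    ∏ i, (1 - (if m (i, false) ≤ M ∧ c (i, false) ≤ T then δ else 0) *
        (if m (i, true) ≤ M ∧ c (i, true) ≤ T then δ else 0))
      ≤ Real.exp (-(δ ^ 2 * (k / 2))) := by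
  have hbadm : ((Finset.univ.filter fun u => M < m u).card : ℝ) ≤ k / 4 := by
    have h1 := (card_filter_lt_mul_le hm0 (c := M)).trans hmsum
    rw [← mul_le_mul_iff_left₀ hM]
    linarith
  have hbadc : ((Finset.univ.filter fun u => T < c u).card : ℝ) ≤ k / 4 := by
    have h1 := (card_filter_lt_mul_le hc0 (c := T)).trans hcsum
    rw [← mul_le_mul_iff_left₀ hT]
    linarith
  obtain ⟨good, hgood⟩ : ∃ good : Finset (Fin k), good = Finset.univ.filter fun i =>
    ∀ e, m (i, e) ≤ M ∧ c (i, e) ≤ T := ⟨_, rfl⟩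
  have hcard : (k : ℝ) / 2 ≤ good.card := by
    have h1 : goodᶜ ⊆ ((Finset.univ.filter fun u => M < m u) ∪
        (Finset.univ.filter fun u => T < c u)).image Prod.fst := by
      intro i hi
      rw [hgood, Finset.mem_compl, Finset.mem_filter] at hi
      push Not at hi
      obtain ⟨e, he⟩ := hi (Finset.mem_univ _)
      rw [Finset.mem_image]
      refine ⟨(i, e), ?_, rfl⟩
      simp only [Finset.mem_union, Finset.mem_filter, Finset.mem_univ, true_and]
      by_cases h : M < m (i, e)
      · exact Or.inl h
      · exact Or.inr (he (not_lt.1 h))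
    have h2 := (Finset.card_le_card h1).trans (Finset.card_image_le.trans
      (Finset.card_union_le _ _))
    have h3 : ((goodᶜ).card : ℝ) ≤ k / 4 + k / 4 :=
      le_trans (by exact_mod_cast h2) (add_le_add hbadm hbadc)
    have h4 : ((good.card + (goodᶜ).card : ℕ) : ℝ) = k := by
      rw [Finset.card_add_card_compl, Fintype.card_fin]
    push_cast at h4
    linarith
  calc _ ≤ ∏ i, (if i ∈ good then Real.exp (-δ ^ 2) else 1) := by
        refine Finset.prod_le_prod (fun i _ => ?_) fun i _ => ?_
        · have h : δ * δ ≤ 1 := by nlinarith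
          split_ifs <;> simp; linarith
        · by_cases h : i ∈ good
          · rw [if_pos h]
            rw [hgood, Finset.mem_filter] at h
            rw [if_pos (h.2 _), if_pos (h.2 _)]
            have := Real.add_one_le_exp (-δ ^ 2)
            nlinarith
          · rw [if_neg h, sub_le_self_iff]
            split_ifs <;> positivity
    _ = Real.exp (-δ ^ 2) ^ good.card := by
        rw [Finset.prod_ite_mem, Finset.univ_inter, Finset.prod_const]
    _ = Real.exp (-(δ ^ 2 * good.card)) := by
        rw [← Real.exp_nat_mul]
        congr 1
        ring
    _ ≤ _ := by
        refine Real.exp_le_exp.2 (neg_le_neg (mul_le_mul_of_nonneg_left hcard (sq_nonneg _)))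

/-- Costs are bounded only on average over the units. Units exceeding four times their share get
overlap 0, which is always valid; the others get `δ₂`. -/
theorem expect_hardInput_correct_le_of_size {k s : ℕ} {R : Type*} [Fintype R] [AddCommGroup Y]
    [Nonempty H]
    (sk : ChainVertex k s Y R → Set (ChainVertex k s Y R) → List Bool)
    (ref : (ChainVertex k s Y R → List Bool) → Bool)
    {ι : Bool × H → Y} (hι : Function.Injective ι) {K L C W : ℕ}
    {θ δ t T δ₂ : ℝ} (hp : SketchParameters (Fintype.card Y) (Fintype.card H) s
      K L C W θ δ t T δ₂) (hT : 0 < T) (g₀ : Fin s)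
    (hmid : 𝔼 c, messageSize sk (midInput R c) ≤ k * ((s + 1 : ℕ) * Fintype.card Y) * (C / 32))
    (hhub : 𝔼 z : Fin k × Bool → Fin (s + 1) × (Y → Bool × H) × (Bool × H),
        messageSize sk (hubInput R z) ≤ k * (T / 4)) :
    𝔼 b : Fin k → Bool, 𝔼 z : Fin k × Bool → UnitSample s Y H (Fin L × (Fin s → Fin (K ^ L))),
        correctness sk ref (hardInput R ι (revealSet K L g₀) b z)
      ≤ 1 / 2 + 1 / 2 * Real.exp (-(δ₂ ^ 2 * (k / 2))) := by
  have hY : 0 < Fintype.card Y := Fintype.card_pos_iff.2 ⟨0⟩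
  have hYpos : (0 : ℝ) < Fintype.card Y := by exact_mod_cast hY
  have hCpos : (0 : ℝ) < C := by exact_mod_cast hp.C_pos
  have hL := hp.L_pos
  have hK := hp.two_le_K
  have : Nonempty (Fin L) := ⟨⟨0, hL⟩⟩
  have : Nonempty (Fin (K ^ L)) := ⟨⟨0, by positivity⟩⟩
  have : Nontrivial (Fin s) := Fin.nontrivial_iff_two_le.2 hp.two_le_s
  obtain ⟨m, hm⟩ : ∃ m : Fin k × Bool → ℝ, m = fun u =>
    𝔼 a, 𝔼 j, 𝔼 x, ((midMessage sk u a j x).length : ℝ) := ⟨_, rfl⟩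
  obtain ⟨c, hc⟩ : ∃ c : Fin k × Bool → ℝ, c = fun u =>
    𝔼 a, 𝔼 r : Y → Bool × H, 𝔼 c : Bool × H, ∑ g, ∑ y,
        ((hubMessage sk u a g y c.1 {j | r j = c}).length : ℝ) := ⟨_, rfl⟩
  have hm0 : ∀ u, 0 ≤ m u := by
    intro u
    rw [hm]
    exact Finset.expect_nonneg fun _ _ => Finset.expect_nonneg fun _ _ =>
      Finset.expect_nonneg fun _ _ => Nat.cast_nonneg _
  have hc0 : ∀ u, 0 ≤ c u := by
    intro u
    rw [hc]
    exact Finset.expect_nonneg fun _ _ => Finset.expect_nonneg fun _ _ =>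
      Finset.expect_nonneg fun _ _ => Finset.sum_nonneg fun _ _ => Finset.sum_nonneg fun _ _ =>
        Nat.cast_nonneg _
  have hmsum : ∑ u, m u ≤ k * (C / 32) := by
    have h1 := (sum_midMessage_le sk).trans hmid
    rw [← Finset.mul_sum] at h1
    have h2 : (0 : ℝ) < ((s + 1 : ℕ) : ℝ) * Fintype.card Y := by positivity
    rw [hm]
    rw [show (k : ℝ) * ((s + 1 : ℕ) * Fintype.card Y) * (C / 32)
      = ((s + 1 : ℕ) : ℝ) * Fintype.card Y * (k * (C / 32)) by ring] at h1
    exact le_of_mul_le_mul_left h1 h2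
  have hcsum : ∑ u, c u ≤ k * (T / 4) := by
    rw [hc]
    exact (sum_hubMessage_le sk).trans hhub
  refine (expect_hardInput_correct_le sk ref hι (fun ξ => revealSet_nonempty K L g₀ ξ)
    (fun ξ => exists_notMem_revealSet K L g₀ ξ)
    (o := fun u => if m u ≤ C / 8 ∧ c u ≤ T then δ₂ else 0) (fun u => ?_) fun u G hG => ?_).trans ?_
  · split_ifs
    · exact hp.overlap_nonneg
    · exact le_rfl
  · split_ifs with h
    · rw [hm, hc] at h
      refine expect_sideSign_mul_view_le_of_parameters hι (T := T) (C := C) (W := W) (δ := δ)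
        (θ := θ) (t := t) ?_ g₀ h.1 h.2 G hG
      rw [Fintype.card_fin]
      exact hp
    · rw [sub_zero]
      refine Finset.expect_le Finset.univ_nonempty fun _ _ => ?_
      refine Finset.expect_le Finset.univ_nonempty fun _ _ => ?_
      refine Finset.expect_le Finset.univ_nonempty fun _ _ => ?_
      refine Finset.expect_le Finset.univ_nonempty fun _ _ => ?_
      refine Finset.expect_le Finset.univ_nonempty fun _ _ => ?_
      refine (le_abs_self _).trans ?_
      rw [abs_mul, abs_sideSign, one_mul]
      exact hG _
  · have := prod_one_sub_mul_le hm0 hc0 (show (0 : ℝ) < C / 8 by positivity) hT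
      (hmsum.trans (le_of_eq (by ring))) hcsum hp.overlap_nonneg hp.overlap_le_one
    linarith

end Deterministic

/-! ### Shared randomness and the passage to `SketchingScheme`. -/

section Randomized

open scoped Classical

set_option linter.unusedSectionVars false

lemma tsum_map_uniformOfFintype_mul {α β : Type*} [Fintype α] [Nonempty α] (g : α → β)
    (f : β → ℝ≥0∞) :
    ∑' b, ((PMF.uniformOfFintype α).map g) b * f b
      = (Fintype.card α : ℝ≥0∞)⁻¹ * ∑ a, f (g a) := by
  simp_rw [PMF.map_apply, ← ENNReal.tsum_mul_right]
  rw [ENNReal.tsum_comm]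
  have h : ∀ a, ∑' b, (if b = g a then (PMF.uniformOfFintype α) a else 0) * f b
      = (Fintype.card α : ℝ≥0∞)⁻¹ * f (g a) := by
    intro a
    rw [tsum_eq_single (g a)]
    · simp
    · intro b hb
      simp [hb]
  simp_rw [h]
  rw [tsum_fintype, Finset.mul_sum]

variable {n : ℕ} (S : SketchingScheme.{u} n)

lemma SketchingScheme.measurableSet_output (G : SimpleGraph (Fin n)) :
    MeasurableSet {ω | S.output G ω = true} := by
  have h : {ω | S.output G ω = true} = ⋃ M : Fin n → List Bool,
      (⋂ v, {ω | S.sketch v (G.neighborSet v) ω = M v}) ∩ {ω | S.referee M ω = true} := by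
    ext ω
    simp only [Set.mem_ofPred_eq, Set.mem_iUnion, Set.mem_inter_iff, Set.mem_iInter,
      SketchingScheme.output]
    constructor
    · intro h
      exact ⟨S.message G ω, fun v => rfl, h⟩
    · rintro ⟨M, hM, h⟩
      have : S.message G ω = M := funext hM
      rw [this]
      exact h
  rw [h]
  exact MeasurableSet.iUnion fun M => (MeasurableSet.iInter fun v =>
    S.measurableSet_sketch v _ _).inter (S.measurableSet_referee M)

lemma SketchingScheme.measurableSet_correct (G : SimpleGraph (Fin n)) :
    MeasurableSet {ω | S.output G ω = true ↔ G.Connected} := by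
  by_cases h : G.Connected
  · simpa [h] using S.measurableSet_output G
  · simp only [h, iff_false]
    exact (S.measurableSet_output G).compl

lemma SketchingScheme.measurable_length (G : SimpleGraph (Fin n)) (v : Fin n) :
    Measurable fun ω => ((S.message G ω v).length : ℝ≥0∞) := by
  let _ : MeasurableSpace (List Bool) := ⊤
  have h1 : Measurable fun ω => S.message G ω v :=
    measurable_to_countable' fun m => S.measurableSet_sketch v _ m
  have h2 : Measurable fun m : List Bool => (m.length : ℝ≥0∞) := measurable_from_top
  exact h2.comp h1

/-- Relabel the vertices of a graph. -/
def relabel {V : Type*} (e : V ≃ Fin n) (G : SimpleGraph V) : SimpleGraph (Fin n) :=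
  G.comap e.symm

lemma relabel_neighborSet {V : Type*} (e : V ≃ Fin n) (G : SimpleGraph V) (v : V) :
    (relabel e G).neighborSet (e v) = e '' G.neighborSet v := by
  ext w
  simp only [relabel, SimpleGraph.mem_neighborSet, SimpleGraph.comap_adj, Equiv.symm_apply_apply,
    Set.mem_image]
  constructor
  · intro h
    exact ⟨e.symm w, h, by simp⟩
  · rintro ⟨x, h, rfl⟩
    simpa using h

lemma relabel_connected_iff {V : Type*} (e : V ≃ Fin n) (G : SimpleGraph V) :
    (relabel e G).Connected ↔ G.Connected :=
  (SimpleGraph.Iso.comap e.symm G).connected_iff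

/-- For every outcome `ω` the scheme is deterministic, with success at most `7 / 10` unless its mean
total size is at least `S₀`. Hence success is at most `7 / 10` plus size divided by `S₀`, pointwise;
integrating, success `3 / 4` forces a mean size of at least `S₀ / 20`. -/
theorem exists_distribution_of_deterministic {V : Type*} [Fintype V] (e : V ≃ Fin n) (hn : 0 < n)
    {α : Type*} [Fintype α] [Nonempty α] (gr : α → SimpleGraph V) {S₀ : ℝ} (hS₀ : 0 < S₀)
    (hdet : ∀ (sk : V → Set V → List Bool) (ref : (V → List Bool) → Bool),
      𝔼 a, messageSize sk (gr a) < S₀ → 𝔼 a, correctness sk ref (gr a) ≤ 7 / 10) :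
    ∃ D : PMF (SimpleGraph (Fin n)), ∀ S : SketchingScheme.{u} n, 3 / 4 ≤ S.successProbOn D →
      ENNReal.ofReal (S₀ / (20 * n)) ≤ S.expectedAverageSizeOn D := by
  refine ⟨(PMF.uniformOfFintype α).map fun a => relabel e (gr a), fun S h => ?_⟩
  have hα : (0 : ℝ) < Fintype.card α := by exact_mod_cast Fintype.card_pos (α := α)
  have hnpos : (0 : ℝ) < n := by exact_mod_cast hn
  obtain ⟨c, hc⟩ : ∃ c : α → S.Ω → ℝ≥0∞, c = fun a =>
    Set.indicator {ω | S.output (relabel e (gr a)) ω = true ↔ (relabel e (gr a)).Connected} 1 :=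
    ⟨_, rfl⟩
  obtain ⟨z, hz⟩ : ∃ z : α → S.Ω → ℝ≥0∞, z = fun a ω =>
    ∑ v, ((S.message (relabel e (gr a)) ω v).length : ℝ≥0∞) := ⟨_, rfl⟩
  have hzmeas : ∀ a, Measurable (z a) := by
    intro a
    rw [hz]
    exact Finset.measurable_sum _ fun v _ => S.measurable_length _ v
  have hpt : ∀ ω, ∑ a, c a ω
      ≤ ENNReal.ofReal (Fintype.card α * (7 / 10)) + ENNReal.ofReal (1 / S₀) * ∑ a, z a ω := by
    intro ω
    obtain ⟨sk, hsk⟩ : ∃ sk : V → Set V → List Bool, sk = fun v N =>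
      S.sketch (e v) (e '' N) ω := ⟨_, rfl⟩
    obtain ⟨ref, href⟩ : ∃ ref : (V → List Bool) → Bool, ref = fun M =>
      S.referee (M ∘ e.symm) ω := ⟨_, rfl⟩
    have hmsg : ∀ a v, S.message (relabel e (gr a)) ω (e v) = sk v ((gr a).neighborSet v) := by
      intro a v
      rw [SketchingScheme.message, relabel_neighborSet, hsk]
    have hz' : ∀ a, z a ω = ENNReal.ofReal (messageSize sk (gr a)) := by
      intro a
      rw [hz, messageSize, ENNReal.ofReal_sum_of_nonneg fun _ _ => Nat.cast_nonneg _]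
      refine (Fintype.sum_equiv e _ _ fun v => ?_).symm
      rw [hmsg, ENNReal.ofReal_natCast]
    have hc' : ∀ a, c a ω = ENNReal.ofReal (correctness sk ref (gr a)) := by
      intro a
      have hout : S.output (relabel e (gr a)) ω = ref fun v => sk v ((gr a).neighborSet v) := by
        rw [SketchingScheme.output, href]
        simp only
        congr 1
        funext w
        rw [Function.comp_apply, ← hmsg, Equiv.apply_symm_apply]
      rw [hc]
      simp only [Set.indicator_apply, Set.mem_ofPred_eq, Pi.one_apply]
      simp only [hout, relabel_connected_iff]
      rw [correctness]
      split_ifs <;> simp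
    have hc0 : ∀ a, 0 ≤ correctness sk ref (gr a) := by
      intro a; rw [correctness]; split_ifs <;> norm_num
    have hc1 : ∀ a, correctness sk ref (gr a) ≤ 1 := by
      intro a; rw [correctness]; split_ifs <;> norm_num
    have hz0 : ∀ a, 0 ≤ messageSize sk (gr a) := fun a => messageSize_nonneg _ _
    simp_rw [hz', hc']
    rw [← ENNReal.ofReal_sum_of_nonneg fun a _ => hc0 a,
      ← ENNReal.ofReal_sum_of_nonneg fun a _ => hz0 a, ← ENNReal.ofReal_mul (by positivity),
      ← ENNReal.ofReal_add (by positivity)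
        (mul_nonneg (by positivity) (Finset.sum_nonneg fun a _ => hz0 a))]
    refine ENNReal.ofReal_le_ofReal ?_
    have hsz : 0 ≤ ∑ a, messageSize sk (gr a) := Finset.sum_nonneg fun a _ => hz0 a
    by_cases hlt : 𝔼 a, messageSize sk (gr a) < S₀
    · have h1 := hdet sk ref hlt
      rw [Fintype.expect_eq_sum_div_card, div_le_iff₀ hα] at h1
      have : 0 ≤ 1 / S₀ * ∑ a, messageSize sk (gr a) := by positivity
      linarith
    · rw [not_lt, Fintype.expect_eq_sum_div_card, le_div_iff₀ hα] at hlt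
      have h1 : ∑ a, correctness sk ref (gr a) ≤ Fintype.card α := by
        calc _ ≤ ∑ _a : α, (1 : ℝ) := Finset.sum_le_sum fun a _ => hc1 a
          _ = _ := by simp
      have h2 : (Fintype.card α : ℝ) ≤ 1 / S₀ * ∑ a, messageSize sk (gr a) := by
        rw [one_div, ← div_eq_inv_mul, le_div_iff₀ hS₀]
        linarith
      have : (0 : ℝ) ≤ Fintype.card α * (7 / 10) := by positivity
      linarith
  have hint := lintegral_mono (μ := S.μ) hpt
  rw [lintegral_finsetSum _ fun a _ => ?_, lintegral_add_left measurable_const, lintegral_const,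
    measure_univ, mul_one, lintegral_const_mul _ (Finset.measurable_sum _ fun a _ => hzmeas a),
    lintegral_finsetSum _ fun a _ => hzmeas a] at hint
  · obtain ⟨Z, hZ⟩ : ∃ Z : ℝ≥0∞, Z = ∑ a, ∫⁻ ω, z a ω ∂S.μ := ⟨_, rfl⟩
    have hP : ∀ a, ∫⁻ ω, c a ω ∂S.μ = S.successProb (relabel e (gr a)) := by
      intro a
      rw [hc]
      simp only
      rw [lintegral_indicator_one (S.measurableSet_correct _), SketchingScheme.successProb]
    simp_rw [hP] at hint
    rw [← hZ] at hint
    rw [SketchingScheme.successProbOn, tsum_map_uniformOfFintype_mul] at h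
    have hE : S.expectedAverageSizeOn
        ((PMF.uniformOfFintype α).map fun a => relabel e (gr a))
        = (Fintype.card α : ℝ≥0∞)⁻¹ * (Z * (n : ℝ≥0∞)⁻¹) := by
      rw [SketchingScheme.expectedAverageSizeOn, tsum_map_uniformOfFintype_mul, hZ, Finset.sum_mul]
      congr 1
      refine Finset.sum_congr rfl fun a _ => ?_
      rw [SketchingScheme.expectedAverageSize, ← lintegral_mul_const _ (hzmeas a)]
      simp_rw [div_eq_mul_inv]
      rw [hz]
    have hαe : (Fintype.card α : ℝ≥0∞) = ENNReal.ofReal (Fintype.card α) := by simp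
    have hne : (n : ℝ≥0∞) = ENNReal.ofReal n := by simp
    rw [hE]
    by_cases hZt : Z = ⊤
    · rw [hZt, ENNReal.top_mul (by simp), ENNReal.mul_top (by simp)]
      exact le_top
    · have hZr : Z = ENNReal.ofReal Z.toReal := (ENNReal.ofReal_toReal hZt).symm
      have hx0 : 0 ≤ Z.toReal := ENNReal.toReal_nonneg
      rw [hZr] at hint ⊢
      generalize Z.toReal = x at *
      have h2 : (3 / 4 : ℝ≥0∞) = ENNReal.ofReal (3 / 4) := by
        rw [ENNReal.ofReal_div_of_pos (by norm_num)]; simp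
      have h1 := h.trans (mul_le_mul_right hint _)
      rw [hαe, ← ENNReal.ofReal_inv_of_pos hα, ← ENNReal.ofReal_mul (by positivity),
        ← ENNReal.ofReal_add (by positivity) (by positivity), ← ENNReal.ofReal_mul (by positivity),
        h2, ENNReal.ofReal_le_ofReal_iff (by positivity)] at h1
      rw [hαe, hne, ← ENNReal.ofReal_inv_of_pos hα, ← ENNReal.ofReal_inv_of_pos hnpos,
        ← ENNReal.ofReal_mul hx0, ← ENNReal.ofReal_mul (by positivity)]
      refine ENNReal.ofReal_le_ofReal ?_
      rw [inv_mul_eq_div, le_div_iff₀ hα] at h1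
      have h3 : Fintype.card α * (1 / 20) ≤ 1 / S₀ * x := by linarith
      rw [one_div_mul_eq_div, le_div_iff₀ hS₀] at h3
      rw [inv_mul_eq_div, le_div_iff₀ hα, ← div_eq_mul_inv, le_div_iff₀ hnpos]
      refine le_trans (le_of_eq ?_) h3
      field_simp
  · rw [hc]
    exact measurable_one.indicator (S.measurableSet_correct _)

end Randomized

/-- The easy direction of Yao's principle: a mean over `D` is at most the maximum over the finitely
many graphs. -/
theorem exists_le_of_distribution {n : ℕ} {x : ℝ≥0∞} {D : PMF (SimpleGraph (Fin n))}
    (hD : ∀ S : SketchingScheme.{u} n, 3 / 4 ≤ S.successProbOn D → x ≤ S.expectedAverageSizeOn D)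
    (S : SketchingScheme.{u} n) (hS : ∀ G, 3 / 4 ≤ S.successProb G) :
    ∃ G, x ≤ S.expectedAverageSize G := by
  have h1 : 3 / 4 ≤ S.successProbOn D := by
    calc (3 / 4 : ℝ≥0∞) = ∑' G, D G * (3 / 4) := by
          rw [ENNReal.tsum_mul_right, D.tsum_coe, one_mul]
      _ ≤ _ := ENNReal.tsum_le_tsum fun G => mul_le_mul_right (hS G) _
  obtain ⟨G, hG⟩ := Finite.exists_max S.expectedAverageSize
  refine ⟨G, (hD S h1).trans ?_⟩
  calc S.expectedAverageSizeOn D ≤ ∑' G', D G' * S.expectedAverageSize G :=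
        ENNReal.tsum_le_tsum fun G' => mul_le_mul_right (hG G') _
    _ = _ := by rw [ENNReal.tsum_mul_right, D.tsum_coe, one_mul]

/-! ### The input distribution as a mixture of three families. -/

section Mixture

open scoped Classical

set_option linter.unusedSectionVars false

/-- The mixture of three families, with weights `8 / 10`, `1 / 10` and `1 / 10`. -/
def mixture {X₁ X₂ X₃ Γ : Type*} (A : X₁ → Γ) (B : X₂ → Γ) (C : X₃ → Γ)
    (w : Fin 10 × X₁ × X₂ × X₃) : Γ :=
  if (w.1 : ℕ) < 8 then A w.2.1 else if (w.1 : ℕ) = 8 then B w.2.2.1 else C w.2.2.2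

lemma expect_mixture {X₁ X₂ X₃ : Type*} [Fintype X₁] [Fintype X₂] [Fintype X₃] [Nonempty X₁]
    [Nonempty X₂] [Nonempty X₃] {Γ : Type*} (A : X₁ → Γ) (B : X₂ → Γ) (C : X₃ → Γ) (f : Γ → ℝ) :
    𝔼 w, f (mixture A B C w) = (8 * (𝔼 x, f (A x)) + (𝔼 x, f (B x)) + 𝔼 x, f (C x)) / 10 := by
  have h1 : 𝔼 x : X₁ × X₂ × X₃, f (A x.1) = 𝔼 x, f (A x) := by
    rw [expect_prod]
    exact Finset.expect_congr rfl fun x _ => Fintype.expect_const (f (A x))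
  have h2 : 𝔼 x : X₁ × X₂ × X₃, f (B x.2.1) = 𝔼 x, f (B x) := by
    rw [expect_prod]
    simp only
    rw [Fintype.expect_const, expect_prod]
    exact Finset.expect_congr rfl fun x _ => Fintype.expect_const (f (B x))
  have h3 : 𝔼 x : X₁ × X₂ × X₃, f (C x.2.2) = 𝔼 x, f (C x) := by
    rw [expect_prod]
    simp only
    rw [Fintype.expect_const, expect_prod]
    simp only
    rw [Fintype.expect_const]
  rw [expect_prod, Fintype.expect_eq_sum_div_card]
  simp only [mixture, Fin.sum_univ_succ, Fintype.card_fin]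
  simp
  rw [h1, h2, h3]
  ring

-- Each auxiliary family has weight `1 / 10`, so a mean size below `S₀` on the mixture is below `10
-- * S₀` on each of them, which meets the two cost hypotheses.
set_option synthInstance.maxSize 1000 in
theorem exists_distribution_of_embedding {n k s K L C W : ℕ} {Y H R : Type} [Fintype Y]
    [AddCommGroup Y] [Fintype H] [Nonempty H] [Fintype R] {ι : Bool × H → Y}
    (hι : Function.Injective ι) (e : ChainVertex k s Y R ≃ Fin n) {θ δ t T δ₂ S₀ : ℝ}
    (hp : SketchParameters (Fintype.card Y) (Fintype.card H) s K L C W θ δ t T δ₂)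
    (hT : 0 < T) (hS₀ : 0 < S₀)
    (hmid : 10 * S₀ ≤ k * ((s + 1 : ℕ) * Fintype.card Y) * (C / 32)) (hhub : 10 * S₀ ≤ k * (T / 4))
    (hk : Real.exp (-(δ₂ ^ 2 * (k / 2))) ≤ 1 / 4) :
    ∃ D : PMF (SimpleGraph (Fin n)), ∀ S : SketchingScheme.{u} n, 3 / 4 ≤ S.successProbOn D →
      ENNReal.ofReal (S₀ / (20 * n)) ≤ S.expectedAverageSizeOn D := by
  have hL := hp.L_pos
  have hK := hp.two_le_K
  have : Nonempty (Fin L) := ⟨⟨0, hL⟩⟩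
  have : Nonempty (Fin (K ^ L)) := ⟨⟨0, by positivity⟩⟩
  have hn : 0 < n := Fin.pos (e (.inr (.inl (0, true))))
  obtain ⟨g₀⟩ : Nonempty (Fin s) := ⟨⟨0, by have := hp.two_le_s; omega⟩⟩
  obtain ⟨hard, hhard⟩ : ∃ hard : (Fin k → Bool) × (Fin k × Bool → UnitSample s Y H
      (Fin L × (Fin s → Fin (K ^ L)))) → SimpleGraph (ChainVertex k s Y R),
      hard = fun w => hardInput R ι (revealSet K L g₀) w.1 w.2 := ⟨_, rfl⟩
  refine exists_distribution_of_deterministic e hn (mixture hard (midInput R) (hubInput (H := H) R)) hS₀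
    fun sk ref hsize => ?_
  rw [expect_mixture _ _ _ fun G => messageSize sk G] at hsize
  rw [expect_mixture _ _ _ fun G => correctness sk ref G]
  have hc1 : ∀ G, correctness sk ref G ≤ 1 := by
    intro a; rw [correctness]; split_ifs <;> norm_num
  have h0 : ∀ {X : Type} [Fintype X] (g : X → SimpleGraph (ChainVertex k s Y R)),
      0 ≤ 𝔼 x, messageSize sk (g x) :=
    fun g => Finset.expect_nonneg fun x _ => messageSize_nonneg _ _
  have h1 : ∀ {X : Type} [Fintype X] [Nonempty X] (g : X → SimpleGraph (ChainVertex k s Y R)),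
      𝔼 x, correctness sk ref (g x) ≤ 1 :=
    fun g => Finset.expect_le Finset.univ_nonempty fun x _ => hc1 _
  have hs1 := h0 hard
  have hs2 := h0 (midInput (k := k) (s := s) (Y := Y) R)
  have hs3 := h0 (hubInput (k := k) (s := s) (Y := Y) (H := H) R)
  have hc2 := h1 (midInput (k := k) (s := s) (Y := Y) R)
  have hc3 := h1 (hubInput (k := k) (s := s) (Y := Y) (H := H) R)
  have hh := expect_hardInput_correct_le_of_size sk ref hι hp hT g₀ (by linarith) (by linarith)
  have hh' : 𝔼 w, correctness sk ref (hard w) ≤ 1 / 2 + 1 / 2 * Real.exp (-(δ₂ ^ 2 * (k / 2))) := by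
    rw [expect_prod, hhard]
    exact hh
  -- Success is at most `8 / 10 * (1 / 2 + 1 / 8) + 2 / 10 = 7 / 10`, even if the auxiliary inputs
  -- are always decided correctly.
  linarith

theorem exists_distribution_of_parameters {n k q h s K L C W : ℕ} {θ δ t T δ₂ S₀ : ℝ}
    (hp : SketchParameters q h s K L C W θ δ t T δ₂) (hh : 0 < h) (hq : 2 * h ≤ q)
    (hn : 2 * (k * ((s + 1) * q)) + 2 * (k + 1) ≤ n) (hT : 0 < T) (hS₀ : 0 < S₀)
    (hmid : 10 * S₀ ≤ k * ((s + 1 : ℕ) * q) * (C / 32)) (hhub : 10 * S₀ ≤ k * (T / 4))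
    (hk : Real.exp (-(δ₂ ^ 2 * (k / 2))) ≤ 1 / 4) :
    ∃ D : PMF (SimpleGraph (Fin n)), ∀ S : SketchingScheme.{u} n, 3 / 4 ≤ S.successProbOn D →
      ENNReal.ofReal (S₀ / (20 * n)) ≤ S.expectedAverageSizeOn D := by
  have : NeZero q := ⟨by omega⟩
  have : Nonempty (Fin h) := ⟨⟨0, hh⟩⟩
  obtain ⟨ι⟩ : Nonempty (Bool × Fin h ↪ ZMod q) :=
    Function.Embedding.nonempty_of_card_le (by simpa [ZMod.card] using hq)
  -- The surplus vertices form `R`, so that every large `n` is covered.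
  obtain ⟨e⟩ : Nonempty (ChainVertex k s (ZMod q)
      (Fin (n - (2 * (k * ((s + 1) * q)) + 2 * (k + 1)))) ≃ Fin n) := by
    refine ⟨Fintype.equivFinOfCardEq ?_⟩
    simp only [Fintype.card_sum, Fintype.card_prod, Fintype.card_fin, Fintype.card_bool, ZMod.card]
    have : k * 2 * ((s + 1) * q) = 2 * (k * ((s + 1) * q)) := by ring
    omega
  refine exists_distribution_of_embedding (K := K) (L := L) (C := C) (W := W) (θ := θ) (δ := δ) (t := t)
    ι.injective e ?_ hT hS₀ ?_ hhub hk
  · rw [ZMod.card, Fintype.card_fin]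
    exact hp
  · rw [ZMod.card]
    exact hmid

end Mixture

/-! ### Choice of the parameters as powers of `b` and of `l = log b`. -/

section Parameters

set_option linter.unusedSectionVars false

lemma one_sub_inv_pow_ge {K J : ℕ} (hK : 2 ≤ K) :
    Real.exp (-(2 * J)) ≤ (1 - 1 / K : ℝ) ^ (K * J) := by
  have hKpos : (0 : ℝ) < K := by exact_mod_cast (by omega : 0 < K)
  have hK2 : (2 : ℝ) ≤ K := by exact_mod_cast hK
  have h1 : Real.exp (-(2 / K)) ≤ (1 - 1 / K : ℝ) := by
    have h2 := Real.add_one_le_exp (2 / (K : ℝ))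
    rw [Real.exp_neg, inv_le_comm₀ (Real.exp_pos _)
      (by rw [sub_pos, div_lt_one hKpos]; linarith)]
    refine le_trans ?_ h2
    have hy : (0 : ℝ) < 1 - 1 / K := by rw [sub_pos, div_lt_one hKpos]; linarith
    rw [inv_le_iff_one_le_mul₀ hy]
    have : (1 : ℝ) / K ≤ 1 / 2 := one_div_le_one_div_of_le (by norm_num) hK2
    have h0 : (0 : ℝ) ≤ 1 / K := by positivity
    rw [show (2 : ℝ) / K = 2 * (1 / K) by ring]
    nlinarith
  calc Real.exp (-(2 * J)) = Real.exp (-(2 / K)) ^ (K * J) := by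
        rw [← Real.exp_nat_mul]
        congr 1
        push_cast
        field_simp
    _ ≤ _ := pow_le_pow_left₀ (Real.exp_pos _).le h1 _

lemma one_sub_pow_le_exp {x : ℝ} (hx : x ≤ 1) (s : ℕ) : (1 - x) ^ s ≤ Real.exp (-(s * x)) := by
  calc (1 - x) ^ s ≤ Real.exp (-x) ^ s := by
        refine pow_le_pow_left₀ (by linarith) ?_ _
        have := Real.add_one_le_exp (-x)
        linarith
    _ = _ := by
        rw [← Real.exp_nat_mul]
        congr 1
        ring

/-- Parameters for groups of size `b ^ 13`, given a bound `T` for the hub cost. -/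
theorem sketchParameters_of_log {b K J : ℕ} {l E T : ℝ} (hl : l = Real.log b) (hl100 : 100 ≤ l)
    (hE : E = Real.exp (l / 8)) (hlE : 1000 * l ^ 3 ≤ E) (hK : K = ⌊l / 16⌋₊) (hJ : J = ⌊l / 4⌋₊)
    (hT : T ≤ b ^ 14 * l ^ 3) :
    SketchParameters (b ^ 13) (b ^ 3) b K (K * J) ⌊l ^ 3 / 2048⌋₊ (b ^ 6) (1 / (5 * b ^ 11))
      (Real.exp (-(2 * K)) / (8 * (K * J : ℕ))) (1 / b) T
      (Real.exp (-(2 * K)) / (32 * (K * J : ℕ))) ∧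
    1 / (E * l ^ 2) ≤ Real.exp (-(2 * K)) / (32 * (K * J : ℕ)) := by
  have hl0 : 0 < l := by linarith
  have hEpos : 0 < E := by rw [hE]; exact Real.exp_pos _
  have hbpos : (0 : ℝ) < b := by
    rcases Nat.eq_zero_or_pos b with rfl | h
    · simp at hl; linarith
    · exact_mod_cast h
  -- `E` is the eighth root of `b`; the estimates below compare powers of `E`, and powers of `l` are
  -- absorbed by `E`.
  have hbE : (b : ℝ) = E ^ 8 := by
    rw [hE, ← Real.exp_nat_mul]
    rw [show ((8 : ℕ) : ℝ) * (l / 8) = l by push_cast; ring, hl, Real.exp_log hbpos]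
  have hl2 : 10000 ≤ l ^ 2 := by nlinarith
  have hl3 : 1000000 ≤ l ^ 3 := by nlinarith
  have hE9 : 1000000000 ≤ E := by linarith
  have hl2E : l ^ 2 ≤ E := by nlinarith
  have hlE' : l ≤ E := by nlinarith
  have hE2 : E ≤ E ^ 2 := by nlinarith
  have hE1 : 1 ≤ E := by linarith
  have hpow : ∀ m n : ℕ, m ≤ n → E ^ m ≤ E ^ n := fun m n h => pow_le_pow_right₀ hE1 h
  have hK1 : (K : ℝ) ≤ l / 16 := by rw [hK]; exact Nat.floor_le (by positivity)
  have hK2 : l / 16 < K + 1 := by rw [hK]; exact Nat.lt_floor_add_one _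
  have hJ1 : (J : ℝ) ≤ l / 4 := by rw [hJ]; exact Nat.floor_le (by positivity)
  have hJ2 : l / 4 < J + 1 := by rw [hJ]; exact Nat.lt_floor_add_one _
  have hK3 : l / 32 ≤ K := by linarith
  have hJ3 : l / 8 ≤ J := by linarith
  have hKge : 2 ≤ K := by
    have : (2 : ℝ) ≤ K := by linarith
    exact_mod_cast this
  have hJge : 2 ≤ J := by
    have : (2 : ℝ) ≤ J := by linarith
    exact_mod_cast this
  have hKpos : (0 : ℝ) < K := by linarith
  obtain ⟨L, hLdef⟩ : ∃ L : ℕ, L = K * J := ⟨_, rfl⟩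
  have hLr : (L : ℝ) = K * J := by rw [hLdef]; push_cast; ring
  have hL1 : (L : ℝ) ≤ l ^ 2 / 64 := by rw [hLr]; nlinarith
  have hL2 : l ^ 2 / 256 ≤ L := by
    rw [hLr]
    calc l ^ 2 / 256 = l / 32 * (l / 8) := by ring
      _ ≤ K * J := mul_le_mul hK3 hJ3 (by positivity) hKpos.le
  have hLpos : (0 : ℝ) < L := by linarith
  have hexp : Real.exp (2 * K) ≤ E := by
    rw [hE]; exact Real.exp_le_exp.2 (by linarith)
  have hexp' : 1 / E ≤ Real.exp (-(2 * K)) := by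
    rw [Real.exp_neg, one_div]
    exact inv_anti₀ (Real.exp_pos _) hexp
  have hexp1 : Real.exp (-(2 * (K : ℝ))) ≤ 1 := Real.exp_le_one_iff.2 (by linarith)
  -- The common scale of the small quantities: the leftover density is `r / 8` and the overlap `r /
  -- 32`.
  obtain ⟨r, hr⟩ : ∃ r : ℝ, r = Real.exp (-(2 * K)) / L := ⟨_, rfl⟩
  have hr1 : 64 / (E * l ^ 2) ≤ r := by
    rw [hr]
    calc 64 / (E * l ^ 2) = 1 / E / (l ^ 2 / 64) := by field_simp
      _ ≤ _ := by gcongr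
  have hrpos : 0 < r := lt_of_lt_of_le (by positivity) hr1
  have hrle : r ≤ 1 := by
    rw [hr, div_le_one hLpos]
    linarith
  have hδ : Real.exp (-(2 * K)) / (8 * (K * J : ℕ)) = r / 8 := by
    rw [← hLdef, hr]; field_simp
  have hδ₂ : Real.exp (-(2 * K)) / (32 * (K * J : ℕ)) = r / 32 := by
    rw [← hLdef, hr]; field_simp
  have hrE2 : 64 / E ^ 2 ≤ r := by
    refine le_trans ?_ hr1
    rw [sq]
    gcongr
  -- The gain per captured coordinate is `b ^ 2 * r / 40`, and `r` is at least `64 / E ^ 2`, so the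
  -- gain exceeds `b`.
  have hgain : (b : ℝ) ≤ ((b ^ 13 : ℕ) : ℝ) * (1 / (5 * b ^ 11) * (r / 8)) := by
    have e : ((b ^ 13 : ℕ) : ℝ) * (1 / (5 * b ^ 11) * (r / 8)) = b * (b * r / 40) := by
      push_cast; field_simp; ring
    rw [e]
    refine le_mul_of_one_le_right hbpos.le ?_
    have h1 : E ^ 8 * (64 / E ^ 2) ≤ b * r := by rw [hbE]; gcongr
    have h2 : E ^ 8 * (64 / E ^ 2) = 64 * E ^ 6 := by field_simp
    have h3 := hpow 1 6 (by norm_num)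
    linarith
  have hbone : (1 : ℝ) ≤ b := by
    rw [hbE]; exact one_le_pow₀ hE1
  have hC1 : ((⌊l ^ 3 / 2048⌋₊ : ℕ) : ℝ) ≤ l ^ 3 / 2048 := Nat.floor_le (by positivity)
  refine ⟨?_, ?_⟩
  swap
  · rw [hδ₂]
    refine le_trans ?_ (show 64 / (E * l ^ 2) / 32 ≤ r / 32 by gcongr)
    rw [div_div, div_le_div_iff₀ (by positivity) (by positivity)]
    have : 0 ≤ E * l ^ 2 := by positivity
    linarith
  rw [hδ, hδ₂, ← hLdef]
  have hsmall : 1 / (K : ℝ) ≤ 1 := by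
    rw [div_le_one hKpos]; exact_mod_cast (by omega : 1 ≤ K)
  -- Even after all `L` rounds a group stays unrevealed with probability at least `b ^ (-1/2)`, so
  -- with `b` groups the full set is very unlikely.
  have hyL : 1 / E ^ 4 ≤ (1 - 1 / K : ℝ) ^ L := by
    rw [hLdef]
    refine le_trans ?_ (one_sub_inv_pow_ge hKge)
    rw [Real.exp_neg, one_div]
    refine inv_anti₀ (Real.exp_pos _) ?_
    rw [hE, ← Real.exp_nat_mul]
    refine Real.exp_le_exp.2 ?_
    push_cast
    linarith
  have hyL1 : (1 - 1 / K : ℝ) ^ L ≤ 1 :=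
    pow_le_one₀ (by linarith) (by have : (0 : ℝ) ≤ 1 / K := by positivity
                                  linarith)
  refine
    { two_le_K := hKge
      L_pos := by rw [hLdef]; positivity
      two_le_s := ?_
      θ_pos := by positivity
      δ_nonneg := by positivity
      δ_le_one := by linarith
      spread_le := ?_
      one_le_gain := hbone.trans hgain
      leftover_le := ?_
      trivial_le := ?_
      gain_ge := ?_
      C_pos := ?_
      W_pos := ?_
      t_pos := by positivity
      t_le := ?_
      overlap_nonneg := by positivity
      overlap_le_one := by linarith
      overlap_le := ?_ }
  · have : (2 : ℝ) ≤ b := by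
      rw [hbE]
      have := hpow 1 8 (by norm_num)
      linarith
    exact_mod_cast this
  -- The base is `1 + 1 / (5 * b)`, whose power `b` is at most `exp (1 / 5) ≤ 5 / 4`.
  · have e : 1 + ((b ^ 13 : ℕ) : ℝ) / (b ^ 3 : ℕ) * (1 / (5 * b ^ 11)) = 1 - -(1 / (5 * b)) := by
      push_cast; field_simp; ring
    rw [e]
    refine (one_sub_pow_le_exp (by have : (0 : ℝ) ≤ 1 / (5 * b) := by positivity
                                   linarith) b).trans ?_
    rw [show -((b : ℝ) * -(1 / (5 * b))) = 1 / 5 by field_simp]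
    have h1 : Real.exp (1 / 5) ^ 5 ≤ (5 / 4) ^ 5 := by
      rw [← Real.exp_nat_mul]
      have := Real.exp_one_lt_d9
      norm_num
      linarith
    exact le_of_pow_le_pow_left₀ (by norm_num) (by norm_num) h1
  · rw [hr, Real.exp_neg]
    have := Real.exp_pos (2 * (K : ℝ))
    refine le_of_eq ?_
    field_simp
  · have h1 : (1 - 1 / K : ℝ) ^ b ≤ Real.exp (-E ^ 4) := by
      refine (one_sub_pow_le_exp hsmall b).trans (Real.exp_le_exp.2 (neg_le_neg ?_))
      have hKE : (K : ℝ) ≤ E := by linarith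
      rw [hbE, mul_one_div, le_div_iff₀ hKpos]
      calc E ^ 4 * K ≤ E ^ 4 * E := by gcongr
        _ = E ^ 5 := by ring
        _ ≤ E ^ 8 := hpow 5 8 (by norm_num)
    have h2 : (1 - (1 - 1 / K : ℝ) ^ L) ^ b ≤ Real.exp (-E ^ 4) := by
      refine (one_sub_pow_le_exp hyL1 b).trans (Real.exp_le_exp.2 (neg_le_neg ?_))
      calc E ^ 4 = E ^ 8 * (1 / E ^ 4) := by field_simp
        _ ≤ _ := by rw [hbE]; gcongr
    have h3 : Real.exp (-E ^ 4) ≤ 1 / E ^ 4 := by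
      rw [Real.exp_neg, one_div]
      refine inv_anti₀ (by positivity) ?_
      have := Real.add_one_le_exp (E ^ 4)
      linarith
    calc Real.exp (2 * K) * (L * ((1 - 1 / K : ℝ) ^ b + (1 - (1 - 1 / K : ℝ) ^ L) ^ b))
        ≤ E * (E * (1 / E ^ 4 + 1 / E ^ 4)) := by
          have h4 : 0 ≤ 1 - 1 / (K : ℝ) := by linarith
          have h5 : 0 ≤ 1 - (1 - 1 / (K : ℝ)) ^ L := by linarith
          exact mul_le_mul hexp (mul_le_mul (by linarith) (add_le_add (h1.trans h3) (h2.trans h3))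
            (by positivity) hEpos.le) (by positivity) hEpos.le
      _ = 2 / E ^ 2 := by field_simp; ring
      _ ≤ 1 / 8 := by
          rw [div_le_div_iff₀ (by positivity) (by norm_num)]
          linarith
  -- The gain is at least `exp (l * L / 4) ≥ exp (l ^ 3 / 1024)`. The cubic logarithm arises here;
  -- taking `C` near `l ^ 3 / 2048` leaves room for the three extra factors of two.
  · have hL4 : (L : ℝ) / 4 ≤ (L / 2 : ℕ) := by
      have h1 : L ≤ 2 * (L / 2) + 1 := by omega
      have h2 : (L : ℝ) ≤ 2 * (L / 2 : ℕ) + 1 := by exact_mod_cast h1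
      linarith
    have h1 : (b : ℝ) ^ (L / 2) ≤ (((b ^ 13 : ℕ) : ℝ) * (1 / (5 * b ^ 11) * (r / 8))) ^ (L / 2) :=
      pow_le_pow_left₀ hbpos.le hgain _
    refine le_trans ?_ h1
    have h2 : (2 : ℝ) ^ (⌊l ^ 3 / 2048⌋₊ + 1) * 4 = 2 ^ (⌊l ^ 3 / 2048⌋₊ + 3) := by
      rw [pow_succ, pow_add]; ring
    have h3 : (2 : ℝ) ^ (⌊l ^ 3 / 2048⌋₊ + 3) ≤ Real.exp (l ^ 3 / 1024) := by
      calc (2 : ℝ) ^ (⌊l ^ 3 / 2048⌋₊ + 3) ≤ Real.exp 1 ^ (⌊l ^ 3 / 2048⌋₊ + 3) := by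
            refine pow_le_pow_left₀ (by norm_num) ?_ _
            have := Real.add_one_le_exp (1 : ℝ)
            linarith
        _ = Real.exp ((⌊l ^ 3 / 2048⌋₊ + 3 : ℕ) : ℝ) := by rw [← Real.exp_nat_mul, mul_one]
        _ ≤ _ := by
            refine Real.exp_le_exp.2 ?_
            push_cast
            linarith
    rw [h2]
    refine h3.trans ?_
    have h4 : (b : ℝ) = Real.exp l := by rw [hl, Real.exp_log hbpos]
    rw [h4, ← Real.exp_nat_mul]
    refine Real.exp_le_exp.2 ?_
    have h5 : l ^ 2 / 1024 ≤ (L / 2 : ℕ) := by linarith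
    calc l ^ 3 / 1024 = l ^ 2 / 1024 * l := by ring
      _ ≤ _ := mul_le_mul_of_nonneg_right h5 hl0.le
  · exact Nat.floor_pos.2 (by linarith)
  · have : 0 < b := by exact_mod_cast hbpos
    positivity
  · rw [div_le_div_iff₀ hbpos (by norm_num), hbE]
    have := hpow 1 8 (by norm_num)
    linarith
  -- Leakage and long hub messages cost at most `1 / E ^ 2 ≤ r / 64`, which reduces `r / 16` to no
  -- less than `r / 32`.
  · have e1 : ((b : ℝ) * (2 * (b ^ 3 : ℕ))) * ((b ^ 6 : ℕ) + 1) / (1 / b * (b ^ 13 : ℕ))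
        = 2 * (b ^ 6 + 1) / b ^ 8 := by
      push_cast; field_simp
    have e2 : 2 * ((2 * ((b ^ 3 : ℕ) : ℝ)) * T / ((b ^ 13 : ℕ) * (b ^ 6 : ℕ))) = 4 * T / b ^ 16 := by
      push_cast; field_simp; ring
    rw [e1, e2]
    have h1 : 2 * ((b : ℝ) ^ 6 + 1) / b ^ 8 ≤ 4 / b := by
      rw [div_le_div_iff₀ (by positivity) hbpos]
      have h : (1 : ℝ) ≤ b ^ 6 := one_le_pow₀ hbone
      have h' : (b : ℝ) ^ 7 ≤ b ^ 8 := pow_le_pow_right₀ hbone (by norm_num)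
      have h'' : (b : ℝ) ≤ b ^ 8 := le_self_pow₀ hbone (by norm_num)
      have e3 : 2 * ((b : ℝ) ^ 6 + 1) * b = 2 * b ^ 7 + 2 * b := by ring
      linarith
    have h2 : 4 * T / (b : ℝ) ^ 16 ≤ 4 * l ^ 3 / b := by
      rw [div_le_div_iff₀ (by positivity) hbpos]
      have h' : (b : ℝ) ^ 15 ≤ b ^ 16 := pow_le_pow_right₀ hbone (by norm_num)
      have h3 : 0 ≤ l ^ 3 := by positivity
      calc 4 * T * b ≤ 4 * (b ^ 14 * l ^ 3) * b := by gcongr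
        _ = 4 * l ^ 3 * b ^ 15 := by ring
        _ ≤ 4 * l ^ 3 * b ^ 16 := by gcongr
    have h3 : (8 + 4 * l ^ 3) / b ≤ 1 / E ^ 2 := by
      rw [hbE, div_le_div_iff₀ (by positivity) (by positivity), one_mul]
      have := hpow 3 8 (by norm_num)
      calc (8 + 4 * l ^ 3) * E ^ 2 ≤ E * E ^ 2 := by gcongr; linarith
        _ = E ^ 3 := by ring
        _ ≤ _ := this
    have h4 : 64 * (1 / E ^ 2) ≤ r := by rw [mul_one_div]; exact hrE2
    have h5 : Real.exp (-(2 * (K : ℝ))) / (8 * L) / 2 = r / 16 := by rw [hr]; field_simp; norm_num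
    have h6 : 4 * (1 / (b : ℝ)) = 4 / b := by ring
    have h7 : (8 + 4 * l ^ 3) / (b : ℝ) = 4 / b + 4 / b + 4 * l ^ 3 / b := by ring
    rw [h5, h6]
    linarith

end Parameters

/-! ### Fitting the construction to a given number of vertices. -/

section Main

lemma exists_pow_le_lt (m n : ℕ) (hm : 0 < m) : ∃ b : ℕ, b ^ m ≤ n ∧ n < (b + 1) ^ m := by
  refine ⟨Nat.findGreatest (fun b => b ^ m ≤ n) n,
    Nat.findGreatest_spec (P := fun b => b ^ m ≤ n) (Nat.zero_le n) ?_, ?_⟩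
  · rw [zero_pow hm.ne']
    exact Nat.zero_le n
  · by_contra h
    rw [not_lt] at h
    have h1 := (Nat.le_self_pow hm.ne' _).trans h
    have := Nat.le_findGreatest (P := fun b => b ^ m ≤ n) h1 h
    omega

lemma mul_pow_three_le_exp {l : ℝ} (hl : 100000000 ≤ l) : 1000 * l ^ 3 ≤ Real.exp (l / 8) := by
  have h1 := Real.pow_div_factorial_le_exp (l / 8) (by linarith) 4
  refine le_trans ?_ h1
  have h2 : ((Nat.factorial 4 : ℕ) : ℝ) = 24 := by norm_num [Nat.factorial]
  rw [h2, show (l / 8) ^ 4 / 24 = l / 98304 * l ^ 3 by ring]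
  have : 0 ≤ l ^ 3 := by positivity
  refine mul_le_mul_of_nonneg_right ?_ this
  linarith

theorem exists_distribution_of_pow_le {n b : ℕ} {l : ℝ} (hl : l = Real.log b)
    (hl8 : 100000000 ≤ l) (hn : b ^ 20 ≤ n) :
    ∃ D : PMF (SimpleGraph (Fin n)), ∀ S : SketchingScheme.{u} n, 3 / 4 ≤ S.successProbOn D →
      ENNReal.ofReal (1 / 2 ^ 28 * l ^ 3) ≤ S.expectedAverageSizeOn D := by
  have hlE := mul_pow_three_le_exp hl8
  obtain ⟨E, hE⟩ : ∃ E : ℝ, E = Real.exp (l / 8) := ⟨_, rfl⟩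
  rw [← hE] at hlE
  have hl0 : 0 < l := by linarith
  have hEpos : 0 < E := by rw [hE]; exact Real.exp_pos _
  have hb0 : 0 < b := by
    rcases Nat.eq_zero_or_pos b with rfl | h
    · simp at hl; linarith
    · exact h
  have hbpos : (0 : ℝ) < b := by exact_mod_cast hb0
  have hbE : (b : ℝ) = E ^ 8 := by
    rw [hE, ← Real.exp_nat_mul]
    rw [show ((8 : ℕ) : ℝ) * (l / 8) = l by push_cast; ring, hl, Real.exp_log hbpos]
  have hl2 : 10000 ≤ l ^ 2 := by nlinarith
  have hl3 : 1000000 ≤ l ^ 3 := by nlinarith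
  have hE9 : 1000000000 ≤ E := by linarith
  have hE1 : 1 ≤ E := by linarith
  have hEb : E ≤ b := by rw [hbE]; exact le_self_pow₀ hE1 (by norm_num)
  have hb16 : (1000000000 : ℝ) ≤ b := by linarith
  have hb16' : 1000000000 ≤ b := by exact_mod_cast hb16
  -- The number of vertices of one unit.
  obtain ⟨m, hm⟩ : ∃ m : ℕ, m = (b + 1) * b ^ 13 := ⟨_, rfl⟩
  have hm2 : m ≤ 2 * b ^ 14 := by
    rw [hm, show 2 * b ^ 14 = (b + b) * b ^ 13 by ring]
    exact Nat.mul_le_mul_right _ (by omega)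
  have hmpos : 0 < m := by rw [hm]; positivity
  have hmn : 8 * m * b ^ 5 ≤ n := by
    refine le_trans ?_ hn
    calc 8 * m * b ^ 5 ≤ 8 * (2 * b ^ 14) * b ^ 5 := by gcongr
      _ = 16 * b ^ 19 := by ring
      _ ≤ b * b ^ 19 := by gcongr; omega
      _ = b ^ 20 := by ring
  have hb5 : 1 ≤ b ^ 5 := Nat.one_le_pow _ _ hb0
  have hm8n : 8 * m ≤ n := by nlinarith
  -- The `2 * k` units occupy at most half of the vertices, but at least a quarter of them, by
  -- `hk3`.
  obtain ⟨k, hk⟩ : ∃ k : ℕ, k = n / (4 * m) := ⟨_, rfl⟩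
  have hk1 : k * (4 * m) ≤ n := by rw [hk]; exact Nat.div_mul_le_self _ _
  have hk2 : n < (k + 1) * (4 * m) := by
    rw [hk, mul_comm]
    exact Nat.lt_mul_div_succ n (by omega)
  have hk3 : n ≤ 8 * (k * m) := by nlinarith
  have hk4 : b ^ 5 ≤ k := by
    rw [hk, Nat.le_div_iff_mul_le (by omega)]
    nlinarith
  have hkpos : 0 < k := by omega
  have hkr : (0 : ℝ) < k := by exact_mod_cast hkpos
  have hnpos : (0 : ℝ) < n := by exact_mod_cast (by omega : 0 < n)
  have hk3r : (n : ℝ) ≤ 8 * (k * m) := by exact_mod_cast hk3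
  obtain ⟨C, hC⟩ : ∃ C : ℕ, C = ⌊l ^ 3 / 2048⌋₊ := ⟨_, rfl⟩
  have hC1 : (C : ℝ) ≤ l ^ 3 / 2048 := by rw [hC]; exact Nat.floor_le (by positivity)
  have hC2 : l ^ 3 / 4096 ≤ C := by
    have : l ^ 3 / 2048 < C + 1 := by rw [hC]; exact Nat.lt_floor_add_one _
    linarith
  have hCpos : (0 : ℝ) < C := by linarith
  -- Chosen so that `k * (T / 4)` is exactly `10 * S₀` for `S₀ = n * C / 2560`.
  obtain ⟨T, hT⟩ : ∃ T : ℝ, T = n * C / (64 * k) := ⟨_, rfl⟩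
  have hTle : T ≤ b ^ 14 * l ^ 3 := by
    rw [hT, div_le_iff₀ (by positivity)]
    have hm2r : (m : ℝ) ≤ 2 * b ^ 14 := by exact_mod_cast hm2
    have h3 : 0 ≤ l ^ 3 := by positivity
    calc (n : ℝ) * C ≤ 8 * (k * (2 * b ^ 14)) * l ^ 3 :=
          mul_le_mul (hk3r.trans (by gcongr)) (by linarith) hCpos.le (by positivity)
      _ = b ^ 14 * l ^ 3 * (16 * k) := by ring
      _ ≤ b ^ 14 * l ^ 3 * (64 * k) := by gcongr; norm_num
  obtain ⟨hp, hover⟩ := sketchParameters_of_log hl (by linarith) hE hlE rfl rfl hTle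
  rw [← hC] at hp
  refine (exists_distribution_of_parameters.{u} (n := n) (k := k) (S₀ := n * C / 2560) hp
    (by positivity) ?_ ?_ (by rw [hT]; positivity) (by positivity) ?_ ?_ ?_).imp
    fun D hD S hS => le_trans (ENNReal.ofReal_le_ofReal ?_) (hD S hS)
  · calc 2 * b ^ 3 ≤ b * b ^ 3 := Nat.mul_le_mul_right _ (by omega)
      _ = b ^ 4 := by ring
      _ ≤ b ^ 13 := Nat.pow_le_pow_right hb0 (by norm_num)
  · rw [← hm]
    have h1 : b + 1 ≤ m := hm ▸ Nat.le_mul_of_pos_right _ (by positivity)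
    have h2 : k * 2 ≤ k * m := Nat.mul_le_mul_left k (by omega)
    have h3 : 4 * (k * m) ≤ n := le_of_eq_of_le (by ring) hk1
    omega
  · have e : ((k : ℝ) * ((b + 1 : ℕ) * (b ^ 13 : ℕ))) = k * m := by rw [hm]; push_cast; ring
    rw [e]
    have h := mul_le_mul_of_nonneg_right hk3r (show (0 : ℝ) ≤ C / 256 by positivity)
    linarith
  · rw [hT]
    refine le_of_eq ?_
    field_simp
    norm_num
  · generalize Real.exp (-(2 * (⌊l / 16⌋₊ : ℝ))) / (32 * (⌊l / 16⌋₊ * ⌊l / 4⌋₊ : ℕ)) = d at hover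
    have hl2E : l ^ 2 ≤ E := by nlinarith
    have h1 : 1 / E ^ 2 ≤ d := by
      refine le_trans ?_ hover
      rw [sq E]
      gcongr
    have h2 : 1 / E ^ 4 ≤ d ^ 2 := by
      calc 1 / E ^ 4 = (1 / E ^ 2) ^ 2 := by field_simp
        _ ≤ _ := pow_le_pow_left₀ (by positivity) h1 _
    have h3 : E ^ 40 ≤ k := by
      have : (b : ℝ) ^ 5 ≤ k := by exact_mod_cast hk4
      rw [hbE, ← pow_mul] at this
      exact this
    have h4 : 2 ≤ d ^ 2 * (k / 2) := by
      calc (2 : ℝ) ≤ E / 2 := by linarith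
        _ ≤ E ^ 36 / 2 := by gcongr; exact le_self_pow₀ hE1 (by norm_num)
        _ = 1 / E ^ 4 * (E ^ 40 / 2) := by field_simp
        _ ≤ _ := by gcongr
    rw [Real.exp_neg, one_div]
    refine inv_anti₀ (by norm_num) ?_
    have h5 : Real.exp 2 ≤ Real.exp (d ^ 2 * (k / 2)) := Real.exp_le_exp.2 h4
    refine le_trans ?_ h5
    rw [show (2 : ℝ) = 1 + 1 by norm_num, Real.exp_add]
    have := Real.exp_one_gt_d9
    nlinarith
  · rw [show (n : ℝ) * C / 2560 / (20 * n) = C / 51200 by field_simp; norm_num]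
    have : 0 ≤ l ^ 3 := by positivity
    norm_num
    linarith

end Main

end

theorem theorem1 :
    ∃ c : ℝ, 0 < c ∧ ∃ n₀ : ℕ, ∀ n : ℕ, n₀ ≤ n →
      (∀ S : SketchingScheme.{u} n,
        (∀ G : SimpleGraph (Fin n), 3 / 4 ≤ S.successProb G) →
        ∃ G : SimpleGraph (Fin n),
          ENNReal.ofReal (c * Real.log n ^ 3) ≤ S.expectedAverageSize G) ∧
      (∃ D : PMF (SimpleGraph (Fin n)), ∀ S : SketchingScheme.{u} n,
        3 / 4 ≤ S.successProbOn D →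
        ENNReal.ofReal (c * Real.log n ^ 3) ≤ S.expectedAverageSizeOn D) := by
  obtain ⟨b₀, hb₀⟩ := exists_nat_ge (Real.exp 100000000)
  -- The divisor `64000 = 40 ^ 3` comes from `log n ≤ 40 * log b`.
  refine ⟨1 / 2 ^ 28 / 64000, by positivity, b₀ ^ 20, fun n hn => ?_⟩
  obtain ⟨b, hb1, hb2⟩ := exists_pow_le_lt 20 n (by norm_num)
  have hbb : b₀ ≤ b := by
    by_contra h
    have : (b + 1) ^ 20 ≤ b₀ ^ 20 := Nat.pow_le_pow_left (by omega) _
    omega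
  have hb : Real.exp 100000000 ≤ b := hb₀.trans (by exact_mod_cast hbb)
  have hb2' : (2 : ℝ) ≤ b := by
    have := Real.add_one_le_exp (100000000 : ℝ)
    linarith
  have hbpos : (0 : ℝ) < b := by linarith
  have hl : 100000000 ≤ Real.log b := (Real.le_log_iff_exp_le hbpos).2 hb
  have hnpos : (1 : ℝ) ≤ n := by
    have : 1 ≤ b ^ 20 := Nat.one_le_pow _ _ (by exact_mod_cast hbpos)
    exact_mod_cast this.trans hb1
  have hlog : Real.log n ≤ 40 * Real.log b := by
    have hb2r : (n : ℝ) ≤ ((b : ℝ) + 1) ^ 20 := by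
      have := Nat.cast_le (α := ℝ) |>.2 hb2.le
      rwa [Nat.cast_pow, Nat.cast_add, Nat.cast_one] at this
    have h1 : (n : ℝ) ≤ b ^ 40 := by
      have h3 : (b : ℝ) + 1 ≤ b ^ 2 := by
        have := mul_le_mul_of_nonneg_right hb2' hbpos.le
        rw [sq]
        linarith
      calc (n : ℝ) ≤ ((b : ℝ) + 1) ^ 20 := hb2r
        _ ≤ (b ^ 2) ^ 20 := pow_le_pow_left₀ (by linarith) h3 20
        _ = b ^ 40 := by rw [← pow_mul]
    calc Real.log n ≤ Real.log ((b : ℝ) ^ 40) := Real.log_le_log (by linarith) h1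
      _ = _ := by rw [Real.log_pow]; norm_num
  have hle : ENNReal.ofReal (1 / 2 ^ 28 / 64000 * Real.log n ^ 3)
      ≤ ENNReal.ofReal (1 / 2 ^ 28 * Real.log b ^ 3) := by
    refine ENNReal.ofReal_le_ofReal ?_
    have h1 : Real.log n ^ 3 ≤ (40 * Real.log b) ^ 3 :=
      pow_le_pow_left₀ (Real.log_nonneg hnpos) hlog _
    rw [mul_pow] at h1
    norm_num at h1
    linarith
  obtain ⟨D, hD⟩ := exists_distribution_of_pow_le.{u} (n := n) rfl hl hb1
  have hD' : ∀ S : SketchingScheme.{u} n, 3 / 4 ≤ S.successProbOn D →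
      ENNReal.ofReal (1 / 2 ^ 28 / 64000 * Real.log n ^ 3) ≤ S.expectedAverageSizeOn D :=
    fun S hS => hle.trans (hD S hS)
  exact ⟨fun S hS => exists_le_of_distribution hD' S hS, D, hD'⟩
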